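/- **Setting.** Let $d\ge 1$, $K\ge 2$, $T\ge 2$, let $\mathcal X\subseteq\mathbb R^d$ be compact and let $\mathcal D$ be a probability distribution on $\mathcal X$ with $\|X\|_2\le 1$ almost surely and $\mathbf\Sigma=\mathbb E_{X\sim\mathcal D}[XX^\top]\succ 0$; write $\lambda=\lambda_{\min}(\mathbf\Sigma)$. In round $t=1,\dots,T$ a context $X_t\sim\mathcal D$ is drawn (independently over rounds and of the losses), the learner observes $X_t$, chooses $A_t\in[K]$ and observes the loss $\ell_t(X_t,A_t)$. In the *adversarial regime* $\ell_t(x,a)=\langle x,\theta_{t,a}\rangle$ with deterministic (oblivious) $\theta_{t,a}\in\mathbb R^d$. In the *corrupted stochastic regime* with corruption level $C$, $\ell_t(x,a)=\langle x,\theta_{t,a}\rangle+\varepsilon_t(x,a)$, where $\varepsilon_t$ is zero-mean noise, independent over rounds and of contexts and of the learner's randomness, the $\theta_{t,a}$ are deterministic, and there are fixed vectors $\theta_1,\dots,\theta_K$ with $\sum_{t=1}^T\max_a\|\theta_{t,a}-\theta_a\|_2\le C$ ($C=0$ is the stochastic regime). In both regimes $\|\theta_{t,a}\|_2\le1$ and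 $\ell_t(x,a)\in[-1,1]$ for all $x\in\mathcal X$. Let $\pi^*$ be a (measurable) policy with $\pi^*(x)\in\arg\min_a\mathbb E[\sum_{t=1}^T\ell_t(x,a)]$ for all $x\in\mathcal X$, and $R_T=\mathbb E\big[\sum_{t=1}^T(\ell_t(X_t,A_t)-\ell_t(X_t,\pi^*(X_t)))\big]$. In the corrupted stochastic regime let $\Delta_{\min}=\inf_{x\in\mathcal X}\min_{a\ne\pi^*(x)}\langle x,\theta_a-\theta_{\pi^*(x)}\rangle$ and assume $\Delta_{\min}>0$. **Algorithm (FTRL-LC).** Let $H(r)=-\sum_a r_a\log r_a$, $c_1'=\sqrt{\big(3Kd+\tfrac{2K\log T}{\lambda}\big)\tfrac{\log T}{\log K}}$, $c_2'=\tfrac{8K}{\lambda}$, $\beta_1'=c_1'$. In round $t$ put $\beta_t=\max\{2,c_2'\log T,\beta_t'\}$, $\eta_t=1/\beta_t$, $\gamma_t=\tfrac{4K\log t}{\lambda}\eta_t$, $$p_t(\cdot|x)=\arg\min_{r\in\Delta([K])}\Big\{\sum_{s<t}\sum_a r_a\langle x,\tilde\theta_{s,a}\rangle-\tfrac{1}{\eta_t}H(r)\Big\},\qquad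 \pi_t(\cdot|x)=(1-\gamma_t)p_t(\cdot|x)+\tfrac{\gamma_t}{K},$$ draw $A_t\sim\pi_t(\cdot|X_t)$, and update $\beta'_{t+1}=\beta'_t+c_1'\big(1+\tfrac{1}{\log K}\sum_{s\le t}H(p_s(\cdot|X_s))\big)^{-1/2}$. The estimates are $\tilde\theta_{t,a}=\widehat{\mathbf\Sigma}^+_{t,a}X_t\,\ell_t(X_t,A_t)\mathbf 1\{A_t=a\}$, where $\widehat{\mathbf\Sigma}^+_{t,a}=\tfrac12\mathbf I+\tfrac12\sum_{k=1}^{M_t}\prod_{j=1}^k\big(\mathbf I-\tfrac12\mathbf 1\{A(j)=a\}X(j)X(j)^\top\big)$ is computed (Matrix Geometric Resampling) from fresh independent draws $X(j)\sim\mathcal D$, $A(j)\sim\pi_t(\cdot|X(j))$, with $M_t=\big\lceil\tfrac{4K}{\gamma_t\lambda}\log t\big\rceil$ for $t\ge2$ and $M_1=0$. In particular the algorithm does not use $\mathbf\Sigma^{-1}$. **Theorem.** There is an absolute constant $c>0$ such that, for all such $d,K,T,\mathcal X,\mathcal D$, the regret of FTRL-LC satisfies in the adversarial regime $$R_T\le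 c\,\sqrt{TK\Big(d+\frac{\log T}{\lambda_{\min}(\mathbf\Sigma)}\Big)\log T\,\log K},$$ and in the corrupted stochastic regime $$R_T\le c\left(\frac{K\big(d+\frac{\log T}{\lambda_{\min}(\mathbf\Sigma)}\big)\log(KT)\log T}{\Delta_{\min}}+\sqrt{\frac{K\big(d+\frac{\log T}{\lambda_{\min}(\mathbf\Sigma)}\big)\log(KT)\log T}{\Delta_{\min}}\,C}+K\log T\sqrt{\frac{\frac{1}{\lambda_{\min}(\mathbf\Sigma)}\big(d+\frac{\log T}{\lambda_{\min}(\mathbf\Sigma)}\big)\log K\,\log(KT)}{\Delta_{\min}}}\right).$$ -/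

import Mathlib

open MeasureTheory Set
open scoped Matrix RealInnerProductSpace

noncomputable section

namespace LinCB

/-- Contexts and loss vectors: `ℝ^d` with the Euclidean norm. -/
abbrev Ctx (d : ℕ) := EuclideanSpace ℝ (Fin d)

/-! ### The environment -/

/-- `Σ = E[X Xᵀ]` for `X ∼ D`. -/
def secondMoment {d : ℕ} (D : Measure (Ctx d)) : Matrix (Fin d) (Fin d) ℝ :=
  Matrix.of fun i j => ∫ x, x i * x j ∂D

/-- The smallest (real) eigenvalue of a square matrix. -/
def minEigenvalue {d : ℕ} (S : Matrix (Fin d) (Fin d) ℝ) : ℝ := sInf (spectrum ℝ S)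

/-- A random loss function: in round `t` nature draws a seed `w` (from a law `ν t`) and the loss of
action `a` in context `x` is `ℓ t w x a`. -/
abbrev Loss (d K : ℕ) (W : Type*) := ℕ → W → Ctx d → Fin K → ℝ

/-- Noiseless linear losses `⟨x, θ_{t,a}⟩`. -/
def linearLoss {d K : ℕ} (θ : ℕ → Fin K → Ctx d) : Loss d K Unit :=
  fun t _ x a => ⟪x, θ t a⟫

/-- Noisy linear losses `⟨x, θ_{t,a}⟩ + ε_t(x,a)`. -/
def noisyLoss {d K : ℕ} {W : Type*} (θ : ℕ → Fin K → Ctx d) (ε : Loss d K W) : Loss d K W :=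
  fun t w x a => ⟪x, θ t a⟫ + ε t w x a

/-- `π` is an optimal deterministic policy: for every context `x ∈ 𝒳`, the action `π x` minimizes
the expected cumulative loss over rounds `1, …, T`. -/
def IsOptimalPolicy {d K : ℕ} {W : Type*} [MeasurableSpace W] (𝒳 : Set (Ctx d)) (T : ℕ)
    (ν : ℕ → Measure W) (ℓ : Loss d K W) (π : Ctx d → Fin K) : Prop :=
  ∀ x ∈ 𝒳, ∀ a : Fin K,
    ∑ t ∈ Finset.Icc 1 T, ∫ w, ℓ t w x (π x) ∂(ν t) ≤ ∑ t ∈ Finset.Icc 1 T, ∫ w, ℓ t w x a ∂(ν t)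

/-- The minimum suboptimality gap
`min_{x ∈ 𝒳} min_{a ≠ π x} ⟨x, θ_a - θ_{π x}⟩`. -/
def minGap {d K : ℕ} (𝒳 : Set (Ctx d)) (θ : Fin K → Ctx d) (π : Ctx d → Fin K) : ℝ :=
  sInf {r | ∃ x ∈ 𝒳, ∃ a : Fin K, a ≠ π x ∧ r = ⟪x, θ a - θ (π x)⟫}

/-! ### Randomness

The randomness of one round consists of the context, a uniform seed with which the learner draws the
action, the seed of the loss function, and an infinite supply of pairs (fresh context, uniform seed)
for matrix geometric resampling.  All of these are independent, within a round and across rounds. -/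

abbrev Round (d : ℕ) (W : Type*) := Ctx d × unitInterval × W × (ℕ → Ctx d × unitInterval)

def roundLaw {d : ℕ} {W : Type*} [MeasurableSpace W] (D : Measure (Ctx d)) [IsProbabilityMeasure D]
    (ν : Measure W) : Measure (Round d W) :=
  D.prod ((volume : Measure unitInterval).prod
    (ν.prod (Measure.infinitePi fun _ : ℕ => D.prod (volume : Measure unitInterval))))

instance {d : ℕ} {W : Type*} [MeasurableSpace W] (D : Measure (Ctx d)) [IsProbabilityMeasure D]
    (ν : Measure W) [IsProbabilityMeasure ν] : IsProbabilityMeasure (roundLaw D ν) := by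
  unfold roundLaw; infer_instance

/-- Law of the whole randomness; coordinate `t` belongs to round `t` (coordinate `0` is not used). -/
def pathLaw {d : ℕ} {W : Type*} [MeasurableSpace W] (D : Measure (Ctx d)) [IsProbabilityMeasure D]
    (ν : ℕ → Measure W) [∀ t, IsProbabilityMeasure (ν t)] : Measure (ℕ → Round d W) :=
  Measure.infinitePi fun t => roundLaw D (ν t)

/-- Sample an action from the distribution `q` with a uniform seed `u` by inverting the distribution
function: the least `a` with `u ≤ ∑_{b ≤ a} q b`. -/
def sampleAction {K : ℕ} [NeZero K] (q : Fin K → ℝ) (u : ℝ) : Fin K :=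
  let S : Finset (Fin K) := {a | u ≤ ∑ b ∈ Finset.Iic a, q b}
  if h : S.Nonempty then S.min' h else 0

/-! ### FTRL with the negative Shannon entropy -/

/-- Shannon entropy. -/
def entropy {K : ℕ} (r : Fin K → ℝ) : ℝ := ∑ a, Real.negMulLog (r a)

/-- The FTRL objective `⟨r, L⟩ + ψ(r)` with `ψ(r) = -H(r) / η`. -/
def ftrlObjective {K : ℕ} (η : ℝ) (L : Fin K → ℝ) (r : Fin K → ℝ) : ℝ :=
  ∑ a, r a * L a - entropy r / η

/-- The FTRL prediction: a minimizer of the objective over the probability simplex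
(it exists and is unique for `η > 0`, see `ftrl_eq_softmax`). -/
def ftrl {K : ℕ} (η : ℝ) (L : Fin K → ℝ) : Fin K → ℝ :=
  Classical.epsilon fun r =>
    r ∈ stdSimplex ℝ (Fin K) ∧ IsMinOn (ftrlObjective η L) (stdSimplex ℝ (Fin K)) r

/-! ### The algorithm FTRL-LC

`d`: dimension, `K`: number of actions, `T`: horizon, `lam`: smallest eigenvalue of `Σ`. -/

/-- What the learner keeps after rounds `1, …, t - 1`: the sums `∑_{s<t} θ̃_{s,a}`, the sum
`∑_{s<t} H(p_s(·|X_s))`, and `β'_t`. -/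
abbrev State (d K : ℕ) := (Fin K → Ctx d) × ℝ × ℝ

abbrev State.cumEst {d K : ℕ} (S : State d K) : Fin K → Ctx d := S.1
abbrev State.cumEntropy {d K : ℕ} (S : State d K) : ℝ := S.2.1
abbrev State.beta' {d K : ℕ} (S : State d K) : ℝ := S.2.2

/-- `c'₁ = √((3Kd + 2K log T / lam) log T / log K)`. -/
def c₁ (d K T : ℕ) (lam : ℝ) : ℝ :=
  √((3 * K * d + 2 * K * Real.log T / lam) * (Real.log T / Real.log K))

/-- `c'₂ = 8K / lam`. -/
def c₂ (K : ℕ) (lam : ℝ) : ℝ := 8 * K / lam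

/-- `β_t = max {2, c'₂ log T, β'_t}`. -/
def beta {d K : ℕ} (T : ℕ) (lam : ℝ) (S : State d K) : ℝ :=
  max (max 2 (c₂ K lam * Real.log T)) S.beta'

/-- Learning rate `η_t = 1 / β_t`. -/
def eta {d K : ℕ} (T : ℕ) (lam : ℝ) (S : State d K) : ℝ := 1 / beta T lam S

/-- Exploration rate `γ_t = α_t η_t` with `α_t = 4K log t / lam`. -/
def gamma {d K : ℕ} (T : ℕ) (lam : ℝ) (t : ℕ) (S : State d K) : ℝ :=
  4 * K * Real.log t / lam * eta T lam S

/-- Number of resampling iterations `M_t = ⌈4K log t / (γ_t lam)⌉`.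
For `t = 1`, where `γ_1 = log 1 = 0`, this is `M_1 = 0`. -/
def iterations {d K : ℕ} (T : ℕ) (lam : ℝ) (t : ℕ) (S : State d K) : ℕ :=
  ⌈4 * K / (gamma T lam t S * lam) * Real.log t⌉₊

/-- `p_t(·|x)`: the FTRL prediction for the estimated cumulative losses `⟨x, ∑_{s<t} θ̃_{s,a}⟩`. -/
def predict {d K : ℕ} (T : ℕ) (lam : ℝ) (S : State d K) (x : Ctx d) : Fin K → ℝ :=
  ftrl (eta T lam S) fun a => ⟪x, S.cumEst a⟫

/-- `π_t(·|x) = (1 - γ_t) p_t(·|x) + γ_t / K`. -/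
def policy {d K : ℕ} (T : ℕ) (lam : ℝ) (t : ℕ) (S : State d K) (x : Ctx d) : Fin K → ℝ :=
  fun a => (1 - gamma T lam t S) * predict T lam S x a + gamma T lam t S / K

/-- `B_{k,a} = 1{A(k) = a} X(k) X(k)ᵀ`, where `X(k)` is the fresh context `z.1` and `A(k)` is drawn
from the policy `q` at `X(k)`. -/
def resampleB {d K : ℕ} [NeZero K] (q : Ctx d → Fin K → ℝ) (a : Fin K)
    (z : Ctx d × unitInterval) : Matrix (Fin d) (Fin d) ℝ :=
  if sampleAction (q z.1) z.2 = a then Matrix.vecMulVec z.1.ofLp z.1.ofLp else 0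

/-- `A_{k,a} = ∏_{j=1}^k (I - B_{j,a} / 2)`; the `j`-th draw is `z (j - 1)`. -/
def resampleA {d K : ℕ} [NeZero K] (q : Ctx d → Fin K → ℝ) (a : Fin K)
    (z : ℕ → Ctx d × unitInterval) : ℕ → Matrix (Fin d) (Fin d) ℝ
  | 0 => 1
  | k + 1 => resampleA q a z k * (1 - (1 / 2 : ℝ) • resampleB q a (z k))

/-- Output `I / 2 + (1/2) ∑_{k=1}^M A_{k,a}` of matrix geometric resampling with `M` iterations. -/
def resampling {d K : ℕ} [NeZero K] (q : Ctx d → Fin K → ℝ) (a : Fin K)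
    (z : ℕ → Ctx d × unitInterval) (M : ℕ) : Matrix (Fin d) (Fin d) ℝ :=
  (1 / 2 : ℝ) • 1 + (1 / 2 : ℝ) • ∑ k ∈ Finset.Icc 1 M, resampleA q a z k

/-- The action `A_t`. -/
def action {d K : ℕ} [NeZero K] {W : Type*} (T : ℕ) (lam : ℝ) (t : ℕ) (S : State d K)
    (ω : Round d W) : Fin K :=
  sampleAction (policy T lam t S ω.1) ω.2.1

/-- The estimate `θ̃_{t,a} = Σ̂⁺_{t,a} X_t ℓ_t(X_t, A_t) 1{A_t = a}`. -/
def estimate {d K : ℕ} [NeZero K] {W : Type*} (T : ℕ) (lam : ℝ) (ℓ : Loss d K W) (t : ℕ)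
    (S : State d K) (ω : Round d W) (a : Fin K) : Ctx d :=
  if action T lam t S ω = a then
    ℓ t ω.2.2.1 ω.1 (action T lam t S ω) •
      WithLp.toLp 2
        (resampling (policy T lam t S) a ω.2.2.2 (iterations T lam t S) *ᵥ ω.1.ofLp)
  else 0

/-- Round `t`: from the state before the round to the state after it, with
`β'_{t+1} = β'_t + c'₁ / √(1 + (log K)⁻¹ ∑_{s≤t} H(p_s(·|X_s)))`. -/
def step {d K : ℕ} [NeZero K] {W : Type*} (T : ℕ) (lam : ℝ) (ℓ : Loss d K W) (t : ℕ)
    (S : State d K) (ω : Round d W) : State d K :=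
  let h := S.cumEntropy + entropy (predict T lam S ω.1)
  (fun a => S.cumEst a + estimate T lam ℓ t S ω a,
    h,
    S.beta' + c₁ d K T lam / √(1 + (Real.log K)⁻¹ * h))

/-- The state after rounds `1, …, t`; initially all sums are `0` and `β'_1 = c'₁`. -/
def stateAfter {d K : ℕ} [NeZero K] {W : Type*} (T : ℕ) (lam : ℝ) (ℓ : Loss d K W)
    (ω : ℕ → Round d W) : ℕ → State d K
  | 0 => (0, 0, c₁ d K T lam)
  | t + 1 => step T lam ℓ (t + 1) (stateAfter T lam ℓ ω t) (ω (t + 1))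

/-- The action `A_t` played by FTRL-LC in round `t ≥ 1`. -/
def actionAt {d K : ℕ} [NeZero K] {W : Type*} (T : ℕ) (lam : ℝ) (ℓ : Loss d K W)
    (ω : ℕ → Round d W) (t : ℕ) : Fin K :=
  action T lam t (stateAfter T lam ℓ ω (t - 1)) (ω t)

/-- `∑_{t=1}^T (ℓ_t(X_t, A_t) - ℓ_t(X_t, π(X_t)))`. -/
def pathRegret {d K : ℕ} [NeZero K] {W : Type*} (T : ℕ) (lam : ℝ) (ℓ : Loss d K W)
    (π : Ctx d → Fin K) (ω : ℕ → Round d W) : ℝ :=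
  ∑ t ∈ Finset.Icc 1 T,
    (ℓ t (ω t).2.2.1 (ω t).1 (actionAt T lam ℓ ω t) - ℓ t (ω t).2.2.1 (ω t).1 (π (ω t).1))

/-- The expected regret of FTRL-LC against `π` is well defined and at most `B`. -/
def RegretLE {d K : ℕ} [NeZero K] {W : Type*} [MeasurableSpace W] (D : Measure (Ctx d))
    [IsProbabilityMeasure D] (T : ℕ) (ν : ℕ → Measure W) [∀ t, IsProbabilityMeasure (ν t)]
    (ℓ : Loss d K W) (π : Ctx d → Fin K) (B : ℝ) : Prop :=
  Integrable (pathRegret T (minEigenvalue (secondMoment D)) ℓ π) (pathLaw D ν) ∧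
    ∫ ω, pathRegret T (minEigenvalue (secondMoment D)) ℓ π ω ∂(pathLaw D ν) ≤ B

/-! ### The FTRL prediction and the sampler are what they should be -/

/-- The exponential weights distribution. -/
def softmax {K : ℕ} (η : ℝ) (L : Fin K → ℝ) : Fin K → ℝ :=
  fun a => Real.exp (-(η * L a)) / ∑ b, Real.exp (-(η * L b))

theorem softmax_pos {K : ℕ} [NeZero K] (η : ℝ) (L : Fin K → ℝ) (a : Fin K) :
    0 < softmax η L a :=
  div_pos (Real.exp_pos _) (Finset.sum_pos (fun _ _ => Real.exp_pos _) ⟨a, Finset.mem_univ _⟩)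

theorem softmax_mem {K : ℕ} [NeZero K] (η : ℝ) (L : Fin K → ℝ) :
    softmax η L ∈ stdSimplex ℝ (Fin K) := by
  refine ⟨fun a => (softmax_pos η L a).le, ?_⟩
  unfold softmax
  rw [← Finset.sum_div]
  exact div_self (Finset.sum_pos (fun _ _ => Real.exp_pos _) ⟨0, Finset.mem_univ _⟩).ne'

theorem ftrlObjective_sub_softmax {K : ℕ} [NeZero K] {η : ℝ} (hη : 0 < η) (L : Fin K → ℝ)
    {r : Fin K → ℝ} (hr : r ∈ stdSimplex ℝ (Fin K)) :
    ftrlObjective η L r - ftrlObjective η L (softmax η L) =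
      (∑ a, softmax η L a * InformationTheory.klFun (r a / softmax η L a)) / η := by
  set Z : ℝ := ∑ b, Real.exp (-(η * L b)) with hZ
  have hZpos : 0 < Z := Finset.sum_pos (fun _ _ => Real.exp_pos _) ⟨0, Finset.mem_univ _⟩
  have hlog : ∀ a, Real.log (softmax η L a) = -(η * L a) - Real.log Z := fun a => by
    unfold softmax
    rw [Real.log_div (Real.exp_pos _).ne' hZpos.ne', Real.log_exp]
  have hobj : ∀ q ∈ stdSimplex ℝ (Fin K), η * ftrlObjective η L q =
      ∑ a, (q a * Real.log (q a) - q a * Real.log (softmax η L a)) - Real.log Z := by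
    intro q hq
    have h1 : ∑ a, (q a * Real.log (q a) - q a * Real.log (softmax η L a)) =
        ∑ a, q a * Real.log (q a) + η * ∑ a, q a * L a + (∑ a, q a) * Real.log Z := by
      rw [Finset.mul_sum, Finset.sum_mul, ← Finset.sum_add_distrib, ← Finset.sum_add_distrib]
      refine Finset.sum_congr rfl fun a _ => ?_
      rw [hlog]; ring
    have h2 : entropy q = -∑ a, q a * Real.log (q a) := by
      unfold entropy Real.negMulLog
      rw [← Finset.sum_neg_distrib]
      exact Finset.sum_congr rfl fun a _ => by ring
    rw [h1, hq.2]
    unfold ftrlObjective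
    rw [h2]
    field_simp
    ring
  have hkl : ∑ a, softmax η L a * InformationTheory.klFun (r a / softmax η L a) =
      ∑ a, (r a * Real.log (r a) - r a * Real.log (softmax η L a)) := by
    have h3 : ∀ a, softmax η L a * InformationTheory.klFun (r a / softmax η L a) =
        (r a * Real.log (r a) - r a * Real.log (softmax η L a)) + (softmax η L a - r a) := by
      intro a
      have hp := softmax_pos η L a
      rw [InformationTheory.klFun_apply]
      rcases (hr.1 a).eq_or_lt with h0 | h0
      · rw [← h0]; simp
      · rw [Real.log_div h0.ne' hp.ne']
        field_simp
        ring
    rw [Finset.sum_congr rfl fun a _ => h3 a, Finset.sum_add_distrib, Finset.sum_sub_distrib (s :=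
      Finset.univ) (f := softmax η L) (g := r), hr.2, (softmax_mem η L).2]
    ring
  have e1 := hobj r hr
  have e2 := hobj _ (softmax_mem η L)
  rw [eq_div_iff hη.ne', hkl]
  simp only [sub_self, Finset.sum_const_zero] at e2
  linarith

/-- For `η > 0` the FTRL prediction is the exponential weights distribution. -/
theorem ftrl_eq_softmax {K : ℕ} [NeZero K] {η : ℝ} (hη : 0 < η) (L : Fin K → ℝ) :
    ftrl η L = softmax η L := by
  have hmin : softmax η L ∈ stdSimplex ℝ (Fin K) ∧
      IsMinOn (ftrlObjective η L) (stdSimplex ℝ (Fin K)) (softmax η L) := by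
    refine ⟨softmax_mem η L, fun r hr => ?_⟩
    have h := ftrlObjective_sub_softmax hη L hr
    have h' : 0 ≤ (∑ a, softmax η L a * InformationTheory.klFun (r a / softmax η L a)) / η :=
      div_nonneg (Finset.sum_nonneg fun a _ => mul_nonneg (softmax_pos η L a).le
        (InformationTheory.klFun_nonneg (div_nonneg (hr.1 a) (softmax_pos η L a).le))) hη.le
    show ftrlObjective η L (softmax η L) ≤ ftrlObjective η L r
    linarith
  obtain ⟨hr, hrmin⟩ : ftrl η L ∈ stdSimplex ℝ (Fin K) ∧
      IsMinOn (ftrlObjective η L) (stdSimplex ℝ (Fin K)) (ftrl η L) :=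
    Classical.epsilon_spec (p := fun r => r ∈ stdSimplex ℝ (Fin K) ∧
      IsMinOn (ftrlObjective η L) (stdSimplex ℝ (Fin K)) r) ⟨_, hmin⟩
  have h := ftrlObjective_sub_softmax hη L hr
  have hle : ftrlObjective η L (ftrl η L) ≤ ftrlObjective η L (softmax η L) := hrmin hmin.1
  have hterm : ∀ a ∈ Finset.univ,
      0 ≤ softmax η L a * InformationTheory.klFun (ftrl η L a / softmax η L a) := fun a _ =>
    mul_nonneg (softmax_pos η L a).le
      (InformationTheory.klFun_nonneg (div_nonneg (hr.1 a) (softmax_pos η L a).le))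
  have hsum : ∑ a, softmax η L a * InformationTheory.klFun (ftrl η L a / softmax η L a) = 0 := by
    refine le_antisymm ?_ (Finset.sum_nonneg hterm)
    by_contra hcon
    have := div_pos (not_le.mp hcon) hη
    linarith
  funext a
  have ha := (Finset.sum_eq_zero_iff_of_nonneg hterm).1 hsum a (Finset.mem_univ a)
  have hp := softmax_pos η L a
  have hk := (mul_eq_zero.1 ha).resolve_left hp.ne'
  have := (InformationTheory.klFun_eq_zero_iff (div_nonneg (hr.1 a) hp.le)).1 hk
  exact (div_eq_one_iff_eq hp.ne').1 this

/-- A uniform seed makes `sampleAction q` a draw from the distribution `q`. -/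
theorem volume_sampleAction {K : ℕ} [NeZero K] {q : Fin K → ℝ} (hq : q ∈ stdSimplex ℝ (Fin K))
    (a : Fin K) :
    volume {u : unitInterval | sampleAction q u = a} = ENNReal.ofReal (q a) := by
  have hmono : ∀ s t : Finset (Fin K), s ⊆ t → ∑ b ∈ s, q b ≤ ∑ b ∈ t, q b := fun s t h =>
    Finset.sum_le_sum_of_subset_of_nonneg h fun b _ _ => hq.1 b
  have hle1 : ∀ s : Finset (Fin K), ∑ b ∈ s, q b ≤ 1 := fun s =>
    (hmono s _ (Finset.subset_univ s)).trans hq.2.le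
  have hnn : ∀ s : Finset (Fin K), 0 ≤ ∑ b ∈ s, q b := fun s =>
    Finset.sum_nonneg fun b _ => hq.1 b
  have hsplit : ∑ b ∈ Finset.Iic a, q b = ∑ b ∈ Finset.Iio a, q b + q a := by
    rw [← Finset.Iio_insert a, Finset.sum_insert (by simp)]; ring
  set lo : unitInterval := ⟨∑ b ∈ Finset.Iio a, q b, hnn _, hle1 _⟩ with hlo
  set hi : unitInterval := ⟨∑ b ∈ Finset.Iic a, q b, hnn _, hle1 _⟩ with hhi
  have key : ∀ u : unitInterval, 0 < u → (sampleAction q u = a ↔ u ∈ Set.Ioc lo hi) := by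
    intro u hu
    have hu0 : (0 : ℝ) < u := hu
    have hne : ({c | (u : ℝ) ≤ ∑ b ∈ Finset.Iic c, q b} : Finset (Fin K)).Nonempty := by
      have : Nonempty (Fin K) := ⟨0⟩
      refine ⟨Finset.univ.max' Finset.univ_nonempty, ?_⟩
      have hall : Finset.Iic (Finset.univ.max' (Finset.univ_nonempty (α := Fin K))) =
          Finset.univ := by
        ext c; simp [Finset.le_max' Finset.univ c (Finset.mem_univ c)]
      simp only [Finset.mem_filter, Finset.mem_univ, true_and]
      rw [hall, hq.2]
      exact u.2.2
    have hval : sampleAction q u =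
        ({c | (u : ℝ) ≤ ∑ b ∈ Finset.Iic c, q b} : Finset (Fin K)).min' hne := by
      unfold sampleAction
      simp only [dif_pos hne]
    rw [hval, Finset.min'_eq_iff]
    simp only [Finset.mem_filter, Finset.mem_univ, true_and, Set.mem_Ioc]
    rw [and_comm]
    refine and_congr ?_ Iff.rfl
    change _ ↔ ∑ b ∈ Finset.Iio a, q b < (u : ℝ)
    constructor
    · intro h
      by_cases ha : (Finset.Iio a).Nonempty
      · have hm := Finset.max'_mem _ ha
        rw [Finset.mem_Iio] at hm
        have heq : Finset.Iio a = Finset.Iic ((Finset.Iio a).max' ha) := by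
          ext c
          rw [Finset.mem_Iic, Finset.mem_Iio]
          exact ⟨fun hc => Finset.le_max' _ _ (Finset.mem_Iio.2 hc), fun hc => hc.trans_lt hm⟩
        rw [heq]
        by_contra hcon
        exact absurd (h _ (not_lt.1 hcon)) (not_le.2 hm)
      · rw [Finset.not_nonempty_iff_eq_empty.1 ha]
        simpa using hu0
    · intro h c hc
      by_contra hcon
      have := hmono (Finset.Iic c) (Finset.Iio a) fun e he =>
        Finset.mem_Iio.2 ((Finset.mem_Iic.1 he).trans_lt (not_le.1 hcon))
      linarith
  have hae : ({u : unitInterval | sampleAction q u = a} : Set unitInterval) =ᵐ[volume]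
      Set.Ioc lo hi := by
    have h0 : ∀ᵐ u : unitInterval, u ≠ 0 := by
      rw [ae_iff]; simp
    filter_upwards [h0] with u hu
    exact propext (key u (unitInterval.pos_iff_ne_zero.2 hu))
  rw [measure_congr hae, unitInterval.volume_Ioc]
  congr 1
  simp only [hhi, hlo]
  linarith

end LinCB

end

/-! In each context separately, FTRL with the Shannon entropy is exponential weights. The regret for
the estimated losses is therefore bounded context by context and then averaged over a ghost context
`y ∼ D`. Because the state before a round is independent of the round, the conditional mean of the
true regret of round `t` is at most this ghost regret plus `2γ_t` for exploration and `2/t²` for the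
bias of the estimator (`integral_roundRegret_le`).

Matrix geometric resampling enters through three estimates; `S` denotes the mean of `1{A = a} X Xᵀ`
under the policy and `A_k` the product of `k` factors `I - B/2`. (i) The mean of the resampled
matrix times `S` is `I - (I - S/2)^(M+1)`. Exploration gives `S ≥ (γλ/K) I`, so the remainder is at
most `t⁻²` (`abs_bias_le`). (ii) Every `A_k` is a contraction, so the estimated losses are at most
`(M+1)/2 ≤ β_t`, as exponential weights requires (`GoodRound.abs_inner_estimate_le`). (iii) The
second moment is at most `4d/3` per action whatever `M` is (`resampling_second_moment`). It is
bounded by the sum over `k` of the means of `‖yᵀA_k‖²`. Averaging over `y` turns these into the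
traces of `A_kᵀ S A_k`, and since `I - B/2` removes at least `(3/4) uᵀBu` from `‖u‖²`, the sum over
`k` telescopes.

With the potential `β log ∑ exp(-L/β)`, exponential weights yields a penalty `∑ (β_{t+1} - β_t)
H(p_{t+1}(·|y))` and a stability term `∑ η_t ∑ p l²`. In expectation the ghost entropies equal the
entropies at the observed contexts (`integrable_increment_mul`), from which the learning rate is
built. Penalty and stability both become multiples of `√(κ log T) √(log K + E H)`, where `κ = 3Kd +
2K log T/λ` and `H` is the cumulative entropy (`integral_pathRegret_le_sqrt`).

In the adversarial regime `H ≤ T log K` finishes the proof. With a gap `Δ`, the entropy is at most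
`log(KT)` times the mass off the optimal action, up to `2/T`, and that mass is paid for by regret.
Hence `E H ≤ (2 log(KT)/Δ)(R + 2C) + 2` (`integral_cumEntropy_le`), and the resulting inequality for
`R` is solved in `le_of_le_sqrt_gap`. A gap of at least `4` forces `C ≥ TΔ/4`, and then the
adversarial bound suffices. The first two terms of the corrupted rate already dominate the regret;
the third is only added at the end. -/

namespace LinCB

/-! ### Entropy -/

theorem entropy_nonneg {K : ℕ} {p : Fin K → ℝ} (hp : p ∈ stdSimplex ℝ (Fin K)) :
    0 ≤ entropy p :=
  Finset.sum_nonneg fun a _ => Real.negMulLog_nonneg (hp.1 a)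
    ((Finset.single_le_sum (fun b _ => hp.1 b) (Finset.mem_univ a)).trans hp.2.le)

/-- Gibbs' inequality. -/
theorem entropy_le_cross {K : ℕ} {p r : Fin K → ℝ} (hp : p ∈ stdSimplex ℝ (Fin K))
    (hr : ∀ a, 0 < r a) (hr1 : ∑ a, r a ≤ 1) :
    entropy p ≤ -∑ a, p a * Real.log (r a) := by
  have h : ∀ a, Real.negMulLog (p a) + p a * Real.log (r a) ≤ r a - p a := by
    intro a
    rcases (hp.1 a).eq_or_lt with h0 | h0
    · rw [← h0]; simpa using (hr a).le
    · have := Real.log_le_sub_one_of_pos (div_pos (hr a) h0)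
      rw [Real.log_div (hr a).ne' h0.ne'] at this
      have h2 := mul_le_mul_of_nonneg_left this h0.le
      have h3 : p a * (r a / p a - 1) = r a - p a := by field_simp
      unfold Real.negMulLog
      linarith
  have hs := Finset.sum_le_sum fun a (_ : a ∈ Finset.univ) => h a
  rw [Finset.sum_add_distrib, Finset.sum_sub_distrib, hp.2] at hs
  unfold entropy
  linarith

theorem entropy_le_log {K : ℕ} [NeZero K] {p : Fin K → ℝ} (hp : p ∈ stdSimplex ℝ (Fin K)) :
    entropy p ≤ Real.log K := by
  have hK : (0 : ℝ) < K := by exact_mod_cast Nat.pos_of_ne_zero (NeZero.ne K)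
  refine (entropy_le_cross hp (r := fun _ => (K : ℝ)⁻¹) (fun _ => inv_pos.2 hK) ?_).trans ?_
  · simp [hK.ne']
  · rw [← Finset.sum_mul, hp.2, Real.log_inv]; simp

/-- Gibbs' inequality against the distribution with mass `1 - 1/T` at `b` and `1/(KT)` elsewhere:
mass off `b` costs `log(KT)` per unit, and `b` itself costs `-log(1 - 1/T) ≤ 2/T`, which sums to a
constant over `T` rounds. -/
theorem entropy_le_of_mode {K T : ℕ} (hK : 2 ≤ K) (hT : 2 ≤ T) {p : Fin K → ℝ}
    (hp : p ∈ stdSimplex ℝ (Fin K)) (b : Fin K) :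
    entropy p ≤ (1 - p b) * Real.log (K * T) + 2 / T := by
  have hT' : (2 : ℝ) ≤ T := by exact_mod_cast hT
  have hK' : (2 : ℝ) ≤ K := by exact_mod_cast hK
  have hpos : (0 : ℝ) < 1 - 1 / T := by
    rw [sub_pos, div_lt_one (by linarith)]; linarith
  set r : Fin K → ℝ := fun a => if a = b then 1 - 1 / T else 1 / (K * T) with hr
  have hsum : ∀ f : Fin K → ℝ, ∑ a, f a = f b + ∑ a ∈ Finset.univ.erase b, f a := fun f =>
    (Finset.add_sum_erase _ f (Finset.mem_univ b)).symm
  have h1 : ∑ a ∈ Finset.univ.erase b, r a = (K - 1) * (1 / (K * T)) := by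
    rw [Finset.sum_congr rfl fun a ha => show r a = 1 / (K * T) by
      simp only [hr, if_neg (Finset.ne_of_mem_erase ha)]]
    rw [Finset.sum_const, Finset.card_erase_of_mem (Finset.mem_univ b), Finset.card_univ,
      Fintype.card_fin, nsmul_eq_mul, Nat.cast_sub (by omega)]
    simp
  have h2 : ∑ a ∈ Finset.univ.erase b, p a * Real.log (r a) = -((1 - p b) * Real.log (K * T)) := by
    have := hsum p
    rw [hp.2] at this
    rw [Finset.sum_congr rfl fun a ha => show p a * Real.log (r a) = p a * -Real.log (K * T) by
      simp only [hr, if_neg (Finset.ne_of_mem_erase ha), one_div, Real.log_inv]]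
    rw [← Finset.sum_mul]
    have h3 : ∑ a ∈ Finset.univ.erase b, p a = 1 - p b := by linarith
    rw [h3]; ring
  refine (entropy_le_cross hp (r := r) ?_ ?_).trans ?_
  · intro a
    simp only [hr]
    split_ifs
    · exact hpos
    · positivity
  · rw [hsum r, h1]
    have : (K - 1 : ℝ) * (1 / (K * T)) ≤ 1 / T := by
      rw [mul_one_div, div_le_div_iff₀ (by positivity) (by positivity)]; nlinarith
    simp only [hr, if_true]
    linarith
  · rw [hsum, h2]
    have hb : r b = 1 - 1 / T := by simp [hr]
    have hlog : -(2 / T) ≤ Real.log (r b) := by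
      rw [hb]
      have := Real.one_sub_inv_le_log_of_pos hpos
      refine le_trans ?_ this
      have h4 : (1 - 1 / (T : ℝ))⁻¹ = T / (T - 1) := by field_simp
      rw [h4, neg_le_iff_add_nonneg, div_eq_mul_inv, div_eq_mul_inv]
      have h5 : (T : ℝ) * (T - 1 : ℝ)⁻¹ = 1 + (T - 1 : ℝ)⁻¹ := by
        have : (T - 1 : ℝ) ≠ 0 := by linarith
        field_simp; ring
      have h6 : (T - 1 : ℝ)⁻¹ ≤ 2 * (T : ℝ)⁻¹ := by
        rw [← div_eq_mul_inv, inv_eq_one_div, div_le_div_iff₀ (by linarith) (by linarith)]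
        linarith
      rw [h5]; linarith
    have hb1 : p b ≤ 1 := (Finset.single_le_sum (fun b _ => hp.1 b) (Finset.mem_univ b)).trans hp.2.le
    have := mul_le_mul_of_nonneg_left hlog (hp.1 b)
    have h7 : p b * (2 / T) ≤ 1 * (2 / T) := mul_le_mul_of_nonneg_right hb1 (by positivity)
    linarith

/-! ### Regret of exponential weights with a decreasing learning rate -/

/-- The log-partition function `β log ∑ₐ exp (-Lₐ / β)`. -/
noncomputable def logPartition {K : ℕ} (β : ℝ) (L : Fin K → ℝ) : ℝ :=
  β * Real.log (∑ a, Real.exp (-(1 / β * L a)))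

theorem partition_pos {K : ℕ} [NeZero K] (η : ℝ) (L : Fin K → ℝ) :
    0 < ∑ a, Real.exp (-(η * L a)) :=
  Finset.sum_pos (fun _ _ => Real.exp_pos _) ⟨0, Finset.mem_univ _⟩

theorem logPartition_eq {K : ℕ} [NeZero K] {β : ℝ} (hβ : 0 < β) (L : Fin K → ℝ) :
    logPartition β L = -ftrlObjective (1 / β) L (softmax (1 / β) L) := by
  have hZ := partition_pos (1 / β) L
  have hlog : ∀ a, Real.log (softmax (1 / β) L a) =
      -(1 / β * L a) - Real.log (∑ b, Real.exp (-(1 / β * L b))) := fun a => by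
    unfold softmax
    rw [Real.log_div (Real.exp_pos _).ne' hZ.ne', Real.log_exp]
  unfold ftrlObjective entropy Real.negMulLog logPartition
  simp only [hlog]
  have h1 := (softmax_mem (1 / β) L).2
  generalize softmax (1 / β) L = p at *
  generalize Real.log (∑ b, Real.exp (-(1 / β * L b))) = z
  have h2 : ∑ a, -p a * (-(1 / β * L a) - z) = 1 / β * ∑ a, p a * L a + z := by
    have h3 : z = ∑ a, p a * z := by rw [← Finset.sum_mul, h1, one_mul]
    rw [Finset.mul_sum, h3, ← Finset.sum_add_distrib, ← h3]
    exact Finset.sum_congr rfl fun a _ => by ring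
  rw [h2]
  field_simp
  ring

theorem ftrlObjective_softmax_le {K : ℕ} [NeZero K] {η : ℝ} (hη : 0 < η) (L : Fin K → ℝ)
    {r : Fin K → ℝ} (hr : r ∈ stdSimplex ℝ (Fin K)) :
    ftrlObjective η L (softmax η L) ≤ ftrlObjective η L r := by
  have h := ftrlObjective_sub_softmax hη L hr
  have h' : 0 ≤ (∑ a, softmax η L a * InformationTheory.klFun (r a / softmax η L a)) / η :=
    div_nonneg (Finset.sum_nonneg fun a _ => mul_nonneg (softmax_pos η L a).le
      (InformationTheory.klFun_nonneg (div_nonneg (hr.1 a) (softmax_pos η L a).le))) hη.le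
  linarith

/-- The potential is minus the optimal FTRL value. Testing the problem for `β` at the minimizer for
`β'` costs `(β' - β)` times the entropy, so the entropy that appears belongs to the later
prediction. -/
theorem logPartition_le_of_le {K : ℕ} [NeZero K] {β β' : ℝ} (hβ : 0 < β) (h : β ≤ β')
    (L : Fin K → ℝ) :
    logPartition β' L ≤ logPartition β L + (β' - β) * entropy (softmax (1 / β') L) := by
  have hβ' : 0 < β' := hβ.trans_le h
  rw [logPartition_eq hβ, logPartition_eq hβ']
  have h1 := ftrlObjective_softmax_le (one_div_pos.2 hβ) L (softmax_mem (1 / β') L)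
  have h2 : ftrlObjective (1 / β) L (softmax (1 / β') L) =
      ftrlObjective (1 / β') L (softmax (1 / β') L) + (β' - β) * entropy (softmax (1 / β') L) := by
    unfold ftrlObjective
    field_simp
    ring
  linarith

theorem neg_le_logPartition {K : ℕ} {β : ℝ} (hβ : 0 < β) (L : Fin K → ℝ) (b : Fin K) :
    -L b ≤ logPartition β L := by
  unfold logPartition
  have h : Real.exp (-(1 / β * L b)) ≤ ∑ a, Real.exp (-(1 / β * L a)) :=
    Finset.single_le_sum (f := fun a => Real.exp (-(1 / β * L a)))
      (fun a _ => (Real.exp_pos _).le) (Finset.mem_univ b)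
  have h2 := Real.log_le_log (Real.exp_pos _) h
  rw [Real.log_exp] at h2
  have h3 := mul_le_mul_of_nonneg_left h2 hβ.le
  have h4 : β * -(1 / β * L b) = -L b := by field_simp
  linarith

/-- Uses `exp(-x) ≤ 1 - x + x²` for `|x| ≤ 1`, which is where the losses must be at most `β`,
followed by `log u ≤ u - 1`. -/
theorem logPartition_add_le {K : ℕ} [NeZero K] {β : ℝ} (hβ : 0 < β) (L l : Fin K → ℝ)
    (hl : ∀ a, |l a| ≤ β) :
    logPartition β (L + l) ≤ logPartition β L - ∑ a, softmax (1 / β) L a * l a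
      + 1 / β * ∑ a, softmax (1 / β) L a * l a ^ 2 := by
  have hZ := partition_pos (1 / β) L
  set p := softmax (1 / β) L with hp
  set Z := ∑ a, Real.exp (-(1 / β * L a)) with hZdef
  have hterm : ∀ a, Real.exp (-(1 / β * (L + l) a)) ≤
      Z * (p a - 1 / β * (p a * l a) + (1 / β) ^ 2 * (p a * l a ^ 2)) := by
    intro a
    have h1 : Z * p a = Real.exp (-(1 / β * L a)) := by
      rw [hp]; unfold softmax; rw [← hZdef]; field_simp
    have habs : |-(1 / β * l a)| ≤ 1 := by
      rw [abs_neg, abs_mul, abs_of_pos (one_div_pos.2 hβ), one_div_mul_eq_div, div_le_one hβ]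
      exact hl a
    have h2 := (abs_le.1 (Real.abs_exp_sub_one_sub_id_le habs)).2
    have h3 : Real.exp (-(1 / β * (L + l) a)) =
        Real.exp (-(1 / β * L a)) * Real.exp (-(1 / β * l a)) := by
      rw [← Real.exp_add]; congr 1; simp only [Pi.add_apply]; ring
    rw [h3, ← h1]
    have h4 : Z * (p a - 1 / β * (p a * l a) + (1 / β) ^ 2 * (p a * l a ^ 2)) =
        Z * p a * (1 - 1 / β * l a + (1 / β * l a) ^ 2) := by ring
    rw [h4]
    refine mul_le_mul_of_nonneg_left ?_ (by rw [h1]; exact (Real.exp_pos _).le)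
    rw [neg_sq] at h2
    linarith
  have hsum := Finset.sum_le_sum fun a (_ : a ∈ Finset.univ) => hterm a
  rw [← Finset.mul_sum, Finset.sum_add_distrib, Finset.sum_sub_distrib, ← Finset.mul_sum,
    ← Finset.mul_sum, (softmax_mem (1 / β) L).2] at hsum
  set m := ∑ a, p a * l a
  set v := ∑ a, p a * l a ^ 2
  have hpos := partition_pos (1 / β) (L + l)
  have hfac : 0 < 1 - 1 / β * m + (1 / β) ^ 2 * v := by
    by_contra hcon
    have := mul_nonpos_of_nonneg_of_nonpos hZ.le (not_lt.1 hcon)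
    linarith
  unfold logPartition
  have h5 : Real.log (∑ a, Real.exp (-(1 / β * (L + l) a))) ≤
      Real.log Z + (-(1 / β * m) + (1 / β) ^ 2 * v) := by
    refine (Real.log_le_log hpos hsum).trans ?_
    rw [Real.log_mul hZ.ne' hfac.ne']
    have := Real.log_le_sub_one_of_pos hfac
    linarith
  have h6 := mul_le_mul_of_nonneg_left h5 hβ.le
  have h7 : β * (Real.log Z + (-(1 / β * m) + (1 / β) ^ 2 * v)) =
      β * Real.log Z - m + 1 / β * v := by field_simp; ring
  linarith

theorem logPartition_zero {K : ℕ} (β : ℝ) :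
    logPartition β (0 : Fin K → ℝ) = β * Real.log K := by
  simp [logPartition]

/-- Regret of exponential weights with learning rates `1 / βₜ`, for losses bounded by `βₜ`. -/
theorem exponential_weights_regret {K : ℕ} [NeZero K] (n : ℕ) (β : ℕ → ℝ) (hβ : ∀ t, 0 < β t)
    (hmono : ∀ t, β t ≤ β (t + 1)) (L l : ℕ → Fin K → ℝ) (hL0 : L 0 = 0)
    (hL : ∀ t, L (t + 1) = L t + l t) (hl : ∀ t < n, ∀ a, |l t a| ≤ β t) (b : Fin K) :
    ∑ t ∈ Finset.range n, (∑ a, softmax (1 / β t) (L t) a * l t a - l t b) ≤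
      β 0 * Real.log K
      + ∑ t ∈ Finset.range n,
          (β (t + 1) - β t) * entropy (softmax (1 / β (t + 1)) (L (t + 1)))
      + ∑ t ∈ Finset.range n, 1 / β t * ∑ a, softmax (1 / β t) (L t) a * l t a ^ 2 := by
  -- Accumulated loss plus the potential is the telescoping quantity: a round first adds the loss at
  -- rate `β m`, then changes the rate with the updated loss vector.
  have key : ∀ m ≤ n, ∑ t ∈ Finset.range m, ∑ a, softmax (1 / β t) (L t) a * l t a
      + logPartition (β m) (L m) ≤
      β 0 * Real.log K
      + ∑ t ∈ Finset.range m,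
          (β (t + 1) - β t) * entropy (softmax (1 / β (t + 1)) (L (t + 1)))
      + ∑ t ∈ Finset.range m, 1 / β t * ∑ a, softmax (1 / β t) (L t) a * l t a ^ 2 := by
    intro m
    induction m with
    | zero => intro _; simp [hL0, logPartition_zero]
    | succ m ih =>
      intro hm
      have h0 := ih (by omega)
      have h1 := logPartition_le_of_le (hβ m) (hmono m) (L (m + 1))
      have h2 := logPartition_add_le (hβ m) (L m) (l m) (hl m (by omega))
      rw [← hL] at h2
      simp only [Finset.sum_range_succ]
      linarith
  have hLb : ∀ m, L m b = ∑ t ∈ Finset.range m, l t b := by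
    intro m
    induction m with
    | zero => simp [hL0]
    | succ m ih => rw [Finset.sum_range_succ, hL, Pi.add_apply, ih]
  have h1 := key n le_rfl
  have h2 := neg_le_logPartition (hβ n) (L n) b
  rw [hLb] at h2
  rw [Finset.sum_sub_distrib]
  linarith

/-! ### Sums of adaptive step sizes -/

/-- Write `a = (√(b+a) - √b)(√(b+a) + √b)` and bound the second factor by `2√(b+a)`. -/
theorem div_sqrt_add_le {a b : ℝ} (ha : 0 ≤ a) (hb : 0 ≤ b) :
    a / √(b + a) ≤ 2 * (√(b + a) - √b) := by
  rcases (add_nonneg hb ha).eq_or_lt with h | h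
  · have : a = 0 := by linarith
    simp [this]
  · have hs := Real.sqrt_pos.2 h
    rw [div_le_iff₀ hs]
    nlinarith [Real.sq_sqrt h.le, Real.sq_sqrt hb, sq_nonneg (√(b + a) - √b)]

/-- For `0 ≤ h ≤ M` the sum `∑ₜ hₜ₊₁ / √(M + h₀ + ⋯ + hₜ)` is at most `2 √(h₀ + ⋯ + hₙ)`. -/
theorem sum_div_sqrt_le {M : ℝ} (h : ℕ → ℝ) (h0 : ∀ t, 0 ≤ h t) (hM : ∀ t, h t ≤ M) (n : ℕ) :
    ∑ t ∈ Finset.range n, h (t + 1) / √(M + ∑ s ∈ Finset.range (t + 1), h s) ≤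
      2 * √(∑ s ∈ Finset.range (n + 1), h s) := by
  induction n with
  | zero => simp
  | succ n ih =>
    rw [Finset.sum_range_succ]
    have hb : 0 ≤ ∑ s ∈ Finset.range (n + 1), h s := Finset.sum_nonneg fun s _ => h0 s
    have h1 := div_sqrt_add_le (h0 (n + 1)) hb
    rw [Finset.sum_range_succ _ (n + 1)]
    -- The denominator lacks the current term `h (n + 1)`; the summand `M` stands in for it.
    have h2 : h (n + 1) / √(M + ∑ s ∈ Finset.range (n + 1), h s) ≤
        h (n + 1) / √(∑ s ∈ Finset.range (n + 1), h s + h (n + 1)) := by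
      rcases (add_nonneg hb (h0 (n + 1))).eq_or_lt with h3 | h3
      · have : h (n + 1) = 0 := by linarith [h0 (n + 1)]
        simp [this]
      · exact div_le_div_of_nonneg_left (h0 _) (Real.sqrt_pos.2 h3)
          (Real.sqrt_le_sqrt (by linarith [hM (n + 1)]))
    linarith

theorem sum_one_div_succ_le (n : ℕ) :
    ∑ t ∈ Finset.range n, 1 / ((t : ℝ) + 1) ≤ 1 + Real.log n := by
  have := harmonic_le_one_add_log n
  simpa [harmonic, one_div] using this

theorem sum_one_div_succ_sq_le (n : ℕ) :
    ∑ t ∈ Finset.range n, 1 / ((t : ℝ) + 1) ^ 2 ≤ 2 := by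
  have key : ∀ m : ℕ, ∑ t ∈ Finset.range (m + 1), 1 / ((t : ℝ) + 1) ^ 2 ≤ 2 - 1 / ((m : ℝ) + 1) := by
    intro m
    induction m with
    | zero => norm_num
    | succ m ih =>
      rw [Finset.sum_range_succ]
      have h : 1 / (((m + 1 : ℕ) : ℝ) + 1) ^ 2 ≤
          1 / ((m : ℝ) + 1) - 1 / (((m + 1 : ℕ) : ℝ) + 1) := by
        push_cast
        rw [div_sub_div _ _ (by positivity) (by positivity),
          div_le_div_iff₀ (by positivity) (by positivity)]
        nlinarith [(Nat.cast_nonneg m : (0 : ℝ) ≤ m)]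
      linarith
  cases n with
  | zero => simp
  | succ m =>
    refine (key m).trans ?_
    have : (0 : ℝ) ≤ 1 / ((m : ℝ) + 1) := by positivity
    linarith

/-! ### Prepending a sample to an i.i.d. sequence -/

/-- Prepend an element to a sequence. -/
def consSeq {Z : Type*} (p : Z × (ℕ → Z)) : ℕ → Z
  | 0 => p.1
  | n + 1 => p.2 n

theorem measurable_consSeq {Z : Type*} [MeasurableSpace Z] :
    Measurable (consSeq (Z := Z)) := by
  refine measurable_pi_lambda _ fun n => ?_
  cases n with
  | zero => exact measurable_fst
  | succ n => exact (measurable_pi_apply n).comp measurable_snd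

/-- This is what permits conditioning on the first sample of an i.i.d. sequence while the remaining
samples keep the same law, so that inductions on the number of resampling steps close. -/
theorem measurePreserving_consSeq {Z : Type*} [MeasurableSpace Z] (P : Measure Z)
    [IsProbabilityMeasure P] :
    MeasurePreserving consSeq (P.prod (Measure.infinitePi fun _ : ℕ => P))
      (Measure.infinitePi fun _ : ℕ => P) := by
  refine ⟨measurable_consSeq, Measure.eq_infinitePi _ fun s t ht => ?_⟩
  classical
  rw [Measure.map_apply measurable_consSeq (MeasurableSet.pi s.countable_toSet fun i _ => ht i)]
  -- A cylinder over `s` splits into a condition on coordinate `0`, if present, and a cylinder for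
  -- the tail over the indices shifted down by one.
  set s' : Finset ℕ := s.preimage Nat.succ Nat.succ_injective.injOn with hs'
  have hpre : consSeq ⁻¹' (Set.pi s t) =
      (if 0 ∈ s then t 0 else Set.univ) ×ˢ (Set.pi s' fun i => t (i + 1)) := by
    ext p
    simp only [Set.mem_preimage, Set.mem_pi, Set.mem_prod, hs', Finset.coe_preimage]
    constructor
    · intro h
      refine ⟨?_, fun i hi => h (i + 1) hi⟩
      split_ifs with h0
      · exact h 0 h0
      · trivial
    · rintro ⟨h0, h1⟩ i hi
      cases i with
      | zero => rw [if_pos (by exact_mod_cast hi)] at h0; exact h0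
      | succ i => exact h1 i hi
  rw [hpre, Measure.prod_prod, Measure.infinitePi_pi _ fun i _ => ht (i + 1)]
  have himg : ∏ i ∈ s', P (t (i + 1)) = ∏ i ∈ s.erase 0, P (t i) := by
    rw [← Finset.prod_image (s := s') (g := Nat.succ) (f := fun i => P (t i))
      Nat.succ_injective.injOn]
    congr 1
    ext i
    simp only [hs', Finset.mem_image, Finset.mem_preimage, Finset.mem_erase]
    constructor
    · rintro ⟨j, hj, rfl⟩; exact ⟨by simp, hj⟩
    · rintro ⟨h0, hi⟩
      exact ⟨i - 1, by rwa [Nat.succ_eq_add_one, Nat.sub_add_cancel (by omega)], by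
        rw [Nat.succ_eq_add_one, Nat.sub_add_cancel (by omega)]⟩
  rw [himg]
  split_ifs with h0
  · rw [Finset.mul_prod_erase s (fun i => P (t i)) h0]
  · rw [Finset.erase_eq_of_notMem h0]; simp

theorem integrable_comp_consSeq {Z : Type*} [MeasurableSpace Z] {P : Measure Z}
    [IsProbabilityMeasure P] {F : (ℕ → Z) → ℝ}
    (hF : Integrable F (Measure.infinitePi fun _ : ℕ => P)) :
    Integrable (fun p => F (consSeq p)) (P.prod (Measure.infinitePi fun _ : ℕ => P)) :=
  (measurePreserving_consSeq P).integrable_comp_of_integrable hF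

theorem integral_eq_integral_consSeq {Z : Type*} [MeasurableSpace Z] {P : Measure Z}
    [IsProbabilityMeasure P] {F : (ℕ → Z) → ℝ}
    (hF : Integrable F (Measure.infinitePi fun _ : ℕ => P)) :
    ∫ z, F z ∂(Measure.infinitePi fun _ : ℕ => P) =
      ∫ p, F (consSeq p) ∂(P.prod (Measure.infinitePi fun _ : ℕ => P)) := by
  have h := (measurePreserving_consSeq P)
  conv_lhs => rw [← h.map_eq]
  exact integral_map h.measurable.aemeasurable (by rw [h.map_eq]; exact hF.aestronglyMeasurable)

/-! ### Random products of matrices -/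

theorem dotProduct_sq_le {d : ℕ} (u v : Fin d → ℝ) : (u ⬝ᵥ v) ^ 2 ≤ (u ⬝ᵥ u) * (v ⬝ᵥ v) := by
  have := Finset.sum_mul_sq_le_sq_mul_sq Finset.univ u v
  simpa [dotProduct, sq] using this

theorem dotProduct_self_nonneg' {d : ℕ} (u : Fin d → ℝ) : 0 ≤ u ⬝ᵥ u :=
  Finset.sum_nonneg fun i _ => mul_self_nonneg (u i)

/-- `A_k = ∏_{j < k} (I - B (z j) / 2)`. -/
noncomputable def geomProd {d : ℕ} {Z : Type*} (B : Z → Matrix (Fin d) (Fin d) ℝ) (z : ℕ → Z) :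
    ℕ → Matrix (Fin d) (Fin d) ℝ
  | 0 => 1
  | k + 1 => geomProd B z k * (1 - (1 / 2 : ℝ) • B (z k))

/-- `(1/2) ∑_{k ≤ M} A_k`. -/
noncomputable def geomEst {d : ℕ} {Z : Type*} (B : Z → Matrix (Fin d) (Fin d) ℝ) (z : ℕ → Z)
    (M : ℕ) : Matrix (Fin d) (Fin d) ℝ :=
  (1 / 2 : ℝ) • ∑ k ∈ Finset.range (M + 1), geomProd B z k

/-- New factors are appended on the right, so a prepended sample contributes the leftmost factor,
independent of the rest of the product. -/
theorem geomProd_consSeq {d : ℕ} {Z : Type*} (B : Z → Matrix (Fin d) (Fin d) ℝ)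
    (p : Z × (ℕ → Z)) (k : ℕ) :
    geomProd B (consSeq p) (k + 1) = (1 - (1 / 2 : ℝ) • B p.1) * geomProd B p.2 k := by
  induction k with
  | zero => simp [geomProd, consSeq]
  | succ k ih => rw [geomProd, ih, Matrix.mul_assoc]; rfl

theorem geomEst_consSeq {d : ℕ} {Z : Type*} (B : Z → Matrix (Fin d) (Fin d) ℝ)
    (p : Z × (ℕ → Z)) (M : ℕ) :
    geomEst B (consSeq p) (M + 1) =
      (1 / 2 : ℝ) • 1 + (1 - (1 / 2 : ℝ) • B p.1) * geomEst B p.2 M := by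
  unfold geomEst
  rw [Finset.sum_range_succ', add_comm, smul_add]
  congr 1
  rw [Matrix.mul_smul, Finset.mul_sum]
  congr 1
  exact Finset.sum_congr rfl fun k _ => geomProd_consSeq B p k

theorem measurable_geomProd {d : ℕ} {Z Ω : Type*} [MeasurableSpace Z] [MeasurableSpace Ω]
    {B : Ω → Z → Matrix (Fin d) (Fin d) ℝ}
    (hB : ∀ i j, Measurable fun p : Ω × Z => B p.1 p.2 i j) {ζ : Ω → ℕ → Z} (hζ : Measurable ζ)
    (k : ℕ) : ∀ i j, Measurable fun ω => geomProd (B ω) (ζ ω) k i j := by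
  induction k with
  | zero => intro i j; exact measurable_const
  | succ k ih =>
    intro i j
    simp only [geomProd, Matrix.mul_apply, Matrix.sub_apply, Matrix.smul_apply, smul_eq_mul]
    refine Finset.measurable_sum _ fun l _ => (ih i l).mul (measurable_const.sub
      (measurable_const.mul ?_))
    exact (hB l j).comp (measurable_id.prodMk ((measurable_pi_apply k).comp hζ))

theorem measurable_geomEst {d : ℕ} {Z Ω : Type*} [MeasurableSpace Z] [MeasurableSpace Ω]
    {B : Ω → Z → Matrix (Fin d) (Fin d) ℝ}
    (hB : ∀ i j, Measurable fun p : Ω × Z => B p.1 p.2 i j) {ζ : Ω → ℕ → Z} (hζ : Measurable ζ)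
    {M : Ω → ℕ} (hM : Measurable M) (i j : Fin d) :
    Measurable fun ω => geomEst (B ω) (ζ ω) (M ω) i j := by
  have h : ∀ m : ℕ, Measurable fun ω => geomEst (B ω) (ζ ω) m i j := by
    intro m
    simp only [geomEst, Matrix.smul_apply, Matrix.sum_apply, smul_eq_mul]
    exact measurable_const.mul (Finset.measurable_sum _ fun k _ => measurable_geomProd hB hζ k i j)
  -- The number of factors is itself random, but it takes countably many values.
  exact (measurable_from_prod_countable_right (f := fun p : ℕ × Ω => geomEst (B p.2) (ζ p.2) p.1 i j)
    h).comp (hM.prodMk measurable_id)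

/-- Random symmetric matrices `B` with `0 ≤ B² ≤ B`. -/
structure IsSubprojection {d : ℕ} {Z : Type*} [MeasurableSpace Z] (P : Measure Z)
    (B : Z → Matrix (Fin d) (Fin d) ℝ) : Prop where
  meas : ∀ i j, Measurable fun z => B z i j
  symm : ∀ z, (B z)ᵀ = B z
  nonneg : ∀ z u, 0 ≤ u ⬝ᵥ (B z *ᵥ u)
  sq_le : ∀ᵐ z ∂P, ∀ u, (B z *ᵥ u) ⬝ᵥ (B z *ᵥ u) ≤ u ⬝ᵥ (B z *ᵥ u)

/-- The entrywise mean of a random matrix. -/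
noncomputable def meanMatrix {d : ℕ} {Z : Type*} [MeasurableSpace Z] (P : Measure Z)
    (B : Z → Matrix (Fin d) (Fin d) ℝ) : Matrix (Fin d) (Fin d) ℝ :=
  Matrix.of fun i j => ∫ z, B z i j ∂P

/-- Expand the square: the cross term is `-uᵀBu`, and `B² ≤ B` bounds the quadratic term by `(1/4)
uᵀBu`. The surplus `(3/4) uᵀBu` drives the telescoping in the second moment. -/
theorem contract {d : ℕ} {B : Matrix (Fin d) (Fin d) ℝ}
    (h : ∀ u, (B *ᵥ u) ⬝ᵥ (B *ᵥ u) ≤ u ⬝ᵥ (B *ᵥ u)) (u : Fin d → ℝ) :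
    ((1 - (1 / 2 : ℝ) • B) *ᵥ u) ⬝ᵥ ((1 - (1 / 2 : ℝ) • B) *ᵥ u) ≤
      u ⬝ᵥ u - 3 / 4 * (u ⬝ᵥ (B *ᵥ u)) := by
  have := h u
  simp only [Matrix.sub_mulVec, Matrix.one_mulVec, Matrix.smul_mulVec, dotProduct_sub,
    sub_dotProduct, smul_dotProduct, dotProduct_smul, smul_eq_mul]
  rw [dotProduct_comm (B *ᵥ u) u]
  linarith

theorem vecMul_one_sub {d : ℕ} {B : Matrix (Fin d) (Fin d) ℝ} (hs : Bᵀ = B) (u : Fin d → ℝ) :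
    u ᵥ* (1 - (1 / 2 : ℝ) • B) = (1 - (1 / 2 : ℝ) • B) *ᵥ u := by
  rw [← Matrix.mulVec_transpose, Matrix.transpose_sub, Matrix.transpose_one,
    Matrix.transpose_smul, hs]

theorem dotProduct_mulVec_symm {d : ℕ} {B : Matrix (Fin d) (Fin d) ℝ} (hs : Bᵀ = B)
    (u v : Fin d → ℝ) : u ⬝ᵥ (B *ᵥ v) = v ⬝ᵥ (B *ᵥ u) := by
  rw [Matrix.dotProduct_mulVec, ← Matrix.mulVec_transpose, hs, dotProduct_comm]

theorem contract_le {d : ℕ} {B : Matrix (Fin d) (Fin d) ℝ}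
    (h0 : ∀ u, 0 ≤ u ⬝ᵥ (B *ᵥ u))
    (h : ∀ u, (B *ᵥ u) ⬝ᵥ (B *ᵥ u) ≤ u ⬝ᵥ (B *ᵥ u)) (u : Fin d → ℝ) :
    ((1 - (1 / 2 : ℝ) • B) *ᵥ u) ⬝ᵥ ((1 - (1 / 2 : ℝ) • B) *ᵥ u) ≤ u ⬝ᵥ u := by
  linarith [contract h u, h0 u]

/-- Expand `0 ≤ ‖u - Bu‖²`; no spectral decomposition is needed. -/
theorem dotProduct_mulVec_le_of_sq_le {d : ℕ} {B : Matrix (Fin d) (Fin d) ℝ}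
    (hz : ∀ u, (B *ᵥ u) ⬝ᵥ (B *ᵥ u) ≤ u ⬝ᵥ (B *ᵥ u)) (u : Fin d → ℝ) :
    u ⬝ᵥ (B *ᵥ u) ≤ u ⬝ᵥ u := by
  have h1 := hz u
  have h2 : 0 ≤ (u - B *ᵥ u) ⬝ᵥ (u - B *ᵥ u) := dotProduct_self_nonneg' _
  simp only [dotProduct_sub, sub_dotProduct] at h2
  rw [dotProduct_comm (B *ᵥ u) u] at h2
  linarith

theorem abs_dotProduct_mulVec_le_of_sq_le {d : ℕ} {B : Matrix (Fin d) (Fin d) ℝ}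
    (hz : ∀ u, (B *ᵥ u) ⬝ᵥ (B *ᵥ u) ≤ u ⬝ᵥ (B *ᵥ u)) (u v : Fin d → ℝ) :
    |u ⬝ᵥ (B *ᵥ v)| ≤ √(u ⬝ᵥ u) * √(v ⬝ᵥ v) := by
  rw [← Real.sqrt_mul (dotProduct_self_nonneg' u)]
  refine Real.abs_le_sqrt ((dotProduct_sq_le _ _).trans ?_)
  exact mul_le_mul_of_nonneg_left ((hz v).trans (dotProduct_mulVec_le_of_sq_le hz v))
    (dotProduct_self_nonneg' u)

/-! ### Products of independent contractions: pathwise bounds and means -/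

section Products

variable {d : ℕ} {Z : Type*} [MeasurableSpace Z] {P : Measure Z}
  {B : Z → Matrix (Fin d) (Fin d) ℝ}

theorem IsSubprojection.geomProd_vecMul_le (hB : IsSubprojection P B) {z : ℕ → Z}
    (hz : ∀ n, ∀ u, (B (z n) *ᵥ u) ⬝ᵥ (B (z n) *ᵥ u) ≤ u ⬝ᵥ (B (z n) *ᵥ u)) (k : ℕ)
    (v : Fin d → ℝ) : (v ᵥ* geomProd B z k) ⬝ᵥ (v ᵥ* geomProd B z k) ≤ v ⬝ᵥ v := by
  induction k with
  | zero => simp [geomProd]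
  | succ k ih =>
    rw [geomProd, ← Matrix.vecMul_vecMul, vecMul_one_sub (hB.symm _)]
    exact (contract_le (hB.nonneg _) (hz k) _).trans ih

theorem IsSubprojection.geomProd_mulVec_le (hB : IsSubprojection P B) {z : ℕ → Z}
    (hz : ∀ n, ∀ u, (B (z n) *ᵥ u) ⬝ᵥ (B (z n) *ᵥ u) ≤ u ⬝ᵥ (B (z n) *ᵥ u)) (k : ℕ)
    (v : Fin d → ℝ) : (geomProd B z k *ᵥ v) ⬝ᵥ (geomProd B z k *ᵥ v) ≤ v ⬝ᵥ v := by
  induction k generalizing v with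
  | zero => simp [geomProd]
  | succ k ih =>
    rw [geomProd, ← Matrix.mulVec_mulVec]
    exact (ih _).trans (contract_le (hB.nonneg _) (hz k) _)

theorem IsSubprojection.abs_geomProd_le (hB : IsSubprojection P B) {z : ℕ → Z}
    (hz : ∀ n, ∀ u, (B (z n) *ᵥ u) ⬝ᵥ (B (z n) *ᵥ u) ≤ u ⬝ᵥ (B (z n) *ᵥ u)) (k : ℕ)
    (u v : Fin d → ℝ) : |u ⬝ᵥ (geomProd B z k *ᵥ v)| ≤ √(u ⬝ᵥ u) * √(v ⬝ᵥ v) := by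
  rw [← Real.sqrt_mul (dotProduct_self_nonneg' u)]
  refine Real.abs_le_sqrt ((dotProduct_sq_le _ _).trans ?_)
  exact mul_le_mul_of_nonneg_left (hB.geomProd_mulVec_le hz k v) (dotProduct_self_nonneg' u)

/-- Half a sum of `M + 1` contractions. This pathwise bound later keeps the estimated losses below
`β_t`. -/
theorem IsSubprojection.abs_geomEst_le (hB : IsSubprojection P B) {z : ℕ → Z}
    (hz : ∀ n, ∀ u, (B (z n) *ᵥ u) ⬝ᵥ (B (z n) *ᵥ u) ≤ u ⬝ᵥ (B (z n) *ᵥ u)) (M : ℕ)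
    (u v : Fin d → ℝ) :
    |u ⬝ᵥ (geomEst B z M *ᵥ v)| ≤ (M + 1) / 2 * (√(u ⬝ᵥ u) * √(v ⬝ᵥ v)) := by
  unfold geomEst
  rw [Matrix.smul_mulVec, dotProduct_smul, Matrix.sum_mulVec, dotProduct_sum, smul_eq_mul, abs_mul]
  have h := (Finset.abs_sum_le_sum_abs (fun k => u ⬝ᵥ (geomProd B z k *ᵥ v))
    (Finset.range (M + 1))).trans (Finset.sum_le_sum fun k _ => hB.abs_geomProd_le hz k u v)
  rw [Finset.sum_const, Finset.card_range, nsmul_eq_mul] at h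
  rw [abs_of_pos (by norm_num : (0 : ℝ) < 1 / 2)]
  push_cast at h
  linarith

theorem measurable_dotProduct_mulVec {Ω : Type*} [MeasurableSpace Ω]
    {A : Ω → Matrix (Fin d) (Fin d) ℝ} (hA : ∀ i j, Measurable fun ω => A ω i j)
    {u v : Ω → Fin d → ℝ} (hu : ∀ i, Measurable fun ω => u ω i)
    (hv : ∀ i, Measurable fun ω => v ω i) :
    Measurable fun ω => u ω ⬝ᵥ (A ω *ᵥ v ω) := by
  simp only [dotProduct, Matrix.mulVec]
  exact Finset.measurable_sum _ fun i _ => (hu i).mul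
    (Finset.measurable_sum _ fun j _ => (hA i j).mul (hv j))

theorem measurable_mulVec_apply {Ω : Type*} [MeasurableSpace Ω]
    {A : Ω → Matrix (Fin d) (Fin d) ℝ} (hA : ∀ i j, Measurable fun ω => A ω i j)
    {v : Ω → Fin d → ℝ} (hv : ∀ i, Measurable fun ω => v ω i) (i : Fin d) :
    Measurable fun ω => (A ω *ᵥ v ω) i := by
  simp only [dotProduct, Matrix.mulVec]
  exact Finset.measurable_sum _ fun j _ => (hA i j).mul (hv j)

theorem measurable_vecMul_apply {Ω : Type*} [MeasurableSpace Ω]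
    {A : Ω → Matrix (Fin d) (Fin d) ℝ} (hA : ∀ i j, Measurable fun ω => A ω i j)
    {v : Ω → Fin d → ℝ} (hv : ∀ i, Measurable fun ω => v ω i) (i : Fin d) :
    Measurable fun ω => (v ω ᵥ* A ω) i := by
  simp only [dotProduct, Matrix.vecMul]
  exact Finset.measurable_sum _ fun j _ => (hv j).mul (hA j i)

theorem measurable_dotProduct {Ω : Type*} [MeasurableSpace Ω]
    {u v : Ω → Fin d → ℝ} (hu : ∀ i, Measurable fun ω => u ω i)
    (hv : ∀ i, Measurable fun ω => v ω i) :
    Measurable fun ω => u ω ⬝ᵥ v ω := by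
  simp only [dotProduct]
  exact Finset.measurable_sum _ fun i _ => (hu i).mul (hv i)

theorem IsSubprojection.measurable_geomProd (hB : IsSubprojection P B) (k : ℕ) (i j : Fin d) :
    Measurable fun z => geomProd B z k i j :=
  LinCB.measurable_geomProd (B := fun _ : ℕ → Z => B) (fun i j => (hB.meas i j).comp measurable_snd)
    measurable_id k i j

theorem IsSubprojection.measurable_geomEst (hB : IsSubprojection P B) (M : ℕ) (i j : Fin d) :
    Measurable fun z => geomEst B z M i j :=
  LinCB.measurable_geomEst (B := fun _ : ℕ → Z => B) (fun i j => (hB.meas i j).comp measurable_snd)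
    measurable_id measurable_const i j

theorem IsSubprojection.meanMatrix_symm (hB : IsSubprojection P B) :
    (meanMatrix P B)ᵀ = meanMatrix P B := by
  ext i j
  simp only [meanMatrix, Matrix.transpose_apply, Matrix.of_apply]
  refine integral_congr_ae (Filter.Eventually.of_forall fun z => ?_)
  exact congrFun (congrFun (hB.symm z) i) j

/-- The finite geometric series with ratio `I - S/2`, for which `I` minus the ratio is `S/2`. -/
theorem half_geom_sum_mul {S : Matrix (Fin d) (Fin d) ℝ} (n : ℕ) :
    ((1 / 2 : ℝ) • ∑ k ∈ Finset.range n, (1 - (1 / 2 : ℝ) • S) ^ k) * S =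
      1 - (1 - (1 / 2 : ℝ) • S) ^ n := by
  rw [← geom_sum_mul_neg]
  simp

variable [IsProbabilityMeasure P]

theorem ae_forall_infinitePi {p : Z → Prop} (h : ∀ᵐ z ∂P, p z) :
    ∀ᵐ z ∂(Measure.infinitePi fun _ : ℕ => P), ∀ n, p (z n) :=
  ae_all_iff.2 fun n =>
    (measurePreserving_eval_infinitePi (fun _ : ℕ => P) n).quasiMeasurePreserving.ae h

theorem IsSubprojection.integrable_geomProd (hB : IsSubprojection P B) (k : ℕ)
    (u v : Fin d → ℝ) :
    Integrable (fun z => u ⬝ᵥ (geomProd B z k *ᵥ v)) (Measure.infinitePi fun _ : ℕ => P) := by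
  refine Integrable.of_bound (measurable_dotProduct_mulVec (u := fun _ => u) (v := fun _ => v)
    (hB.measurable_geomProd k) (fun i => measurable_const) (fun i => measurable_const)).aestronglyMeasurable
    (√(u ⬝ᵥ u) * √(v ⬝ᵥ v)) ?_
  filter_upwards [ae_forall_infinitePi hB.sq_le] with z hz
  exact hB.abs_geomProd_le hz k u v

theorem IsSubprojection.integrable_geomEst (hB : IsSubprojection P B) (M : ℕ)
    (u v : Fin d → ℝ) :
    Integrable (fun z => u ⬝ᵥ (geomEst B z M *ᵥ v)) (Measure.infinitePi fun _ : ℕ => P) := by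
  refine Integrable.of_bound (measurable_dotProduct_mulVec (u := fun _ => u) (v := fun _ => v)
    (hB.measurable_geomEst M) (fun i => measurable_const) (fun i => measurable_const)).aestronglyMeasurable
    ((M + 1) / 2 * (√(u ⬝ᵥ u) * √(v ⬝ᵥ v))) ?_
  filter_upwards [ae_forall_infinitePi hB.sq_le] with z hz
  exact hB.abs_geomEst_le hz M u v

theorem IsSubprojection.integrable (hB : IsSubprojection P B) (u v : Fin d → ℝ) :
    Integrable (fun z => u ⬝ᵥ (B z *ᵥ v)) P := by
  refine Integrable.of_bound (measurable_dotProduct_mulVec (u := fun _ => u) (v := fun _ => v)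
    hB.meas (fun i => measurable_const) (fun i => measurable_const)).aestronglyMeasurable
    (√(u ⬝ᵥ u) * √(v ⬝ᵥ v)) ?_
  filter_upwards [hB.sq_le] with z hz
  exact abs_dotProduct_mulVec_le_of_sq_le hz u v

theorem IsSubprojection.integral_eq (hB : IsSubprojection P B) (u v : Fin d → ℝ) :
    ∫ z, u ⬝ᵥ (B z *ᵥ v) ∂P = u ⬝ᵥ (meanMatrix P B *ᵥ v) := by
  have hint : ∀ i j, Integrable (fun z => B z i j) P := fun i j => by
    simpa using hB.integrable (Pi.single i 1) (Pi.single j 1)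
  simp only [dotProduct, Matrix.mulVec, meanMatrix, Matrix.of_apply]
  rw [integral_finsetSum _ fun i _ => (integrable_finsetSum _ fun j _ =>
    (hint i j).mul_const _).const_mul _]
  refine Finset.sum_congr rfl fun i _ => ?_
  rw [integral_const_mul, integral_finsetSum _ fun j _ => (hint i j).mul_const _]
  congr 1
  exact Finset.sum_congr rfl fun j _ => integral_mul_const _ _

theorem IsSubprojection.meanMatrix_nonneg (hB : IsSubprojection P B) (u : Fin d → ℝ) :
    0 ≤ u ⬝ᵥ (meanMatrix P B *ᵥ u) := by
  rw [← hB.integral_eq]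
  exact integral_nonneg fun z => hB.nonneg z u

theorem IsSubprojection.meanMatrix_le (hB : IsSubprojection P B) (u : Fin d → ℝ) :
    u ⬝ᵥ (meanMatrix P B *ᵥ u) ≤ u ⬝ᵥ u := by
  rw [← hB.integral_eq]
  have : ∫ z, u ⬝ᵥ (B z *ᵥ u) ∂P ≤ ∫ _, u ⬝ᵥ u ∂P := by
    refine integral_mono_ae (hB.integrable u u) (integrable_const _) ?_
    filter_upwards [hB.sq_le] with z hz
    exact dotProduct_mulVec_le_of_sq_le hz u
  simpa using this

theorem IsSubprojection.integral_one_sub (hB : IsSubprojection P B) (u v : Fin d → ℝ) :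
    ∫ z, u ⬝ᵥ ((1 - (1 / 2 : ℝ) • B z) *ᵥ v) ∂P =
      u ⬝ᵥ ((1 - (1 / 2 : ℝ) • meanMatrix P B) *ᵥ v) := by
  simp only [Matrix.sub_mulVec, Matrix.one_mulVec, Matrix.smul_mulVec, dotProduct_sub,
    dotProduct_smul, smul_eq_mul]
  rw [integral_sub (integrable_const _) ((hB.integrable u v).const_mul _), integral_const_mul,
    hB.integral_eq]
  simp

/-- The mean of a product of independent factors. -/
theorem IsSubprojection.integral_geomProd (hB : IsSubprojection P B) (k : ℕ) (u v : Fin d → ℝ) :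
    ∫ z, u ⬝ᵥ (geomProd B z k *ᵥ v) ∂(Measure.infinitePi fun _ : ℕ => P) =
      u ⬝ᵥ (((1 - (1 / 2 : ℝ) • meanMatrix P B) ^ k) *ᵥ v) := by
  induction k generalizing u with
  | zero => simp [geomProd]
  | succ k ih =>
    have hint := hB.integrable_geomProd (k + 1) u v
    rw [integral_eq_integral_consSeq hint, integral_prod _ (integrable_comp_consSeq hint)]
    simp only [geomProd_consSeq, ← Matrix.mulVec_mulVec]
    -- The first factor is moved onto the left vector, so the induction hypothesis, which holds for
    -- every `u`, evaluates the inner integral.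
    simp only [fun (A : Matrix (Fin d) (Fin d) ℝ) w => Matrix.dotProduct_mulVec u A w]
    simp only [ih]
    simp only [← fun (A : Matrix (Fin d) (Fin d) ℝ) w => Matrix.dotProduct_mulVec u A w]
    rw [hB.integral_one_sub, pow_succ', ← Matrix.mulVec_mulVec]

theorem IsSubprojection.integral_geomEst (hB : IsSubprojection P B) (M : ℕ) (u v : Fin d → ℝ) :
    ∫ z, u ⬝ᵥ (geomEst B z M *ᵥ v) ∂(Measure.infinitePi fun _ : ℕ => P) =
      u ⬝ᵥ (((1 / 2 : ℝ) • ∑ k ∈ Finset.range (M + 1),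
        (1 - (1 / 2 : ℝ) • meanMatrix P B) ^ k) *ᵥ v) := by
  simp only [geomEst, Matrix.smul_mulVec, dotProduct_smul, Matrix.sum_mulVec, dotProduct_sum,
    smul_eq_mul]
  rw [integral_const_mul, integral_finsetSum _ fun k _ => hB.integrable_geomProd k u v]
  simp only [hB.integral_geomProd]

/-- Matrix geometric resampling inverts the mean up to a power of `I - S / 2`. -/
theorem IsSubprojection.integral_geomEst_mean (hB : IsSubprojection P B) (M : ℕ)
    (u v : Fin d → ℝ) :
    ∫ z, u ⬝ᵥ (geomEst B z M *ᵥ (meanMatrix P B *ᵥ v)) ∂(Measure.infinitePi fun _ : ℕ => P) =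
      u ⬝ᵥ v - u ⬝ᵥ (((1 - (1 / 2 : ℝ) • meanMatrix P B) ^ (M + 1)) *ᵥ v) := by
  rw [hB.integral_geomEst, Matrix.mulVec_mulVec, half_geom_sum_mul, Matrix.sub_mulVec,
    Matrix.one_mulVec, dotProduct_sub]

end Products

theorem integral_const_add_add {Ω : Type*} [MeasurableSpace Ω] {μ : Measure Ω}
    [IsProbabilityMeasure μ] (c : ℝ) {f g : Ω → ℝ} (hf : Integrable f μ) (hg : Integrable g μ) :
    ∫ x, (c + f x + g x) ∂μ = c + ∫ x, f x ∂μ + ∫ x, g x ∂μ := by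
  have h : Integrable (fun x => c + f x) μ := (integrable_const c).add hf
  rw [integral_add h hg, integral_add (integrable_const c) hf]
  simp

/-! ### Second moment of matrix geometric resampling -/

section SecondMoment

variable {d : ℕ} {Z : Type*} [MeasurableSpace Z] {P : Measure Z} [IsProbabilityMeasure P]
  {B : Z → Matrix (Fin d) (Fin d) ℝ}

theorem quadratic_le_of_isSubprojection (hB : IsSubprojection P B) (u : Fin d → ℝ) :
    |u ⬝ᵥ (meanMatrix P B *ᵥ u)| ≤ u ⬝ᵥ u := by
  rw [abs_of_nonneg (hB.meanMatrix_nonneg u)]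
  exact hB.meanMatrix_le u

theorem IsSubprojection.integrable_vecMul_sq (hB : IsSubprojection P B) (k : ℕ)
    (v : Fin d → ℝ) :
    Integrable (fun z => (v ᵥ* geomProd B z k) ⬝ᵥ (v ᵥ* geomProd B z k))
      (Measure.infinitePi fun _ : ℕ => P) := by
  have hm := measurable_vecMul_apply (v := fun _ => v) (hB.measurable_geomProd k)
    (fun i => measurable_const)
  refine Integrable.of_bound (measurable_dotProduct hm hm).aestronglyMeasurable (v ⬝ᵥ v) ?_
  filter_upwards [ae_forall_infinitePi hB.sq_le] with z hz
  rw [Real.norm_eq_abs, abs_of_nonneg (dotProduct_self_nonneg' _)]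
  exact hB.geomProd_vecMul_le hz k v

theorem IsSubprojection.integrable_mulVec_sq (hB : IsSubprojection P B) (k : ℕ)
    (v : Fin d → ℝ) :
    Integrable (fun z => (geomProd B z k *ᵥ v) ⬝ᵥ (geomProd B z k *ᵥ v))
      (Measure.infinitePi fun _ : ℕ => P) := by
  have hm := measurable_mulVec_apply (v := fun _ => v) (hB.measurable_geomProd k)
    (fun i => measurable_const)
  refine Integrable.of_bound (measurable_dotProduct hm hm).aestronglyMeasurable (v ⬝ᵥ v) ?_
  filter_upwards [ae_forall_infinitePi hB.sq_le] with z hz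
  rw [Real.norm_eq_abs, abs_of_nonneg (dotProduct_self_nonneg' _)]
  exact hB.geomProd_mulVec_le hz k v

theorem IsSubprojection.integrable_mulVec_quadratic (hB : IsSubprojection P B) (k : ℕ)
    (v : Fin d → ℝ) :
    Integrable (fun z => (geomProd B z k *ᵥ v) ⬝ᵥ (meanMatrix P B *ᵥ (geomProd B z k *ᵥ v)))
      (Measure.infinitePi fun _ : ℕ => P) := by
  have hm := measurable_mulVec_apply (v := fun _ => v) (hB.measurable_geomProd k)
    (fun i => measurable_const)
  refine (hB.integrable_mulVec_sq k v).mono' (measurable_dotProduct_mulVec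
    (A := fun _ => meanMatrix P B) (fun _ _ => measurable_const) hm hm).aestronglyMeasurable ?_
  exact Filter.Eventually.of_forall fun z => quadratic_le_of_isSubprojection hB _

/-- The quadratic form of the mean matrix, summed along the products `A_k`. -/
theorem IsSubprojection.sum_integral_quadratic_le (hB : IsSubprojection P B) (n : ℕ)
    (v : Fin d → ℝ) :
    ∑ k ∈ Finset.range n, ∫ z, (geomProd B z k *ᵥ v) ⬝ᵥ
      (meanMatrix P B *ᵥ (geomProd B z k *ᵥ v)) ∂(Measure.infinitePi fun _ : ℕ => P) ≤
      4 / 3 * (v ⬝ᵥ v) := by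
  -- One more factor lowers the mean squared norm by `3/4` of the quadratic form; summing this gives
  -- the constant `4/3`.
  have step : ∀ k, ∫ z, (geomProd B z (k + 1) *ᵥ v) ⬝ᵥ (geomProd B z (k + 1) *ᵥ v)
        ∂(Measure.infinitePi fun _ : ℕ => P) ≤
      ∫ z, (geomProd B z k *ᵥ v) ⬝ᵥ (geomProd B z k *ᵥ v) ∂(Measure.infinitePi fun _ : ℕ => P)
      - 3 / 4 * ∫ z, (geomProd B z k *ᵥ v) ⬝ᵥ
      (meanMatrix P B *ᵥ (geomProd B z k *ᵥ v)) ∂(Measure.infinitePi fun _ : ℕ => P) := by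
    intro k
    have hint := hB.integrable_mulVec_sq (k + 1) v
    -- The first sample is integrated innermost: acting on `v` from the left, its factor is applied
    -- last, to a vector depending only on the other samples.
    rw [integral_eq_integral_consSeq hint, integral_prod_symm _ (integrable_comp_consSeq hint),
      ← integral_const_mul, ← integral_sub (hB.integrable_mulVec_sq k v)
        ((hB.integrable_mulVec_quadratic k v).const_mul _)]
    refine integral_mono_ae (integrable_comp_consSeq hint).integral_prod_right
      ((hB.integrable_mulVec_sq k v).sub ((hB.integrable_mulVec_quadratic k v).const_mul _))
      ((integrable_comp_consSeq hint).prod_left_ae.mono fun z hz => ?_)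
    simp only [geomProd_consSeq, ← Matrix.mulVec_mulVec] at hz ⊢
    set u := geomProd B z k *ᵥ v
    have h1 : ∫ z0, u ⬝ᵥ u - 3 / 4 * (u ⬝ᵥ (B z0 *ᵥ u)) ∂P =
        u ⬝ᵥ u - 3 / 4 * (u ⬝ᵥ (meanMatrix P B *ᵥ u)) := by
      rw [integral_sub (integrable_const _) ((hB.integrable u u).const_mul _),
        integral_const_mul, hB.integral_eq]
      simp
    rw [← h1]
    refine integral_mono_ae hz ((integrable_const _).sub ((hB.integrable u u).const_mul _)) ?_
    filter_upwards [hB.sq_le] with z0 hz0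
    exact contract hz0 u
  have key : ∀ n, 3 / 4 * ∑ k ∈ Finset.range n, ∫ z, (geomProd B z k *ᵥ v) ⬝ᵥ
      (meanMatrix P B *ᵥ (geomProd B z k *ᵥ v)) ∂(Measure.infinitePi fun _ : ℕ => P) +
      ∫ z, (geomProd B z n *ᵥ v) ⬝ᵥ (geomProd B z n *ᵥ v) ∂(Measure.infinitePi fun _ : ℕ => P)
      ≤ v ⬝ᵥ v := by
    intro n
    induction n with
    | zero => simp [geomProd]
    | succ n ih =>
      rw [Finset.sum_range_succ]
      linarith [step n]
  have h0 : 0 ≤ ∫ z, (geomProd B z n *ᵥ v) ⬝ᵥ (geomProd B z n *ᵥ v)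
      ∂(Measure.infinitePi fun _ : ℕ => P) :=
    integral_nonneg fun z => dotProduct_self_nonneg' _
  linarith [key n]

/-- `I - S/2` is positive semidefinite because `S ≤ I`, hence so are its powers. This gives the sign
of the remainder dropped in the second moment bound. -/
theorem IsSubprojection.resolvent_nonneg (hB : IsSubprojection P B) (n : ℕ) (v : Fin d → ℝ) :
    0 ≤ v ⬝ᵥ ((1 - (1 / 2 : ℝ) • meanMatrix P B) ^ n *ᵥ v) := by
  have hpsd : (1 - (1 / 2 : ℝ) • meanMatrix P B).PosSemidef := by
    refine Matrix.PosSemidef.of_dotProduct_mulVec_nonneg ?_ fun u => ?_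
    · rw [Matrix.IsHermitian, Matrix.conjTranspose_eq_transpose_of_trivial, Matrix.transpose_sub,
        Matrix.transpose_one, Matrix.transpose_smul, hB.meanMatrix_symm]
    · rw [star_trivial, Matrix.sub_mulVec, Matrix.one_mulVec, Matrix.smul_mulVec, dotProduct_sub,
        dotProduct_smul, smul_eq_mul]
      linarith [hB.meanMatrix_le u, dotProduct_self_nonneg' u]
  have := (hpsd.pow n).dotProduct_mulVec_nonneg v
  rwa [star_trivial] at this

theorem IsSubprojection.integrable_vecMul_quadratic (hB : IsSubprojection P B) (M : ℕ)
    (v : Fin d → ℝ) :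
    Integrable (fun z => (v ᵥ* geomEst B z M) ⬝ᵥ (meanMatrix P B *ᵥ (v ᵥ* geomEst B z M)))
      (Measure.infinitePi fun _ : ℕ => P) := by
  have hm := measurable_vecMul_apply (v := fun _ => v) (hB.measurable_geomEst M)
    (fun i => measurable_const)
  refine Integrable.of_bound (measurable_dotProduct_mulVec
    (A := fun _ => meanMatrix P B) (fun _ _ => measurable_const) hm hm).aestronglyMeasurable
    (d * ((M + 1) / 2 * √(v ⬝ᵥ v)) ^ 2) ?_
  filter_upwards [ae_forall_infinitePi hB.sq_le] with z hz
  refine (quadratic_le_of_isSubprojection hB _).trans ?_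
  -- Each coordinate is the bilinear form paired with a basis vector.
  have hi : ∀ i, (v ᵥ* geomEst B z M) i * (v ᵥ* geomEst B z M) i ≤
      ((M + 1) / 2 * √(v ⬝ᵥ v)) ^ 2 := by
    intro i
    have h := hB.abs_geomEst_le hz M v (Pi.single i 1)
    rw [Matrix.dotProduct_mulVec] at h
    simp only [dotProduct_single, mul_one, Pi.single_eq_same, Real.sqrt_one] at h
    rw [← sq, ← sq_abs]
    exact pow_le_pow_left₀ (abs_nonneg _) h 2
  calc (v ᵥ* geomEst B z M) ⬝ᵥ (v ᵥ* geomEst B z M)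
      ≤ ∑ _i : Fin d, ((M + 1) / 2 * √(v ⬝ᵥ v)) ^ 2 := Finset.sum_le_sum fun i _ => hi i
    _ = _ := by simp

/-- The second moment of matrix geometric resampling is controlled by the products `A_k`. -/
theorem IsSubprojection.integral_quadratic_geomEst_le (hB : IsSubprojection P B) (M : ℕ)
    (v : Fin d → ℝ) :
    ∫ z, (v ᵥ* geomEst B z M) ⬝ᵥ (meanMatrix P B *ᵥ (v ᵥ* geomEst B z M))
        ∂(Measure.infinitePi fun _ : ℕ => P) ≤
      ∑ k ∈ Finset.range (M + 1), ∫ z, (v ᵥ* geomProd B z k) ⬝ᵥ (v ᵥ* geomProd B z k)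
        ∂(Measure.infinitePi fun _ : ℕ => P) := by
  set S := meanMatrix P B with hS
  induction M generalizing v with
  | zero =>
    simp only [geomEst, zero_add, Finset.sum_range_one, geomProd, Matrix.vecMul_smul,
      Matrix.vecMul_one, Matrix.mulVec_smul, smul_dotProduct, dotProduct_smul, smul_eq_mul]
    simp only [integral_const, probReal_univ, one_smul]
    linarith [hB.meanMatrix_le v, dotProduct_self_nonneg' v, hB.meanMatrix_nonneg v]
  | succ N ih =>
    have hint := hB.integrable_vecMul_quadratic (N + 1) v
    rw [← hS] at hint
    -- For row vectors the first factor acts first, so terms with `k + 1` factors are terms with `k`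
    -- factors for the random vector `v(I - B/2)`, to which the induction hypothesis applies.
    have hh : ∀ k, ∫ z, (v ᵥ* geomProd B z (k + 1)) ⬝ᵥ (v ᵥ* geomProd B z (k + 1))
        ∂(Measure.infinitePi fun _ : ℕ => P) = ∫ z0, ∫ z,
          ((v ᵥ* (1 - (1 / 2 : ℝ) • B z0)) ᵥ* geomProd B z k) ⬝ᵥ
          ((v ᵥ* (1 - (1 / 2 : ℝ) • B z0)) ᵥ* geomProd B z k)
        ∂(Measure.infinitePi fun _ : ℕ => P) ∂P := by
      intro k
      have h := hB.integrable_vecMul_sq (k + 1) v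
      rw [integral_eq_integral_consSeq h, integral_prod _ (integrable_comp_consSeq h)]
      simp only [geomProd_consSeq, ← Matrix.vecMul_vecMul]
    have hhint : ∀ k, Integrable (fun z0 => ∫ z,
          ((v ᵥ* (1 - (1 / 2 : ℝ) • B z0)) ᵥ* geomProd B z k) ⬝ᵥ
          ((v ᵥ* (1 - (1 / 2 : ℝ) • B z0)) ᵥ* geomProd B z k)
        ∂(Measure.infinitePi fun _ : ℕ => P)) P := by
      intro k
      have h := (integrable_comp_consSeq (hB.integrable_vecMul_sq (k + 1) v)).integral_prod_left
      simpa only [geomProd_consSeq, ← Matrix.vecMul_vecMul] using h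
    rw [Finset.sum_range_succ']
    simp only [hh]
    rw [integral_eq_integral_consSeq hint, integral_prod _ (integrable_comp_consSeq hint)]
    -- The averaged cross term is `vᵀ(I - S/2)v` minus the nonnegative form of `(I - S/2)^(N+2)`.
    have hlin : ∫ z0, v ⬝ᵥ ((1 - (1 / 2 : ℝ) • B z0) *ᵥ
        ((1 - (1 - (1 / 2 : ℝ) • S) ^ (N + 1)) *ᵥ v)) ∂P ≤ v ⬝ᵥ v - 1 / 2 * (v ⬝ᵥ (S *ᵥ v)) := by
      rw [hB.integral_one_sub, Matrix.mulVec_mulVec, ← hS, mul_sub, mul_one, ← pow_succ',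
        Matrix.sub_mulVec, dotProduct_sub]
      have h1 := hB.resolvent_nonneg (N + 2) v
      rw [← hS] at h1
      rw [Matrix.sub_mulVec, Matrix.one_mulVec, Matrix.smul_mulVec, dotProduct_sub,
        dotProduct_smul, smul_eq_mul]
      linarith
    have hlinint : Integrable (fun z0 => v ⬝ᵥ ((1 - (1 / 2 : ℝ) • B z0) *ᵥ
        ((1 - (1 - (1 / 2 : ℝ) • S) ^ (N + 1)) *ᵥ v))) P := by
      simp only [Matrix.sub_mulVec _ _ ((1 - (1 - (1 / 2 : ℝ) • S) ^ (N + 1)) *ᵥ v),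
        Matrix.one_mulVec, Matrix.smul_mulVec, dotProduct_sub, dotProduct_smul]
      exact (integrable_const _).sub (by exact (hB.integrable _ _).smul (1 / 2 : ℝ))
    have hbound : ∀ z0, ∫ z, (v ᵥ* geomEst B (consSeq (z0, z)) (N + 1)) ⬝ᵥ
          (S *ᵥ (v ᵥ* geomEst B (consSeq (z0, z)) (N + 1))) ∂(Measure.infinitePi fun _ : ℕ => P) ≤
        1 / 4 * (v ⬝ᵥ (S *ᵥ v)) + v ⬝ᵥ ((1 - (1 / 2 : ℝ) • B z0) *ᵥ
          ((1 - (1 - (1 / 2 : ℝ) • S) ^ (N + 1)) *ᵥ v)) +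
        ∑ k ∈ Finset.range (N + 1), ∫ z,
          ((v ᵥ* (1 - (1 / 2 : ℝ) • B z0)) ᵥ* geomProd B z k) ⬝ᵥ
          ((v ᵥ* (1 - (1 / 2 : ℝ) • B z0)) ᵥ* geomProd B z k)
        ∂(Measure.infinitePi fun _ : ℕ => P) := by
      intro z0
      set v0 := v ᵥ* (1 - (1 / 2 : ℝ) • B z0) with hv0
      -- Square out `½v + v0 G`, with `G` the estimator built from the remaining samples; symmetry
      -- of `S` merges the two cross terms.
      have hpt : ∀ z, (v ᵥ* geomEst B (consSeq (z0, z)) (N + 1)) ⬝ᵥ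
          (S *ᵥ (v ᵥ* geomEst B (consSeq (z0, z)) (N + 1))) =
          1 / 4 * (v ⬝ᵥ (S *ᵥ v)) + v0 ⬝ᵥ (geomEst B z N *ᵥ (S *ᵥ v)) +
          (v0 ᵥ* geomEst B z N) ⬝ᵥ (S *ᵥ (v0 ᵥ* geomEst B z N)) := by
        intro z
        rw [geomEst_consSeq, Matrix.vecMul_add, ← Matrix.vecMul_vecMul, Matrix.vecMul_smul,
          Matrix.vecMul_one, Matrix.dotProduct_mulVec v0]
        simp only [Matrix.mulVec_add, Matrix.mulVec_smul, dotProduct_add, add_dotProduct,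
          smul_dotProduct, dotProduct_smul, smul_eq_mul]
        rw [← hv0, dotProduct_mulVec_symm hB.meanMatrix_symm v (v0 ᵥ* geomEst B z N)]
        ring
      simp only [hpt]
      rw [integral_const_add_add _ (hB.integrable_geomEst N _ _)
        (hB.integrable_vecMul_quadratic N v0), hB.integral_geomEst_mean]
      have h2 := ih v0
      rw [Matrix.dotProduct_mulVec v (1 - (1 / 2 : ℝ) • B z0), ← hv0, Matrix.sub_mulVec, Matrix.one_mulVec, dotProduct_sub]
      linarith
    have hsumint : Integrable (fun z0 => ∑ k ∈ Finset.range (N + 1), ∫ z,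
          ((v ᵥ* (1 - (1 / 2 : ℝ) • B z0)) ᵥ* geomProd B z k) ⬝ᵥ
          ((v ᵥ* (1 - (1 / 2 : ℝ) • B z0)) ᵥ* geomProd B z k)
        ∂(Measure.infinitePi fun _ : ℕ => P)) P := integrable_finsetSum _ fun k _ => hhint k
    have hI := integral_mono (integrable_comp_consSeq hint).integral_prod_left
      (((integrable_const _).add hlinint).add hsumint) hbound
    refine hI.trans ?_
    simp only [Pi.add_apply]
    rw [integral_const_add_add _ hlinint hsumint, integral_finsetSum _ fun k _ => hhint k]
    simp only [integral_const, probReal_univ, one_smul, geomProd, Matrix.vecMul_one]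
    -- The coefficients `1/4` and `-1/2` of `vᵀSv` sum to a negative number, leaving `vᵀv`, the term
    -- `k = 0`.
    have := hB.meanMatrix_nonneg v
    linarith

end SecondMoment

/-! ### The smallest eigenvalue -/

/-- The spectrum is finite and, for `d ≥ 1`, nonempty, so the infimum is attained at an eigenvalue.
In dimension `0` it would be the default value `0`. -/
theorem minEigenvalue_pos {d : ℕ} (hd : 1 ≤ d) {S : Matrix (Fin d) (Fin d) ℝ} (hS : S.PosDef) :
    0 < minEigenvalue S := by
  have : Nonempty (Fin d) := ⟨⟨0, hd⟩⟩
  unfold minEigenvalue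
  rw [hS.1.spectrum_real_eq_range_eigenvalues]
  obtain ⟨i, hi⟩ := (Set.range_nonempty hS.1.eigenvalues).csInf_mem (Set.finite_range _)
  rw [← hi]
  exact hS.eigenvalues_pos i

/-- Subtracting `λ_min I` translates the spectrum and leaves only nonnegative eigenvalues. -/
theorem minEigenvalue_mul_le {d : ℕ} {S : Matrix (Fin d) (Fin d) ℝ} (hS : S.PosDef)
    (u : Fin d → ℝ) : minEigenvalue S * (u ⬝ᵥ u) ≤ u ⬝ᵥ (S *ᵥ u) := by
  have hS' : (S - minEigenvalue S • (1 : Matrix (Fin d) (Fin d) ℝ)).PosSemidef := by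
    have hH : (S - minEigenvalue S • (1 : Matrix (Fin d) (Fin d) ℝ)).IsHermitian :=
      hS.1.sub (by simp [Matrix.IsHermitian])
    refine hH.posSemidef_iff_eigenvalues_nonneg.2 fun i => ?_
    have hi := hH.eigenvalues_mem_spectrum_real i
    have hi' : hH.eigenvalues i + minEigenvalue S ∈ spectrum ℝ S := by
      rw [spectrum.mem_iff] at hi ⊢
      convert hi using 2
      rw [map_add, Algebra.algebraMap_eq_smul_one (minEigenvalue S)]
      abel
    have := csInf_le Matrix.finite_real_spectrum.bddBelow hi'
    change sInf (spectrum ℝ S) ≤ hH.eigenvalues i + sInf (spectrum ℝ S) at this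
    simpa using this
  have h := hS'.dotProduct_mulVec_nonneg u
  rw [star_trivial, Matrix.sub_mulVec, Matrix.smul_mulVec, Matrix.one_mulVec, dotProduct_sub,
    dotProduct_smul, smul_eq_mul] at h
  linarith

/-! ### Sampling an action -/

theorem measurable_sampleAction {K : ℕ} [NeZero K] :
    Measurable fun p : (Fin K → ℝ) × ℝ => sampleAction p.1 p.2 := by
  classical
  -- The sampler factors through the finite set of admissible actions, a discrete space on which
  -- every function is measurable.
  set S : (Fin K → ℝ) × ℝ → Finset (Fin K) := fun p =>
    Finset.univ.filter fun a => p.2 ≤ ∑ b ∈ Finset.Iic a, p.1 b with hS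
  let _ : MeasurableSpace (Finset (Fin K)) := ⊤
  have hSm : Measurable S := by
    refine measurable_to_countable' fun s => ?_
    have : S ⁻¹' {s} = ⋂ a, if a ∈ s then {p | p.2 ≤ ∑ b ∈ Finset.Iic a, p.1 b}
        else {p | p.2 ≤ ∑ b ∈ Finset.Iic a, p.1 b}ᶜ := by
      ext p
      simp only [Set.mem_preimage, Set.mem_singleton_iff, Set.mem_iInter, hS]
      rw [Finset.ext_iff]
      refine forall_congr' fun a => ?_
      by_cases ha : a ∈ s <;> simp [ha]
    rw [this]
    refine MeasurableSet.iInter fun a => ?_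
    have hm : MeasurableSet {p : (Fin K → ℝ) × ℝ | p.2 ≤ ∑ b ∈ Finset.Iic a, p.1 b} :=
      measurableSet_le measurable_snd (by fun_prop)
    split_ifs
    · exact hm
    · exact hm.compl
  have hg : Measurable fun s : Finset (Fin K) => if h : s.Nonempty then s.min' h else 0 :=
    measurable_from_top
  exact hg.comp hSm

theorem integral_sampleAction {K : ℕ} [NeZero K] {q : Fin K → ℝ} (hq : q ∈ stdSimplex ℝ (Fin K))
    (a : Fin K) (c : ℝ) :
    ∫ u : unitInterval, (if sampleAction q u = a then c else 0) = q a * c := by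
  have hm : MeasurableSet {u : unitInterval | sampleAction q u = a} :=
    (measurable_sampleAction.comp (measurable_const.prodMk measurable_subtype_coe))
      (measurableSet_singleton a)
  have h : (fun u : unitInterval => if sampleAction q u = a then c else 0) =
      Set.indicator {u : unitInterval | sampleAction q u = a} fun _ => c := by
    ext u; simp [Set.indicator_apply]
  rw [h, integral_indicator_const _ hm, measureReal_def, volume_sampleAction hq,
    ENNReal.toReal_ofReal (hq.1 a), smul_eq_mul]

/-! ### Resampling from a policy -/

/-- The separate summand `I/2` of the algorithm is the term `k = 0` of the geometric sum. -/
theorem resampling_eq_geomEst {d K : ℕ} [NeZero K] (q : Ctx d → Fin K → ℝ) (a : Fin K)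
    (z : ℕ → Ctx d × unitInterval) (M : ℕ) :
    resampling q a z M = geomEst (resampleB q a) z M := by
  have h : ∀ k, resampleA q a z k = geomProd (resampleB q a) z k := by
    intro k
    induction k with
    | zero => rfl
    | succ k ih => rw [resampleA, ih, geomProd]
  unfold resampling geomEst
  rw [Finset.sum_range_succ', smul_add, add_comm]
  congr 2
  rw [Finset.range_eq_Ico, Finset.sum_Ico_add' (fun k => geomProd (resampleB q a) z k) 0 M 1]
  exact Finset.sum_congr (by ext; simp) fun k _ => h k

theorem norm_sq_eq_dotProduct {d : ℕ} (x : Ctx d) : ‖x‖ ^ 2 = x.ofLp ⬝ᵥ x.ofLp := by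
  rw [EuclideanSpace.norm_sq_eq]
  simp [dotProduct, sq]

theorem sqrt_dotProduct_self {d : ℕ} (x : Ctx d) : √(x.ofLp ⬝ᵥ x.ofLp) = ‖x‖ := by
  rw [← norm_sq_eq_dotProduct, Real.sqrt_sq (norm_nonneg _)]

theorem inner_eq_dotProduct {d : ℕ} (x y : Ctx d) : ⟪x, y⟫ = x.ofLp ⬝ᵥ y.ofLp := by
  rw [EuclideanSpace.inner_eq_star_dotProduct, star_trivial, dotProduct_comm]

theorem measurable_resampleB {d K : ℕ} [NeZero K] {Ω : Type*} [MeasurableSpace Ω]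
    {q : Ω → Ctx d → Fin K → ℝ} (hq : Measurable fun p : Ω × Ctx d => q p.1 p.2) (a : Fin K)
    (i j : Fin d) :
    Measurable fun p : Ω × (Ctx d × unitInterval) => resampleB (q p.1) a p.2 i j := by
  have hs : MeasurableSet {p : Ω × (Ctx d × unitInterval) |
      sampleAction (q p.1 p.2.1) p.2.2 = a} :=
    (measurable_sampleAction.comp ((hq.comp (measurable_fst.prodMk
      (measurable_fst.comp measurable_snd))).prodMk
      (measurable_subtype_coe.comp (measurable_snd.comp measurable_snd))))
      (measurableSet_singleton a)
  have h : (fun p : Ω × (Ctx d × unitInterval) => resampleB (q p.1) a p.2 i j) =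
      fun p => if sampleAction (q p.1 p.2.1) p.2.2 = a then p.2.1 i * p.2.1 j else 0 := by
    ext p
    unfold resampleB
    split_ifs <;> simp [Matrix.vecMulVec_apply]
  rw [h]
  exact Measurable.ite hs (by fun_prop) measurable_const

theorem integrable_weighted_sq {d K : ℕ} {D : Measure (Ctx d)} [IsFiniteMeasure D]
    {q : Ctx d → Fin K → ℝ} (hq : Measurable q) (hq1 : ∀ x, q x ∈ stdSimplex ℝ (Fin K))
    (hD : ∀ᵐ x ∂D, ‖x‖ ≤ 1) (a : Fin K) (w : Fin d → ℝ) :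
    Integrable (fun y : Ctx d => q y a * (w ⬝ᵥ y.ofLp) ^ 2) D := by
  have hqa : Measurable fun x => q x a := (measurable_pi_apply a).comp hq
  have hm : Measurable fun y : Ctx d => w ⬝ᵥ y.ofLp := by
    simp only [dotProduct]; fun_prop
  refine Integrable.of_bound (hqa.mul (hm.pow_const 2)).aestronglyMeasurable (w ⬝ᵥ w) ?_
  filter_upwards [hD] with y hy
  rw [Real.norm_eq_abs, abs_of_nonneg (mul_nonneg ((hq1 _).1 a) (sq_nonneg _))]
  have h1 : q y a ≤ 1 :=
    (Finset.single_le_sum (fun b _ => (hq1 y).1 b) (Finset.mem_univ a)).trans (hq1 y).2.le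
  have h2 := dotProduct_sq_le w y.ofLp
  rw [← norm_sq_eq_dotProduct y] at h2
  have h3 : ‖y‖ ^ 2 ≤ 1 := pow_le_one₀ (norm_nonneg _) hy
  have h4 := mul_le_mul_of_nonneg_left h3 (dotProduct_self_nonneg' w)
  have h5 := mul_le_mul_of_nonneg_right h1 (sq_nonneg (w ⬝ᵥ y.ofLp))
  linarith

section Resampling

variable {d K : ℕ} [NeZero K] {D : Measure (Ctx d)}
  {q : Ctx d → Fin K → ℝ}

theorem resampleB_mulVec (a : Fin K) (z : Ctx d × unitInterval) (u : Fin d → ℝ) :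
    resampleB q a z *ᵥ u =
      if sampleAction (q z.1) z.2 = a then (z.1.ofLp ⬝ᵥ u) • z.1.ofLp else 0 := by
  unfold resampleB
  split_ifs
  · rw [Matrix.vecMulVec_mulVec]; ext; simp [mul_comm]
  · simp

theorem resampleB_sq_le (a : Fin K) {z : Ctx d × unitInterval} (hz : ‖z.1‖ ≤ 1) (u : Fin d → ℝ) :
    (resampleB q a z *ᵥ u) ⬝ᵥ (resampleB q a z *ᵥ u) ≤ u ⬝ᵥ (resampleB q a z *ᵥ u) := by
  rw [resampleB_mulVec]
  split_ifs
  · simp only [dotProduct_smul, smul_dotProduct, smul_eq_mul]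
    rw [dotProduct_comm u, ← norm_sq_eq_dotProduct]
    have h1 : ‖z.1‖ ^ 2 ≤ 1 := pow_le_one₀ (norm_nonneg _) hz
    nlinarith [mul_self_nonneg (z.1.ofLp ⬝ᵥ u)]
  · simp

theorem isSubprojection_resampleB (hq : Measurable q) (hD : ∀ᵐ x ∂D, ‖x‖ ≤ 1) (a : Fin K) :
    IsSubprojection (D.prod (volume : Measure unitInterval)) (resampleB q a) := by
  refine ⟨fun i j => ?_, fun z => ?_, fun z u => ?_, ?_⟩
  · have h := measurable_resampleB (Ω := Unit) (q := fun _ => q) (hq.comp measurable_snd) a i j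
    have h' := h.comp (measurable_prodMk_left (x := ()))
    simpa only [Function.comp_def] using h'
  · unfold resampleB
    split_ifs
    · ext i j; simp [Matrix.vecMulVec_apply, mul_comm]
    · simp
  · rw [resampleB_mulVec]
    split_ifs
    · rw [dotProduct_smul, smul_eq_mul, dotProduct_comm]; exact mul_self_nonneg _
    · simp
  · have hD' : ∀ᵐ z ∂(D.prod (volume : Measure unitInterval)), ‖z.1‖ ≤ 1 :=
      Measure.quasiMeasurePreserving_fst.ae hD
    filter_upwards [hD'] with z hz using resampleB_sq_le a hz

variable [IsProbabilityMeasure D]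

/-- Integrating out the uniform seed turns the indicator of the drawn action into its probability.
-/
theorem dotProduct_meanMatrix_resampleB (hq : Measurable q)
    (hq1 : ∀ x, q x ∈ stdSimplex ℝ (Fin K)) (hD : ∀ᵐ x ∂D, ‖x‖ ≤ 1) (a : Fin K)
    (u v : Fin d → ℝ) :
    u ⬝ᵥ (meanMatrix (D.prod (volume : Measure unitInterval)) (resampleB q a) *ᵥ v) =
      ∫ x, q x a * ((u ⬝ᵥ x.ofLp) * (x.ofLp ⬝ᵥ v)) ∂D := by
  have hB := isSubprojection_resampleB hq hD a
  rw [← hB.integral_eq, integral_prod _ (hB.integrable u v)]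
  refine integral_congr_ae (Filter.Eventually.of_forall fun x => ?_)
  simp only [resampleB_mulVec]
  rw [← integral_sampleAction (hq1 x)]
  refine integral_congr_ae (Filter.Eventually.of_forall fun w => ?_)
  simp only
  split_ifs
  · rw [dotProduct_smul, smul_eq_mul, mul_comm]
  · simp

/-- Second moment of the matrix geometric resampling estimator of the inverse covariance. -/
theorem resampling_second_moment (hq : Measurable q)
    (hq1 : ∀ x, q x ∈ stdSimplex ℝ (Fin K)) (hD : ∀ᵐ x ∂D, ‖x‖ ≤ 1) (a : Fin K) (M : ℕ) :
    ∫ y, q y a * ∫ z, ∫ x, q x a * (y.ofLp ⬝ᵥ (resampling q a z M *ᵥ x.ofLp)) ^ 2 ∂D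
        ∂(Measure.infinitePi fun _ : ℕ => D.prod (volume : Measure unitInterval)) ∂D ≤
      4 / 3 * d := by
  have hB := isSubprojection_resampleB hq hD a
  set P := D.prod (volume : Measure unitInterval) with hP
  set B := resampleB q a with hBdef
  set S := meanMatrix P B with hS
  have hSq : ∀ u, u ⬝ᵥ (S *ᵥ u) = ∫ x, q x a * (u ⬝ᵥ x.ofLp) ^ 2 ∂D := by
    intro u
    rw [dotProduct_meanMatrix_resampleB hq hq1 hD a u u]
    refine integral_congr_ae (Filter.Eventually.of_forall fun x => ?_)
    simp only
    rw [dotProduct_comm x.ofLp u, sq]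
  have hinner : ∀ (y : Ctx d) z, ∫ x, q x a * (y.ofLp ⬝ᵥ (resampling q a z M *ᵥ x.ofLp)) ^ 2 ∂D =
      (y.ofLp ᵥ* geomEst B z M) ⬝ᵥ (S *ᵥ (y.ofLp ᵥ* geomEst B z M)) := by
    intro y z
    rw [hSq]
    simp only [resampling_eq_geomEst, Matrix.dotProduct_mulVec, ← hBdef]
  simp only [hinner]
  have hqa : Measurable fun x => q x a := (measurable_pi_apply a).comp hq
  have hqle : ∀ x, q x a ≤ 1 := fun x =>
    (Finset.single_le_sum (fun b _ => (hq1 x).1 b) (Finset.mem_univ a)).trans (hq1 x).2.le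
  have hgood : ∀ᵐ p ∂(D.prod (Measure.infinitePi fun _ : ℕ => P)), ‖p.1‖ ≤ 1 ∧
      ∀ n, ∀ u, (B (p.2 n) *ᵥ u) ⬝ᵥ (B (p.2 n) *ᵥ u) ≤ u ⬝ᵥ (B (p.2 n) *ᵥ u) :=
    (Measure.quasiMeasurePreserving_fst.ae hD).and
      (Measure.quasiMeasurePreserving_snd.ae (ae_forall_infinitePi hB.sq_le))
  have hint : ∀ k, Integrable (fun p : Ctx d × (ℕ → Ctx d × unitInterval) =>
      q p.1 a * ((p.1.ofLp ᵥ* geomProd B p.2 k) ⬝ᵥ (p.1.ofLp ᵥ* geomProd B p.2 k)))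
      (D.prod (Measure.infinitePi fun _ : ℕ => P)) := by
    intro k
    have hm := measurable_vecMul_apply
      (A := fun p : Ctx d × (ℕ → Ctx d × unitInterval) => geomProd B p.2 k)
      (v := fun p => p.1.ofLp) (fun i j => (hB.measurable_geomProd k i j).comp measurable_snd)
      (fun i => by fun_prop)
    refine Integrable.of_bound ((hqa.comp measurable_fst).mul
      (measurable_dotProduct hm hm)).aestronglyMeasurable 1 ?_
    filter_upwards [hgood] with p hp
    rw [Real.norm_eq_abs, abs_of_nonneg (mul_nonneg ((hq1 _).1 a) (dotProduct_self_nonneg' _))]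
    refine mul_le_one₀ (hqle _) (dotProduct_self_nonneg' _)
      ((hB.geomProd_vecMul_le hp.2 k _).trans ?_)
    rw [← norm_sq_eq_dotProduct]
    exact pow_le_one₀ (norm_nonneg _) hp.1
  have hint' : ∀ k, Integrable (fun y : Ctx d => q y a *
      ∫ z, (y.ofLp ᵥ* geomProd B z k) ⬝ᵥ (y.ofLp ᵥ* geomProd B z k)
        ∂(Measure.infinitePi fun _ : ℕ => P)) D := by
    intro k
    simpa only [integral_const_mul] using (hint k).integral_prod_left
  -- Both sides are the mean trace of `A_kᵀ S A_k`. Averaging over `y` replaces the row vectors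
  -- `yᵀA_k` by the columns `A_k e_i`, for which the sum over `k` telescopes.
  have hk : ∀ k, ∫ y : Ctx d, q y a *
      ∫ z, (y.ofLp ᵥ* geomProd B z k) ⬝ᵥ (y.ofLp ᵥ* geomProd B z k)
        ∂(Measure.infinitePi fun _ : ℕ => P) ∂D =
      ∑ i, ∫ z, (geomProd B z k *ᵥ Pi.single i 1) ⬝ᵥ (S *ᵥ (geomProd B z k *ᵥ Pi.single i 1))
        ∂(Measure.infinitePi fun _ : ℕ => P) := by
    intro k
    simp only [← integral_const_mul]
    rw [← integral_prod _ (hint k), integral_prod_symm _ (hint k), ← integral_finsetSum _ fun i _ =>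
      hB.integrable_mulVec_quadratic k _]
    refine integral_congr_ae ?_
    filter_upwards [ae_forall_infinitePi hB.sq_le] with z hz
    simp only [← hS, hSq]
    rw [← integral_finsetSum]
    · refine integral_congr_ae (Filter.Eventually.of_forall fun y => ?_)
      simp only [← Finset.mul_sum]
      congr 1
      simp only [dotProduct, Matrix.vecMul, Matrix.mulVec_single_one, sq, Matrix.col_apply]
      exact Finset.sum_congr rfl fun i _ => by simp only [mul_comm]
    · intro i _
      exact integrable_weighted_sq hq hq1 hD a _
  calc _ ≤ ∫ y : Ctx d, ∑ k ∈ Finset.range (M + 1), q y a *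
      ∫ z, (y.ofLp ᵥ* geomProd B z k) ⬝ᵥ (y.ofLp ᵥ* geomProd B z k)
        ∂(Measure.infinitePi fun _ : ℕ => P) ∂D := by
        refine integral_mono_of_nonneg (Filter.Eventually.of_forall fun y => ?_)
          (integrable_finsetSum _ fun k _ => hint' k) (Filter.Eventually.of_forall fun y => ?_)
        · exact mul_nonneg ((hq1 _).1 a) (integral_nonneg fun z => hB.meanMatrix_nonneg _)
        · simp only [← Finset.mul_sum]
          exact mul_le_mul_of_nonneg_left (hB.integral_quadratic_geomEst_le M _) ((hq1 _).1 a)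
    _ = ∑ i : Fin d, ∑ k ∈ Finset.range (M + 1), ∫ z, (geomProd B z k *ᵥ Pi.single i 1) ⬝ᵥ
        (S *ᵥ (geomProd B z k *ᵥ Pi.single i 1)) ∂(Measure.infinitePi fun _ : ℕ => P) := by
        rw [integral_finsetSum _ fun k _ => hint' k, Finset.sum_comm]
        exact Finset.sum_congr rfl fun k _ => hk k
    -- Each basis vector contributes at most `4/3`, independently of the number of iterations.
    _ ≤ ∑ i : Fin d, 4 / 3 := Finset.sum_le_sum fun i _ => by
        have := hB.sum_integral_quadratic_le (M + 1) (Pi.single i 1)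
        simpa using this
    _ = 4 / 3 * d := by simp [mul_comm]

end Resampling

/-! ### Bias of the estimator -/

/-- That `0 ≤ R ≤ ρ` gives `R² ≤ ρ²` follows by testing `R ≥ 0` at `ρu - Ru` and `R ≤ ρ` at `Ru`. -/
theorem mulVec_sq_le_of_quadratic_le {d : ℕ} {R : Matrix (Fin d) (Fin d) ℝ} (hs : Rᵀ = R) {ρ : ℝ}
    (hρ : 0 < ρ) (h0 : ∀ u, 0 ≤ u ⬝ᵥ (R *ᵥ u)) (h1 : ∀ u, u ⬝ᵥ (R *ᵥ u) ≤ ρ * (u ⬝ᵥ u))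
    (u : Fin d → ℝ) : (R *ᵥ u) ⬝ᵥ (R *ᵥ u) ≤ ρ ^ 2 * (u ⬝ᵥ u) := by
  have h2 := h1 (R *ᵥ u)
  have h3 := h0 (ρ • u - R *ᵥ u)
  simp only [Matrix.mulVec_sub, Matrix.mulVec_smul, dotProduct_sub, sub_dotProduct,
    smul_dotProduct, dotProduct_smul, smul_eq_mul] at h3
  rw [dotProduct_mulVec_symm hs u (R *ᵥ u)] at h3
  have h4 := h1 u
  have h5 : ρ * ((R *ᵥ u) ⬝ᵥ (R *ᵥ u)) ≤ ρ * (ρ * (u ⬝ᵥ (R *ᵥ u))) := by nlinarith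
  have h6 := le_of_mul_le_mul_left h5 hρ
  nlinarith

theorem abs_dotProduct_pow_mulVec_le {d : ℕ} {R : Matrix (Fin d) (Fin d) ℝ} (hs : Rᵀ = R) {ρ : ℝ}
    (hρ : 0 < ρ) (h0 : ∀ u, 0 ≤ u ⬝ᵥ (R *ᵥ u)) (h1 : ∀ u, u ⬝ᵥ (R *ᵥ u) ≤ ρ * (u ⬝ᵥ u))
    (n : ℕ) (u v : Fin d → ℝ) :
    |u ⬝ᵥ (R ^ n *ᵥ v)| ≤ ρ ^ n * (√(u ⬝ᵥ u) * √(v ⬝ᵥ v)) := by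
  have hn : ∀ n, (R ^ n *ᵥ v) ⬝ᵥ (R ^ n *ᵥ v) ≤ (ρ ^ n) ^ 2 * (v ⬝ᵥ v) := by
    intro n
    induction n with
    | zero => simp
    | succ n ih =>
      rw [pow_succ', ← Matrix.mulVec_mulVec]
      refine (mulVec_sq_le_of_quadratic_le hs hρ h0 h1 _).trans ?_
      have := mul_le_mul_of_nonneg_left ih (sq_nonneg ρ)
      rw [pow_succ' ρ n]
      linarith
  refine Real.abs_le_sqrt ((dotProduct_sq_le _ _).trans
    (mul_le_mul_of_nonneg_left (hn n) (dotProduct_self_nonneg' u))) |>.trans (le_of_eq ?_)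
  rw [Real.sqrt_mul (dotProduct_self_nonneg' u), Real.sqrt_mul (sq_nonneg _),
    Real.sqrt_sq (pow_nonneg hρ.le n)]
  ring

/-! ### The quantities computed from a state -/

section State

variable {d K T t : ℕ} {lam : ℝ}

theorem two_le_beta (S : State d K) : 2 ≤ beta T lam S :=
  (le_max_left _ _).trans (le_max_left _ _)

theorem beta_pos (S : State d K) : 0 < beta T lam S := by linarith [two_le_beta (T := T) (lam := lam) S]

theorem eta_pos (S : State d K) : 0 < eta T lam S := one_div_pos.2 (beta_pos S)

theorem predict_eq [NeZero K] (S : State d K) (x : Ctx d) :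
    predict T lam S x = softmax (1 / beta T lam S) fun a => ⟪x, S.cumEst a⟫ :=
  ftrl_eq_softmax (eta_pos S) _

theorem predict_mem [NeZero K] (S : State d K) (x : Ctx d) :
    predict T lam S x ∈ stdSimplex ℝ (Fin K) := by
  rw [predict_eq]; exact softmax_mem _ _

theorem gamma_nonneg (hlam : 0 < lam) (S : State d K) : 0 ≤ gamma T lam t S :=
  mul_nonneg (div_nonneg (mul_nonneg (by positivity) (Real.log_natCast_nonneg t)) hlam.le)
    (eta_pos S).le

theorem gamma_le_eta (hlam : 0 < lam) (ht : 1 ≤ t) (htT : t ≤ T) (S : State d K) :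
    gamma T lam t S ≤ 4 * K * Real.log T / lam * eta T lam S := by
  have h : Real.log t ≤ Real.log T :=
    Real.log_le_log (by exact_mod_cast ht) (by exact_mod_cast htT)
  unfold gamma
  have := (eta_pos (T := T) (lam := lam) S).le
  gcongr

/-- This is the purpose of the term `c₂ log T` in `beta`: it is twice the largest factor multiplying
`η_t` in `γ_t`. -/
theorem gamma_le_half (hlam : 0 < lam) (ht : 1 ≤ t) (htT : t ≤ T) (S : State d K) :
    gamma T lam t S ≤ 1 / 2 := by
  refine (gamma_le_eta hlam ht htT S).trans ?_
  have hb : c₂ K lam * Real.log T ≤ beta T lam S :=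
    (le_max_right _ _).trans (le_max_left _ _)
  have hpos := beta_pos (T := T) (lam := lam) S
  unfold eta c₂ at *
  rw [mul_one_div, div_le_iff₀ hpos]
  have : 4 * K * Real.log T / lam = 1 / 2 * (8 * K / lam * Real.log T) := by ring
  rw [this]
  linarith

theorem policy_mem [NeZero K] (hlam : 0 < lam) (ht : 1 ≤ t) (htT : t ≤ T) (S : State d K)
    (x : Ctx d) : policy T lam t S x ∈ stdSimplex ℝ (Fin K) := by
  have hp := predict_mem (T := T) (lam := lam) S x
  have h0 := gamma_nonneg (T := T) (t := t) hlam S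
  have h1 := gamma_le_half hlam ht htT S
  refine ⟨fun a => add_nonneg (mul_nonneg (by linarith) (hp.1 a)) (by positivity), ?_⟩
  unfold policy
  rw [Finset.sum_add_distrib, ← Finset.mul_sum, hp.2]
  have : (K : ℝ) ≠ 0 := by exact_mod_cast NeZero.ne K
  simp
  field_simp
  ring

/-- Since `γ_t ≤ 1/2`, second moments under the prediction can be compared with those under the
policy actually used for sampling. -/
theorem predict_le_policy [NeZero K] (hlam : 0 < lam) (ht : 1 ≤ t) (htT : t ≤ T) (S : State d K)
    (x : Ctx d) (a : Fin K) : predict T lam S x a ≤ 2 * policy T lam t S x a := by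
  have hp := (predict_mem (T := T) (lam := lam) S x).1 a
  have h0 : 0 ≤ gamma T lam t S / K := div_nonneg (gamma_nonneg hlam S) (by positivity)
  have h1 := gamma_le_half hlam ht htT S
  unfold policy
  nlinarith

theorem gamma_div_le_policy [NeZero K] (hlam : 0 < lam) (ht : 1 ≤ t) (htT : t ≤ T) (S : State d K)
    (x : Ctx d) (a : Fin K) : gamma T lam t S / K ≤ policy T lam t S x a := by
  have hp := (predict_mem (T := T) (lam := lam) S x).1 a
  have h1 := gamma_le_half hlam ht htT S
  unfold policy
  nlinarith

/-- Inserting `γ_t` cancels its prefactor: before rounding, the number of iterations is exactly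
`β_t`. -/
theorem log_div_gamma (hK : 0 < K) (hlam : 0 < lam) (ht : 2 ≤ t) (S : State d K) :
    4 * K / (gamma T lam t S * lam) * Real.log t = beta T lam S := by
  have hl : 0 < Real.log t := Real.log_pos (by exact_mod_cast ht)
  have hK' : (0 : ℝ) < K := by exact_mod_cast hK
  have hb := beta_pos (T := T) (lam := lam) S
  unfold gamma eta
  field_simp

/-- Rounding gives `M ≤ β + 1`, hence `(M + 1)/2 ≤ β/2 + 1 ≤ β`; the lower bound `2` in `beta` is
chosen for this. -/
theorem iterations_le (hK : 0 < K) (hlam : 0 < lam) (S : State d K) :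
    ((iterations T lam t S : ℝ) + 1) / 2 ≤ beta T lam S := by
  have hb := two_le_beta (T := T) (lam := lam) S
  unfold iterations
  rcases Nat.lt_or_ge t 2 with h | h
  · have : Real.log t = 0 := by interval_cases t <;> simp
    rw [this, mul_zero, Nat.ceil_zero]
    push_cast
    linarith
  · rw [log_div_gamma hK hlam h]
    have := (Nat.ceil_lt_add_one (by linarith : 0 ≤ beta T lam S)).le
    linarith

/-- Enough iterations for a residual of the form `exp(-c(M+1))` with `c = γλ/(2K)` to be at most
`t⁻²`. -/
theorem le_gamma_mul_iterations (hK : 0 < K) (hlam : 0 < lam) (S : State d K) :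
    2 * Real.log t ≤ gamma T lam t S * lam / (2 * K) * (iterations T lam t S + 1) := by
  have hK' : (0 : ℝ) < K := by exact_mod_cast hK
  rcases Nat.lt_or_ge t 2 with h | h
  · have : Real.log t = 0 := by interval_cases t <;> simp
    unfold gamma
    rw [this]; simp
  · have h1 := log_div_gamma (T := T) hK hlam h S
    have hb := beta_pos (T := T) (lam := lam) S
    have hM : beta T lam S ≤ iterations T lam t S := by
      unfold iterations; rw [← h1]; exact Nat.le_ceil _
    have hg : gamma T lam t S * lam / (2 * K) = 2 * Real.log t / beta T lam S := by
      unfold gamma eta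
      field_simp
      ring
    have hl : 0 ≤ Real.log t := Real.log_natCast_nonneg t
    rw [hg, div_mul_eq_mul_div, le_div_iff₀ hb]
    exact mul_le_mul_of_nonneg_left (by linarith) (by linarith)

end State

/-! ### Measurability -/

section Measurability

variable {d K T t : ℕ} {lam : ℝ}

theorem measurable_beta : Measurable (beta T lam : State d K → ℝ) := by
  unfold beta State.beta'; fun_prop

theorem measurable_eta : Measurable (eta T lam : State d K → ℝ) :=
  measurable_const.div measurable_beta

theorem measurable_gamma : Measurable (gamma T lam t : State d K → ℝ) :=
  measurable_const.mul measurable_eta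

theorem measurable_iterations : Measurable (iterations T lam t : State d K → ℕ) :=
  Nat.measurable_ceil.comp ((measurable_const.div (measurable_gamma.mul_const _)).mul_const _)

/-- The prediction is defined by a choice of minimizer; measurability comes from the softmax
formula. -/
theorem measurable_predict [NeZero K] :
    Measurable fun p : State d K × Ctx d => predict T lam p.1 p.2 := by
  have h : ∀ a, Measurable fun p : State d K × Ctx d =>
      Real.exp (-(1 / beta T lam p.1 * ⟪p.2, p.1.cumEst a⟫)) := by
    intro a
    have h1 : Measurable fun p : State d K × Ctx d => beta T lam p.1 :=
      measurable_beta.comp measurable_fst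
    have h2 : Measurable fun p : State d K × Ctx d => ⟪p.2, p.1.cumEst a⟫ :=
      measurable_snd.inner ((measurable_pi_apply a).comp (measurable_fst.comp measurable_fst))
    fun_prop
  refine measurable_pi_lambda _ fun a => ?_
  simp only [predict_eq, softmax]
  exact (h a).div (Finset.measurable_sum _ fun b _ => h b)

theorem measurable_policy [NeZero K] :
    Measurable fun p : State d K × Ctx d => policy T lam t p.1 p.2 := by
  have h1 : Measurable fun p : State d K × Ctx d => gamma T lam t p.1 :=
    measurable_gamma.comp measurable_fst
  refine measurable_pi_lambda _ fun a => ?_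
  have h2 := (measurable_pi_apply a).comp (measurable_predict (d := d) (K := K) (T := T) (lam := lam))
  simp only [Function.comp_def] at h2
  unfold policy
  exact ((measurable_const.sub h1).mul h2).add (h1.div_const _)

theorem measurable_predict_comp [NeZero K] {Ω : Type*} [MeasurableSpace Ω] {f : Ω → State d K}
    {g : Ω → Ctx d} (hf : Measurable f) (hg : Measurable g) :
    Measurable fun ω => predict T lam (f ω) (g ω) := by
  have h0 : Measurable fun p : State d K × Ctx d => predict T lam p.1 p.2 := measurable_predict
  have h := h0.comp (hf.prodMk hg)
  exact h

theorem measurable_policy_comp [NeZero K] {Ω : Type*} [MeasurableSpace Ω] {f : Ω → State d K}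
    {g : Ω → Ctx d} (hf : Measurable f) (hg : Measurable g) :
    Measurable fun ω => policy T lam t (f ω) (g ω) := by
  have h0 : Measurable fun p : State d K × Ctx d => policy T lam t p.1 p.2 := measurable_policy
  have h := h0.comp (hf.prodMk hg)
  exact h

theorem measurable_entropy : Measurable (entropy : (Fin K → ℝ) → ℝ) :=
  Finset.measurable_sum _ fun a _ =>
    Real.continuous_negMulLog.measurable.comp (measurable_pi_apply a)

variable {W : Type*} [MeasurableSpace W] [NeZero K]

theorem measurable_action :
    Measurable fun p : State d K × Round d W => action T lam t p.1 p.2 := by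
  have h1 : Measurable fun p : State d K × Round d W => policy T lam t p.1 p.2.1 :=
    measurable_policy_comp measurable_fst (measurable_fst.comp measurable_snd)
  have h2 : Measurable fun p : State d K × Round d W => (p.2.2.1 : ℝ) :=
    measurable_subtype_coe.comp (measurable_fst.comp (measurable_snd.comp measurable_snd))
  unfold action
  exact measurable_sampleAction.comp (h1.prodMk h2)

theorem measurableSet_action_eq (a : Fin K) :
    MeasurableSet {p : State d K × Round d W | action T lam t p.1 p.2 = a} :=
  measurable_action (measurableSet_singleton a)

theorem measurable_estimate {ℓ : Loss d K W}
    (hℓ : ∀ a, Measurable fun p : W × Ctx d => ℓ t p.1 p.2 a) (a : Fin K) :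
    Measurable fun p : State d K × Round d W => estimate T lam ℓ t p.1 p.2 a := by
  -- On the event that `a` is played, the loss at the random action is the loss at the fixed `a`.
  have h : (fun p : State d K × Round d W => estimate T lam ℓ t p.1 p.2 a) = fun p =>
      if action T lam t p.1 p.2 = a then ℓ t p.2.2.2.1 p.2.1 a • WithLp.toLp 2
        (geomEst (resampleB (policy T lam t p.1) a) p.2.2.2.2 (iterations T lam t p.1) *ᵥ
          p.2.1.ofLp) else 0 := by
    ext1 p
    unfold estimate
    split_ifs with ha
    · rw [ha, resampling_eq_geomEst]
    · rfl
  rw [h]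
  refine Measurable.ite (measurableSet_action_eq a) (Measurable.fun_smul ?_ ?_) measurable_const
  · exact (hℓ a).comp ((measurable_fst.comp (measurable_snd.comp (measurable_snd.comp
      measurable_snd))).prodMk (measurable_fst.comp measurable_snd))
  · refine (WithLp.measurable_toLp 2 _).comp (measurable_pi_lambda _ fun i => ?_)
    refine measurable_mulVec_apply (fun i j => ?_) (fun i => by fun_prop) i
    refine measurable_geomEst (B := fun p : State d K × Round d W =>
      resampleB (policy T lam t p.1) a) (fun i j => ?_)
      (measurable_snd.comp (measurable_snd.comp (measurable_snd.comp measurable_snd)))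
      (measurable_iterations.comp measurable_fst) i j
    have h0 : Measurable fun p : State d K × Ctx d => policy T lam t p.1 p.2 := measurable_policy
    have h1 := measurable_resampleB h0 a i j
    have h2 : Measurable fun p : (State d K × Round d W) × (Ctx d × unitInterval) =>
      (p.1.1, p.2) := (measurable_fst.comp measurable_fst).prodMk measurable_snd
    have h3 := h1.comp h2
    exact h3

theorem measurable_step {ℓ : Loss d K W}
    (hℓ : ∀ a, Measurable fun p : W × Ctx d => ℓ t p.1 p.2 a) :
    Measurable fun p : State d K × Round d W => step T lam ℓ t p.1 p.2 := by
  have hh : Measurable fun p : State d K × Round d W =>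
      p.1.cumEntropy + entropy (predict T lam p.1 p.2.1) := by
    have h1 : Measurable fun p : State d K × Round d W => predict T lam p.1 p.2.1 :=
      measurable_predict_comp measurable_fst (measurable_fst.comp measurable_snd)
    have h2 : Measurable fun p : State d K × Round d W => entropy (predict T lam p.1 p.2.1) :=
      measurable_entropy.comp h1
    have h3 : Measurable fun p : State d K × Round d W => p.1.cumEntropy :=
      measurable_fst.comp (measurable_snd.comp measurable_fst)
    exact h3.add h2
  have h4 : Measurable fun p : State d K × Round d W => p.1.beta' :=
    measurable_snd.comp (measurable_snd.comp measurable_fst)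
  have h5 : ∀ a, Measurable fun p : State d K × Round d W => p.1.cumEst a := fun a =>
    (measurable_pi_apply a).comp (measurable_fst.comp measurable_fst)
  unfold step
  refine Measurable.prodMk (measurable_pi_lambda _ fun a => ?_) (hh.prodMk ?_)
  · exact (h5 a).add (measurable_estimate hℓ a)
  · exact h4.add (measurable_const.div (Real.continuous_sqrt.measurable.comp
      (measurable_const.add (measurable_const.mul hh))))

theorem measurable_stateAfter {ℓ : Loss d K W}
    (hℓ : ∀ t ∈ Finset.Icc 1 T, ∀ a, Measurable fun p : W × Ctx d => ℓ t p.1 p.2 a)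
    (ht : t ≤ T) : Measurable fun ω : ℕ → Round d W => stateAfter T lam ℓ ω t := by
  induction t with
  | zero => exact measurable_const
  | succ t ih =>
    exact (measurable_step (hℓ (t + 1) (Finset.mem_Icc.2 ⟨by omega, ht⟩))).comp
      ((ih (by omega)).prodMk (measurable_pi_apply (t + 1)))

end Measurability

/-! ### One round, conditionally on the state -/

/-- The losses of a round are bounded with a linear mean. -/
structure LinearRound {d K : ℕ} {W : Type*} [MeasurableSpace W] (D : Measure (Ctx d))
    (ν : Measure W) (l : W → Ctx d → Fin K → ℝ) (θ : Fin K → Ctx d) : Prop where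
  meas : ∀ a, Measurable fun p : W × Ctx d => l p.1 p.2 a
  mean : ∀ᵐ x ∂D, ∀ a, ∫ w, l w x a ∂ν = ⟪x, θ a⟫
  bound : ∀ᵐ x ∂D, ∀ a, ∀ᵐ w ∂ν, |l w x a| ≤ 1
  norm_le : ∀ a, ‖θ a‖ ≤ 1

/-- The bounds that hold almost surely in a round. -/
structure GoodRound {d K : ℕ} {W : Type*} (l : W → Ctx d → Fin K → ℝ) (r : Round d W) : Prop where
  norm_le : ‖r.1‖ ≤ 1
  loss_le : ∀ a, |l r.2.2.1 r.1 a| ≤ 1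
  sample_le : ∀ n, ‖(r.2.2.2 n).1‖ ≤ 1

theorem abs_inner_le_one {d : ℕ} {x y : Ctx d} (hx : ‖x‖ ≤ 1) (hy : ‖y‖ ≤ 1) : |⟪x, y⟫| ≤ 1 :=
  (abs_real_inner_le_norm x y).trans (mul_le_one₀ hx (norm_nonneg _) hy)

/-- A difference of two elements of the simplex integrates a function bounded by `c`
to at most `2c`. -/
theorem abs_sum_sub_mul_le {K : ℕ} {p r : Fin K → ℝ} (hp : p ∈ stdSimplex ℝ (Fin K))
    (hr : r ∈ stdSimplex ℝ (Fin K)) {f : Fin K → ℝ} {c : ℝ} (hf : ∀ a, |f a| ≤ c) :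
    |∑ a, (p a - r a) * f a| ≤ 2 * c := by
  have h : ∀ a ∈ Finset.univ, |(p a - r a) * f a| ≤ p a * c + r a * c := by
    intro a _
    rw [abs_mul, ← add_mul]
    refine mul_le_mul ((abs_sub _ _).trans ?_) (hf a) (abs_nonneg _)
      (add_nonneg (hp.1 a) (hr.1 a))
    rw [abs_of_nonneg (hp.1 a), abs_of_nonneg (hr.1 a)]
  refine (Finset.abs_sum_le_sum_abs _ _).trans ((Finset.sum_le_sum h).trans ?_)
  rw [Finset.sum_add_distrib, ← Finset.sum_mul, ← Finset.sum_mul, hp.2, hr.2]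
  linarith

section Round

set_option linter.unusedSectionVars false

variable {d K T t : ℕ} [NeZero K] {lam : ℝ} {W : Type*} [MeasurableSpace W]
  {D : Measure (Ctx d)} [IsProbabilityMeasure D] {ν : Measure W} [IsProbabilityMeasure ν]
  {ℓ : Loss d K W} {θ : Fin K → Ctx d}

theorem ae_goodRound (hD : ∀ᵐ x ∂D, ‖x‖ ≤ 1) (hl : LinearRound D ν (ℓ t) θ) :
    ∀ᵐ r ∂(roundLaw D ν), GoodRound (ℓ t) r := by
  have h1 : ∀ᵐ r ∂(roundLaw D ν), ‖r.1‖ ≤ 1 := Measure.quasiMeasurePreserving_fst.ae hD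
  have h2 : ∀ᵐ r ∂(roundLaw D ν), ∀ a, |ℓ t r.2.2.1 r.1 a| ≤ 1 := by
    refine ae_all_iff.2 fun a => ?_
    have hm : Measurable fun r : Round d W => ℓ t r.2.2.1 r.1 a :=
      (hl.meas a).comp ((measurable_fst.comp (measurable_snd.comp measurable_snd)).prodMk
        measurable_fst)
    refine (Measure.ae_prod_iff_ae_ae (measurableSet_le (hm.norm) measurable_const)).2 ?_
    filter_upwards [hl.bound] with x hx
    exact (Measure.quasiMeasurePreserving_fst.comp Measure.quasiMeasurePreserving_snd).ae (hx a)
  have h3 : ∀ᵐ r ∂(roundLaw D ν), ∀ n, ‖(r.2.2.2 n).1‖ ≤ 1 := by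
    have h4 : ∀ᵐ z ∂(Measure.infinitePi fun _ : ℕ => D.prod (volume : Measure unitInterval)),
        ∀ n, ‖(z n).1‖ ≤ 1 :=
      ae_forall_infinitePi (p := fun z : Ctx d × unitInterval => ‖z.1‖ ≤ 1)
        (Measure.quasiMeasurePreserving_fst.ae hD)
    exact (Measure.quasiMeasurePreserving_snd.comp (Measure.quasiMeasurePreserving_snd.comp
      Measure.quasiMeasurePreserving_snd)).ae h4
  filter_upwards [h1, h2, h3] with r a b c using ⟨a, b, c⟩

/-- A product of functions of the action seed, the loss seed and the resampling seeds: for a fixed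
context its integral factorizes. -/
theorem inner_estimate (S : State d K) (r : Round d W) (a : Fin K) (y : Ctx d) :
    ⟪y, estimate T lam ℓ t S r a⟫ = (if sampleAction (policy T lam t S r.1) r.2.1 = a
      then (1 : ℝ) else 0) * (ℓ t r.2.2.1 r.1 a * (y.ofLp ⬝ᵥ (geomEst
        (resampleB (policy T lam t S) a) r.2.2.2 (iterations T lam t S) *ᵥ r.1.ofLp))) := by
  unfold estimate action
  split_ifs with h
  · rw [h, inner_smul_right, inner_eq_dotProduct, resampling_eq_geomEst, one_mul]
  · simp

theorem measurable_policy_state (S : State d K) : Measurable (policy T lam t S) :=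
  measurable_policy_comp (f := fun _ : Ctx d => S) measurable_const measurable_id

theorem measurable_predict_state (S : State d K) : Measurable (predict T lam S) :=
  measurable_predict_comp (f := fun _ : Ctx d => S) measurable_const measurable_id

theorem abs_geomEst_resampleB_le (hlam : 0 < lam) (S : State d K) (a : Fin K)
    {z : ℕ → Ctx d × unitInterval} (hz : ∀ n, ‖(z n).1‖ ≤ 1) {x y : Ctx d} (hx : ‖x‖ ≤ 1)
    (hy : ‖y‖ ≤ 1) :
    |y.ofLp ⬝ᵥ (geomEst (resampleB (policy T lam t S) a) z (iterations T lam t S) *ᵥ x.ofLp)| ≤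
      beta T lam S := by
  -- The bound is pathwise, so any law supplies the structure; a Dirac mass satisfies the norm
  -- condition trivially.
  have hB := isSubprojection_resampleB (D := Measure.dirac 0)
    (measurable_policy_state (T := T) (lam := lam) (t := t) S) (by simp) a
  have h := hB.abs_geomEst_le (fun n => resampleB_sq_le a (hz n)) (iterations T lam t S)
    y.ofLp x.ofLp
  rw [sqrt_dotProduct_self, sqrt_dotProduct_self] at h
  refine h.trans ?_
  have h1 := iterations_le (T := T) (t := t) (Nat.pos_of_ne_zero (NeZero.ne K)) hlam S
  have h2 : ‖y‖ * ‖x‖ ≤ 1 := mul_le_one₀ hy (norm_nonneg _) hx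
  refine le_trans (mul_le_of_le_one_right (by positivity) h2) h1

/-- This is exactly the boundedness by `β_t = 1/η_t` that exponential weights needs. -/
theorem GoodRound.abs_inner_estimate_le {r : Round d W} (hr : GoodRound (ℓ t) r) (hlam : 0 < lam)
    (S : State d K) (a : Fin K) {y : Ctx d} (hy : ‖y‖ ≤ 1) :
    |⟪y, estimate T lam ℓ t S r a⟫| ≤ beta T lam S := by
  rw [inner_estimate]
  have h1 := abs_geomEst_resampleB_le (T := T) (t := t) hlam S a hr.sample_le hr.norm_le hy
  split_ifs
  · rw [one_mul, abs_mul]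
    exact (mul_le_of_le_one_left (abs_nonneg _) (hr.loss_le a)).trans h1
  · simpa using (beta_pos S).le

theorem measurable_inner_estimate (hl : LinearRound D ν (ℓ t) θ) (a : Fin K) :
    Measurable fun p : Ctx d × (State d K × Round d W) =>
      ⟪p.1, estimate T lam ℓ t p.2.1 p.2.2 a⟫ :=
  measurable_fst.inner ((measurable_estimate hl.meas a).comp measurable_snd)

theorem measurable_inner_estimate_state (hl : LinearRound D ν (ℓ t) θ) (S : State d K)
    (a : Fin K) (y : Ctx d) :
    Measurable fun r : Round d W => ⟪y, estimate T lam ℓ t S r a⟫ := by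
  have h := (measurable_inner_estimate (T := T) (lam := lam) hl a).comp
    ((measurable_const (a := y)).prodMk ((measurable_const (a := S)).prodMk
      (measurable_id (α := Round d W))))
  simpa only [Function.comp_def, id] using h

theorem integral_round_mul {x : Ctx d} {a : Fin K} {m : ℝ} (hx : ∫ w, ℓ t w x a ∂ν = m)
    (f : unitInterval → ℝ) (g : (ℕ → Ctx d × unitInterval) → ℝ) :
    ∫ s, f s.1 * (ℓ t s.2.1 x a * g s.2.2) ∂((volume : Measure unitInterval).prod
      (ν.prod (Measure.infinitePi fun _ : ℕ => D.prod (volume : Measure unitInterval)))) =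
    (∫ u, f u) * (m * ∫ z, g z ∂(Measure.infinitePi fun _ : ℕ =>
      D.prod (volume : Measure unitInterval))) := by
  rw [integral_prod_mul f (fun s : W × (ℕ → Ctx d × unitInterval) => ℓ t s.1 x a * g s.2),
    integral_prod_mul (fun w => ℓ t w x a) g, hx]

/-- The mean of the loss estimate. -/
theorem integral_inner_estimate (hlam : 0 < lam) (ht : 1 ≤ t) (htT : t ≤ T)
    (hD : ∀ᵐ x ∂D, ‖x‖ ≤ 1) (hl : LinearRound D ν (ℓ t) θ) (S : State d K) (a : Fin K)
    {y : Ctx d} (hy : ‖y‖ ≤ 1) :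
    ∫ r, ⟪y, estimate T lam ℓ t S r a⟫ ∂(roundLaw D ν) = ⟪y, θ a⟫ - y.ofLp ⬝ᵥ
      ((1 - (1 / 2 : ℝ) • meanMatrix (D.prod (volume : Measure unitInterval))
        (resampleB (policy T lam t S) a)) ^ (iterations T lam t S + 1) *ᵥ (θ a).ofLp) := by
  have hq := measurable_policy_state (T := T) (lam := lam) (t := t) S
  have hq1 := policy_mem (d := d) (K := K) hlam ht htT S
  have hB := isSubprojection_resampleB (D := D) hq hD a
  have hint : Integrable (fun r : Round d W => ⟪y, estimate T lam ℓ t S r a⟫) (roundLaw D ν) := by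
    refine Integrable.of_bound
      (measurable_inner_estimate_state hl S a y).aestronglyMeasurable (beta T lam S) ?_
    filter_upwards [ae_goodRound hD hl] with r hr using hr.abs_inner_estimate_le hlam S a hy
  unfold roundLaw at hint ⊢
  rw [integral_prod _ hint]
  set q := policy T lam t S with hqdef
  set M := iterations T lam t S with hM
  set Sg := meanMatrix (D.prod (volume : Measure unitInterval)) (resampleB q a) with hSg
  set PM := (1 / 2 : ℝ) • ∑ k ∈ Finset.range (M + 1), (1 - (1 / 2 : ℝ) • Sg) ^ k with hPM
  have h1 : ∀ᵐ x ∂D, ∫ s, ⟪y, estimate T lam ℓ t S (x, s) a⟫ ∂((volume : Measure unitInterval).prod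
      (ν.prod (Measure.infinitePi fun _ : ℕ => D.prod (volume : Measure unitInterval)))) =
      q x a * (((y.ofLp ᵥ* PM) ⬝ᵥ x.ofLp) * (x.ofLp ⬝ᵥ (θ a).ofLp)) := by
    filter_upwards [hl.mean] with x hx
    simp only [inner_estimate, ← hqdef, ← hM]
    rw [integral_round_mul (hx a) (fun u : unitInterval => if sampleAction (q x) u = a
      then (1 : ℝ) else 0) (fun z => y.ofLp ⬝ᵥ (geomEst (resampleB q a) z M *ᵥ x.ofLp)),
      integral_sampleAction (hq1 x), hB.integral_geomEst, inner_eq_dotProduct,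
      Matrix.dotProduct_mulVec y.ofLp]
    ring
  -- Averaging over the context puts `S` next to the mean resampled matrix, and the geometric series
  -- cancels it up to the last power.
  rw [integral_congr_ae h1, ← dotProduct_meanMatrix_resampleB hq hq1 hD a, ← hSg,
    ← Matrix.dotProduct_mulVec, Matrix.mulVec_mulVec, hPM, half_geom_sum_mul, Matrix.sub_mulVec,
    Matrix.one_mulVec, dotProduct_sub, inner_eq_dotProduct]

/-- Exploration gives `S ≥ 2c` with `c = γλ/(2K)`, so `I - S/2 ≤ 1 - c ≤ exp(-c)`. The exponential
is used because it is positive and its powers compare directly with `t⁻² = exp(-2 log t)`. -/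
theorem abs_bias_le (hlam : 0 < lam) (ht : 1 ≤ t) (htT : t ≤ T) (hD : ∀ᵐ x ∂D, ‖x‖ ≤ 1)
    (hcov : ∀ u : Fin d → ℝ, lam * (u ⬝ᵥ u) ≤ ∫ x, (u ⬝ᵥ x.ofLp) ^ 2 ∂D) (S : State d K)
    (a : Fin K) {y v : Ctx d} (hy : ‖y‖ ≤ 1) (hv : ‖v‖ ≤ 1) :
    |y.ofLp ⬝ᵥ ((1 - (1 / 2 : ℝ) • meanMatrix (D.prod (volume : Measure unitInterval))
        (resampleB (policy T lam t S) a)) ^ (iterations T lam t S + 1) *ᵥ v.ofLp)| ≤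
      1 / (t : ℝ) ^ 2 := by
  have hq := measurable_policy_state (T := T) (lam := lam) (t := t) S
  have hq1 := policy_mem (d := d) (K := K) hlam ht htT S
  have hB := isSubprojection_resampleB (D := D) hq hD a
  set c := gamma T lam t S * lam / (2 * K) with hc
  set Sg := meanMatrix (D.prod (volume : Measure unitInterval)) (resampleB (policy T lam t S) a)
    with hSg
  have hK : (0 : ℝ) < K := by exact_mod_cast Nat.pos_of_ne_zero (NeZero.ne K)
  have hlow : ∀ u : Fin d → ℝ, 2 * c * (u ⬝ᵥ u) ≤ u ⬝ᵥ (Sg *ᵥ u) := by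
    intro u
    rw [hSg, dotProduct_meanMatrix_resampleB hq hq1 hD a]
    have h2 : gamma T lam t S / K * ∫ x, (u ⬝ᵥ x.ofLp) ^ 2 ∂D ≤
        ∫ x, policy T lam t S x a * ((u ⬝ᵥ x.ofLp) * (x.ofLp ⬝ᵥ u)) ∂D := by
      rw [← integral_const_mul]
      refine integral_mono_of_nonneg (Filter.Eventually.of_forall fun x => mul_nonneg
        (div_nonneg (gamma_nonneg hlam S) hK.le) (sq_nonneg _)) ?_
        (Filter.Eventually.of_forall fun x => ?_)
      · have h3 := integrable_weighted_sq hq hq1 hD a u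
        refine h3.congr (Filter.Eventually.of_forall fun x => ?_)
        simp only [dotProduct_comm x.ofLp u, sq]
      · simp only [dotProduct_comm x.ofLp u, ← sq]
        exact mul_le_mul_of_nonneg_right (gamma_div_le_policy hlam ht htT S x a) (sq_nonneg _)
    refine le_trans ?_ h2
    have h4 := mul_le_mul_of_nonneg_left (hcov u)
      (div_nonneg (gamma_nonneg (T := T) (t := t) hlam S) hK.le)
    refine le_trans (le_of_eq ?_) h4
    rw [hc]; field_simp
  have h := abs_dotProduct_pow_mulVec_le (R := 1 - (1 / 2 : ℝ) • Sg) (ρ := Real.exp (-c))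
    (by rw [Matrix.transpose_sub, Matrix.transpose_one, Matrix.transpose_smul, hSg,
      hB.meanMatrix_symm]) (Real.exp_pos _)
    (fun u => by simpa using hB.resolvent_nonneg 1 u)
    (fun u => by
      rw [Matrix.sub_mulVec, Matrix.one_mulVec, Matrix.smul_mulVec, dotProduct_sub,
        dotProduct_smul, smul_eq_mul]
      have h5 := Real.add_one_le_exp (-c)
      have h6 := mul_le_mul_of_nonneg_right h5 (dotProduct_self_nonneg' u)
      linarith [hlow u]) (iterations T lam t S + 1) y.ofLp v.ofLp
  refine h.trans ?_
  rw [sqrt_dotProduct_self, sqrt_dotProduct_self]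
  refine (mul_le_of_le_one_right (by positivity) (mul_le_one₀ hy (norm_nonneg _) hv)).trans ?_
  have ht' : (0 : ℝ) < t := by exact_mod_cast ht
  have h7 := le_gamma_mul_iterations (T := T) (t := t)
    (Nat.pos_of_ne_zero (NeZero.ne K)) hlam S
  rw [← Real.exp_nat_mul]
  have h8 : 1 / (t : ℝ) ^ 2 = Real.exp (-(2 * Real.log t)) := by
    rw [Real.exp_neg, two_mul, Real.exp_add, Real.exp_log ht', sq, one_div]
  rw [h8, Real.exp_le_exp]
  push_cast
  rw [← hc] at h7
  linarith

end Round

/-! ### Mean regret and second moment of the estimated losses in one round -/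

section RoundMoments

set_option linter.unusedSectionVars false

variable {d K T t : ℕ} [NeZero K] {lam : ℝ} {W : Type*} [MeasurableSpace W]
  {D : Measure (Ctx d)} [IsProbabilityMeasure D] {ν : Measure W} [IsProbabilityMeasure ν]
  {ℓ : Loss d K W} {θ : Fin K → Ctx d} {π : Ctx d → Fin K}

theorem measurable_apply_fin {Ω : Type*} [MeasurableSpace Ω] {f : Ω → Fin K} (hf : Measurable f)
    {g : Fin K → Ω → ℝ} (hg : ∀ a, Measurable (g a)) : Measurable fun ω => g (f ω) ω :=
  (measurable_from_prod_countable_right (f := fun p : Fin K × Ω => g p.1 p.2) hg).comp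
    (hf.prodMk measurable_id)

/-- The regret of a round against `π`. -/
noncomputable def roundRegret (T : ℕ) (lam : ℝ) (ℓ : Loss d K W) (π : Ctx d → Fin K) (t : ℕ) (S : State d K)
    (r : Round d W) : ℝ :=
  ℓ t r.2.2.1 r.1 (action T lam t S r) - ℓ t r.2.2.1 r.1 (π r.1)

/-- The regret of the FTRL prediction against `π` in context `y` for the estimated losses. -/
noncomputable def estRegret (T : ℕ) (lam : ℝ) (ℓ : Loss d K W) (π : Ctx d → Fin K) (t : ℕ)
    (y : Ctx d) (S : State d K) (r : Round d W) : ℝ :=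
  ∑ a, (predict T lam S y a - Pi.single (M := fun _ => ℝ) (π y) 1 a) *
    ⟪y, estimate T lam ℓ t S r a⟫

/-- The second moment of the estimated losses under the FTRL prediction in context `y`. -/
noncomputable def estQuad (T : ℕ) (lam : ℝ) (ℓ : Loss d K W) (t : ℕ)
    (y : Ctx d) (S : State d K) (r : Round d W) : ℝ :=
  ∑ a, predict T lam S y a * ⟪y, estimate T lam ℓ t S r a⟫ ^ 2

theorem measurable_single (hπ : Measurable π) (a : Fin K) :
    Measurable fun y => Pi.single (M := fun _ => ℝ) (π y) 1 a :=
  (measurable_of_finite fun b : Fin K => Pi.single (M := fun _ => ℝ) b 1 a).comp hπ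

theorem measurable_roundRegret (hl : LinearRound D ν (ℓ t) θ) (hπ : Measurable π) :
    Measurable fun p : State d K × Round d W => roundRegret T lam ℓ π t p.1 p.2 := by
  have h : ∀ a, Measurable fun p : State d K × Round d W => ℓ t p.2.2.2.1 p.2.1 a := fun a =>
    (hl.meas a).comp ((measurable_fst.comp (measurable_snd.comp (measurable_snd.comp
      measurable_snd))).prodMk (measurable_fst.comp measurable_snd))
  exact (measurable_apply_fin measurable_action h).sub
    (measurable_apply_fin (hπ.comp (measurable_fst.comp measurable_snd)) h)

theorem measurable_predict_apply (a : Fin K) :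
    Measurable fun p : Ctx d × (State d K × Round d W) => predict T lam p.2.1 p.1 a :=
  (measurable_pi_apply a).comp
    (measurable_predict_comp (measurable_fst.comp measurable_snd) measurable_fst)

theorem measurable_estRegret (hl : LinearRound D ν (ℓ t) θ) (hπ : Measurable π) :
    Measurable fun p : Ctx d × (State d K × Round d W) =>
      estRegret T lam ℓ π t p.1 p.2.1 p.2.2 :=
  Finset.measurable_sum _ fun a _ => ((measurable_predict_apply a).sub
    ((measurable_single hπ a).comp measurable_fst)).mul (measurable_inner_estimate hl a)

theorem measurable_estQuad (hl : LinearRound D ν (ℓ t) θ) :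
    Measurable fun p : Ctx d × (State d K × Round d W) =>
      estQuad T lam ℓ t p.1 p.2.1 p.2.2 :=
  Finset.measurable_sum _ fun a _ => (measurable_predict_apply a).mul
    ((measurable_inner_estimate hl a).pow_const 2)

theorem GoodRound.abs_roundRegret_le {r : Round d W} (hr : GoodRound (ℓ t) r) (S : State d K) :
    |roundRegret T lam ℓ π t S r| ≤ 2 := by
  unfold roundRegret
  refine (abs_sub _ _).trans ?_
  linarith [hr.loss_le (action T lam t S r), hr.loss_le (π r.1)]

theorem GoodRound.abs_estRegret_le {r : Round d W} (hr : GoodRound (ℓ t) r) (hlam : 0 < lam)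
    (S : State d K) {y : Ctx d} (hy : ‖y‖ ≤ 1) :
    |estRegret T lam ℓ π t y S r| ≤ 2 * beta T lam S :=
  abs_sum_sub_mul_le (predict_mem S y) (single_mem_stdSimplex ℝ (π y))
    fun a => hr.abs_inner_estimate_le hlam S a hy

theorem estQuad_nonneg (S : State d K) (y : Ctx d) (r : Round d W) :
    0 ≤ estQuad T lam ℓ t y S r :=
  Finset.sum_nonneg fun a _ => mul_nonneg ((predict_mem S y).1 a) (sq_nonneg _)

theorem GoodRound.abs_estQuad_le {r : Round d W} (hr : GoodRound (ℓ t) r) (hlam : 0 < lam)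
    (S : State d K) {y : Ctx d} (hy : ‖y‖ ≤ 1) :
    |estQuad T lam ℓ t y S r| ≤ beta T lam S ^ 2 := by
  rw [abs_of_nonneg (estQuad_nonneg S y r)]
  have h : ∀ a ∈ Finset.univ, predict T lam S y a * ⟪y, estimate T lam ℓ t S r a⟫ ^ 2 ≤
      predict T lam S y a * beta T lam S ^ 2 := fun a _ => by
    refine mul_le_mul_of_nonneg_left ?_ ((predict_mem S y).1 a)
    rw [← sq_abs]
    exact pow_le_pow_left₀ (abs_nonneg _) (hr.abs_inner_estimate_le hlam S a hy) 2
  refine (Finset.sum_le_sum h).trans ?_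
  rw [← Finset.sum_mul, (predict_mem S y).2, one_mul]

theorem ae_prod_good (hD : ∀ᵐ x ∂D, ‖x‖ ≤ 1) (hl : LinearRound D ν (ℓ t) θ) :
    ∀ᵐ p ∂(D.prod (roundLaw D ν)), ‖p.1‖ ≤ 1 ∧ GoodRound (ℓ t) p.2 :=
  (Measure.quasiMeasurePreserving_fst.ae hD).and
    (Measure.quasiMeasurePreserving_snd.ae (ae_goodRound hD hl))

theorem measurable_state_section {f : Ctx d → State d K → Round d W → ℝ}
    (hf : Measurable fun p : Ctx d × (State d K × Round d W) => f p.1 p.2.1 p.2.2)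
    (S : State d K) : Measurable fun p : Ctx d × Round d W => f p.1 S p.2 := by
  have h := hf.comp (measurable_fst.prodMk ((measurable_const (a := S)).prodMk
    (measurable_snd (α := Ctx d) (β := Round d W))))
  simpa only [Function.comp_def] using h

theorem integrable_estRegret (hlam : 0 < lam) (hD : ∀ᵐ x ∂D, ‖x‖ ≤ 1)
    (hl : LinearRound D ν (ℓ t) θ) (hπ : Measurable π) (S : State d K) :
    Integrable (fun p : Ctx d × Round d W => estRegret T lam ℓ π t p.1 S p.2)
      (D.prod (roundLaw D ν)) := by
  refine Integrable.of_bound (measurable_state_section (measurable_estRegret hl hπ)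
    S).aestronglyMeasurable (2 * beta T lam S) ?_
  filter_upwards [ae_prod_good hD hl] with p hp using hp.2.abs_estRegret_le hlam S hp.1

theorem integrable_estQuad (hlam : 0 < lam) (hD : ∀ᵐ x ∂D, ‖x‖ ≤ 1)
    (hl : LinearRound D ν (ℓ t) θ) (S : State d K) :
    Integrable (fun p : Ctx d × Round d W => estQuad T lam ℓ t p.1 S p.2)
      (D.prod (roundLaw D ν)) := by
  refine Integrable.of_bound (measurable_state_section (measurable_estQuad hl)
    S).aestronglyMeasurable (beta T lam S ^ 2) ?_
  filter_upwards [ae_prod_good hD hl] with p hp using hp.2.abs_estQuad_le hlam S hp.1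

theorem integral_sampleAction_sub {q : Fin K → ℝ} (hq : q ∈ stdSimplex ℝ (Fin K)) (a b : Fin K) :
    ∫ u : unitInterval, ((if sampleAction q u = a then (1 : ℝ) else 0) -
      Pi.single (M := fun _ => ℝ) b 1 a) = q a - Pi.single (M := fun _ => ℝ) b 1 a := by
  have hm : Measurable fun u : unitInterval => if sampleAction q u = a then (1 : ℝ) else 0 :=
    Measurable.ite ((measurable_sampleAction.comp (measurable_const.prodMk measurable_subtype_coe))
      (measurableSet_singleton a)) measurable_const measurable_const
  rw [integral_sub (Integrable.of_bound hm.aestronglyMeasurable 1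
    (Filter.Eventually.of_forall fun u => by split_ifs <;> simp)) (integrable_const _),
    integral_sampleAction hq]
  simp

/-- Expand the regret over actions. Given the context, the action seed and the loss seed average
independently, to the policy and to the linear mean loss. -/
theorem integral_roundRegret (hlam : 0 < lam) (ht : 1 ≤ t) (htT : t ≤ T)
    (hD : ∀ᵐ x ∂D, ‖x‖ ≤ 1) (hl : LinearRound D ν (ℓ t) θ) (hπ : Measurable π) (S : State d K) :
    ∫ r, roundRegret T lam ℓ π t S r ∂(roundLaw D ν) =
      ∫ x, ∑ a, (policy T lam t S x a - Pi.single (M := fun _ => ℝ) (π x) 1 a) * ⟪x, θ a⟫ ∂D := by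
  have hq := measurable_policy_state (T := T) (lam := lam) (t := t) S
  have hq1 := policy_mem (d := d) (K := K) hlam ht htT S
  set q := policy T lam t S with hqdef
  set δ : Fin K → Round d W → ℝ := fun a r => ((if sampleAction (q r.1) r.2.1 = a
    then (1 : ℝ) else 0) - Pi.single (M := fun _ => ℝ) (π r.1) 1 a) * ℓ t r.2.2.1 r.1 a with hδ
  have hsum : ∀ r, roundRegret T lam ℓ π t S r = ∑ a, δ a r := by
    intro r
    simp only [hδ, sub_mul, Finset.sum_sub_distrib, ite_mul, one_mul, zero_mul, Finset.sum_ite_eq,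
      Finset.mem_univ, if_true, Pi.single_apply]
    simp [roundRegret, action, hqdef]
  have hδint : ∀ a, Integrable (δ a) (roundLaw D ν) := by
    intro a
    have hm1 : Measurable fun r : Round d W => sampleAction (q r.1) r.2.1 := by
      have h1 : Measurable fun r : Round d W => q r.1 := hq.comp measurable_fst
      have h2 : Measurable fun r : Round d W => (r.2.1 : ℝ) :=
        measurable_subtype_coe.comp (measurable_fst.comp measurable_snd)
      exact measurable_sampleAction.comp (h1.prodMk h2)
    have hm2 : Measurable fun r : Round d W => ℓ t r.2.2.1 r.1 a :=
      (hl.meas a).comp ((measurable_fst.comp (measurable_snd.comp measurable_snd)).prodMk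
        measurable_fst)
    have hm : Measurable (δ a) := ((Measurable.ite (hm1 (measurableSet_singleton a))
      measurable_const measurable_const).sub ((measurable_single hπ a).comp measurable_fst)).mul hm2
    refine Integrable.of_bound hm.aestronglyMeasurable 1 ?_
    filter_upwards [ae_goodRound hD hl] with r hr
    rw [Real.norm_eq_abs, abs_mul]
    refine mul_le_one₀ ?_ (abs_nonneg _) (hr.loss_le a)
    rw [Pi.single_apply]
    split_ifs <;> simp
  simp only [hsum]
  rw [integral_finsetSum _ fun a _ => hδint a, integral_finsetSum]
  · refine Finset.sum_congr rfl fun a _ => ?_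
    have h := hδint a
    unfold roundLaw at h ⊢
    rw [integral_prod _ h]
    refine integral_congr_ae ?_
    filter_upwards [hl.mean] with x hx
    have h2 := integral_round_mul (D := D) (ν := ν) (ℓ := ℓ) (hx a) (fun u : unitInterval =>
      (if sampleAction (q x) u = a then (1 : ℝ) else 0) - Pi.single (M := fun _ => ℝ) (π x) 1 a)
      (fun _ => 1)
    rw [integral_sampleAction_sub (hq1 x)] at h2
    simp only [mul_one, integral_const, probReal_univ, one_smul] at h2
    simp only [hδ]
    exact h2
  · intro a _
    have hm : Measurable fun x => (q x a - Pi.single (M := fun _ => ℝ) (π x) 1 a) * ⟪x, θ a⟫ :=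
      (((measurable_pi_apply a).comp hq).sub (measurable_single hπ a)).mul
        (measurable_id.inner measurable_const)
    refine Integrable.of_bound hm.aestronglyMeasurable 2 ?_
    filter_upwards [hD] with x hx
    rw [Real.norm_eq_abs, abs_mul]
    have h1 := abs_inner_le_one hx (hl.norm_le a)
    have h2 : |q x a - Pi.single (M := fun _ => ℝ) (π x) 1 a| ≤ 2 := by
      have h3 : q x a ≤ 1 :=
        (Finset.single_le_sum (fun b _ => (hq1 x).1 b) (Finset.mem_univ a)).trans (hq1 x).2.le
      have h4 := (hq1 x).1 a
      rw [abs_le, Pi.single_apply]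
      split_ifs <;> constructor <;> linarith
    nlinarith [abs_nonneg (q x a - Pi.single (M := fun _ => ℝ) (π x) 1 a), abs_nonneg ⟪x, θ a⟫]

/-- The regret of a round is at most the estimated regret, up to exploration and bias. -/
theorem integral_roundRegret_le (hlam : 0 < lam) (ht : 1 ≤ t) (htT : t ≤ T)
    (hD : ∀ᵐ x ∂D, ‖x‖ ≤ 1)
    (hcov : ∀ u : Fin d → ℝ, lam * (u ⬝ᵥ u) ≤ ∫ x, (u ⬝ᵥ x.ofLp) ^ 2 ∂D)
    (hl : LinearRound D ν (ℓ t) θ) (hπ : Measurable π) (S : State d K) :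
    ∫ r, roundRegret T lam ℓ π t S r ∂(roundLaw D ν) ≤
      ∫ r, ∫ y, estRegret T lam ℓ π t y S r ∂D ∂(roundLaw D ν) + 2 * gamma T lam t S
        + 2 / (t : ℝ) ^ 2 := by
  have hq1 := policy_mem (d := d) (K := K) hlam ht htT S
  have hint := integrable_estRegret (T := T) hlam hD hl hπ S
  -- The observed context and the ghost context have the same law, so the two sides can be compared
  -- pointwise in the context.
  rw [integral_roundRegret hlam ht htT hD hl hπ S, ← integral_prod_symm _ hint,
    integral_prod _ hint]
  have hI := hint.integral_prod_left
  have hc : ∫ y, (∫ r, estRegret T lam ℓ π t y S r ∂(roundLaw D ν) +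
      (2 * gamma T lam t S + 2 / (t : ℝ) ^ 2)) ∂D =
      ∫ y, ∫ r, estRegret T lam ℓ π t y S r ∂(roundLaw D ν) ∂D + 2 * gamma T lam t S
        + 2 / (t : ℝ) ^ 2 := by
    rw [integral_add hI (integrable_const _)]
    simp [add_assoc]
  rw [← hc]
  refine integral_mono_ae ?_ (hI.add (integrable_const _)) ?_
  · have hq := measurable_policy_state (T := T) (lam := lam) (t := t) S
    refine Integrable.of_bound (Finset.measurable_sum _ fun a _ =>
      (((measurable_pi_apply a).comp hq).sub (measurable_single hπ a)).mul
        (measurable_id.inner measurable_const)).aestronglyMeasurable 2 ?_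
    filter_upwards [hD] with x hx
    have := abs_sum_sub_mul_le (hq1 x) (single_mem_stdSimplex ℝ (π x)) (c := 1)
      (f := fun a => ⟪x, θ a⟫) fun a => abs_inner_le_one hx (hl.norm_le a)
    rw [mul_one] at this
    exact this
  · filter_upwards [hD] with y hy
    have hest : ∀ a, Integrable (fun r : Round d W => ⟪y, estimate T lam ℓ t S r a⟫)
        (roundLaw D ν) := fun a => by
      refine Integrable.of_bound
        (measurable_inner_estimate_state hl S a y).aestronglyMeasurable (beta T lam S) ?_
      filter_upwards [ae_goodRound hD hl] with r hr using hr.abs_inner_estimate_le hlam S a hy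
    unfold estRegret
    rw [integral_finsetSum _ fun a _ => (hest a).const_mul _]
    simp only [integral_const_mul]
    have hmean := fun a => integral_inner_estimate hlam ht htT hD hl S a hy
    simp only [hmean]
    set b : Fin K → ℝ := fun a => y.ofLp ⬝ᵥ ((1 - (1 / 2 : ℝ) • meanMatrix
      (D.prod (volume : Measure unitInterval)) (resampleB (policy T lam t S) a)) ^
      (iterations T lam t S + 1) *ᵥ (θ a).ofLp) with hb
    have hbias : ∀ a, |b a| ≤ 1 / (t : ℝ) ^ 2 := fun a =>
      abs_bias_le hlam ht htT hD hcov S a hy (hl.norm_le a)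
    have h1 := abs_sum_sub_mul_le (predict_mem (T := T) (lam := lam) S y)
      (single_mem_stdSimplex ℝ (π y)) hbias
    have hunif : (fun _ : Fin K => (1 : ℝ) / K) ∈ stdSimplex ℝ (Fin K) := by
      have : (K : ℝ) ≠ 0 := by exact_mod_cast NeZero.ne K
      exact ⟨fun _ => by positivity, by simp [this]⟩
    have h2 := abs_sum_sub_mul_le hunif (predict_mem (T := T) (lam := lam) S y) (c := 1)
      (f := fun a => ⟪y, θ a⟫) fun a => abs_inner_le_one hy (hl.norm_le a)
    -- Three parts: the prediction against the mean of the estimates, the bias `b`, and the shift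
    -- `γ(1/K - p)` due to exploration.
    have h3 : ∑ a, (policy T lam t S y a - Pi.single (M := fun _ => ℝ) (π y) 1 a) * ⟪y, θ a⟫ =
        ∑ a, (predict T lam S y a - Pi.single (M := fun _ => ℝ) (π y) 1 a) * (⟪y, θ a⟫ - b a) +
        ∑ a, (predict T lam S y a - Pi.single (M := fun _ => ℝ) (π y) 1 a) * b a +
        gamma T lam t S * ∑ a, ((1 : ℝ) / K - predict T lam S y a) * ⟪y, θ a⟫ := by
      rw [Finset.mul_sum, ← Finset.sum_add_distrib, ← Finset.sum_add_distrib]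
      refine Finset.sum_congr rfl fun a _ => ?_
      unfold policy
      ring
    rw [h3]
    have h4 := (abs_le.1 h1).2
    have h5 := mul_le_mul_of_nonneg_left (abs_le.1 h2).2
      (gamma_nonneg (T := T) (t := t) hlam S)
    have h6 : 2 * (1 / (t : ℝ) ^ 2) = 2 / (t : ℝ) ^ 2 := by ring
    linarith

theorem integrable_vecMul_quadratic_prod {q : Ctx d → Fin K → ℝ} (hq : Measurable q)
    (hq1 : ∀ x, q x ∈ stdSimplex ℝ (Fin K)) (hD : ∀ᵐ x ∂D, ‖x‖ ≤ 1) (a : Fin K) (M : ℕ) :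
    Integrable (fun p : Ctx d × ((ℕ → Ctx d × unitInterval) × Ctx d) =>
      q p.1 a * (q p.2.2 a * (p.1.ofLp ⬝ᵥ (resampling q a p.2.1 M *ᵥ p.2.2.ofLp)) ^ 2))
      (D.prod ((Measure.infinitePi fun _ : ℕ => D.prod (volume : Measure unitInterval)).prod D)) := by
  have hB := isSubprojection_resampleB hq hD a
  have hqa : Measurable fun x => q x a := (measurable_pi_apply a).comp hq
  have hm : Measurable fun p : Ctx d × ((ℕ → Ctx d × unitInterval) × Ctx d) =>
      p.1.ofLp ⬝ᵥ (resampling q a p.2.1 M *ᵥ p.2.2.ofLp) := by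
    simp only [resampling_eq_geomEst]
    exact measurable_dotProduct_mulVec (fun i j => (hB.measurable_geomEst M i j).comp
      (measurable_fst.comp measurable_snd)) (fun i => by fun_prop) (fun i => by fun_prop)
  refine Integrable.of_bound ((hqa.comp measurable_fst).mul ((hqa.comp (measurable_snd.comp
    measurable_snd)).mul (hm.pow_const 2))).aestronglyMeasurable (((M + 1) / 2) ^ 2) ?_
  have h1 : ∀ᵐ p ∂(D.prod ((Measure.infinitePi fun _ : ℕ =>
      D.prod (volume : Measure unitInterval)).prod D)), ‖p.1‖ ≤ 1 :=
    Measure.quasiMeasurePreserving_fst.ae hD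
  have h2 : ∀ᵐ p ∂(D.prod ((Measure.infinitePi fun _ : ℕ =>
      D.prod (volume : Measure unitInterval)).prod D)), ‖p.2.2‖ ≤ 1 :=
    (Measure.quasiMeasurePreserving_snd.comp Measure.quasiMeasurePreserving_snd).ae hD
  have h3 := (Measure.quasiMeasurePreserving_fst.comp (Measure.quasiMeasurePreserving_snd
    (μ := D) (ν := (Measure.infinitePi fun _ : ℕ => D.prod (volume : Measure unitInterval)).prod
      D))).ae (ae_forall_infinitePi hB.sq_le)
  filter_upwards [h1, h2, h3] with p hp1 hp2 hp3
  have hle : ∀ x, q x a ≤ 1 := fun x =>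
    (Finset.single_le_sum (fun b _ => (hq1 x).1 b) (Finset.mem_univ a)).trans (hq1 x).2.le
  have h4 := hB.abs_geomEst_le hp3 M p.1.ofLp p.2.2.ofLp
  rw [sqrt_dotProduct_self, sqrt_dotProduct_self] at h4
  have h5 : |p.1.ofLp ⬝ᵥ (resampling q a p.2.1 M *ᵥ p.2.2.ofLp)| ≤ (M + 1) / 2 := by
    rw [resampling_eq_geomEst]
    exact h4.trans (mul_le_of_le_one_right (by positivity) (mul_le_one₀ hp1 (norm_nonneg _) hp2))
  have h6 := pow_le_pow_left₀ (abs_nonneg _) h5 2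
  rw [sq_abs] at h6
  rw [Real.norm_eq_abs, abs_of_nonneg (mul_nonneg ((hq1 _).1 a) (mul_nonneg ((hq1 _).1 a)
    (sq_nonneg _)))]
  refine (mul_le_of_le_one_left (mul_nonneg ((hq1 _).1 a) (sq_nonneg _)) (hle _)).trans ?_
  exact (mul_le_of_le_one_left (sq_nonneg _) (hle _)).trans h6

theorem measurable_resampling_sq {q : Ctx d → Fin K → ℝ} (hq : Measurable q) (a : Fin K) (M : ℕ)
    (y : Ctx d) : Measurable fun p : (ℕ → Ctx d × unitInterval) × Ctx d =>
      (y.ofLp ⬝ᵥ (resampling q a p.1 M *ᵥ p.2.ofLp)) ^ 2 := by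
  have hB := isSubprojection_resampleB (D := Measure.dirac 0) hq (by simp) a
  simp only [resampling_eq_geomEst]
  have h := measurable_dotProduct_mulVec (u := fun _ => y.ofLp)
    (A := fun p : (ℕ → Ctx d × unitInterval) × Ctx d => geomEst (resampleB q a) p.1 M)
    (v := fun p => p.2.ofLp) (fun i j => (hB.measurable_geomEst M i j).comp measurable_fst)
    (fun i => measurable_const) (fun i => by fun_prop)
  exact h.pow_const 2

theorem resampling_sq_le (hlam : 0 < lam) (S : State d K) (a : Fin K)
    {z : ℕ → Ctx d × unitInterval} (hz : ∀ n, ‖(z n).1‖ ≤ 1) {x y : Ctx d} (hx : ‖x‖ ≤ 1)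
    (hy : ‖y‖ ≤ 1) :
    (y.ofLp ⬝ᵥ (resampling (policy T lam t S) a z (iterations T lam t S) *ᵥ x.ofLp)) ^ 2 ≤
      beta T lam S ^ 2 := by
  rw [← sq_abs, resampling_eq_geomEst]
  exact pow_le_pow_left₀ (abs_nonneg _) (abs_geomEst_resampleB_le hlam S a hz hx hy) 2

theorem integrable_inner_estimate_sq (hlam : 0 < lam) (hD : ∀ᵐ x ∂D, ‖x‖ ≤ 1)
    (hl : LinearRound D ν (ℓ t) θ) (S : State d K) (a : Fin K) {y : Ctx d} (hy : ‖y‖ ≤ 1) :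
    Integrable (fun r : Round d W => ⟪y, estimate T lam ℓ t S r a⟫ ^ 2) (roundLaw D ν) := by
  refine Integrable.of_bound
    ((measurable_inner_estimate_state hl S a y).pow_const 2).aestronglyMeasurable
    (beta T lam S ^ 2) ?_
  filter_upwards [ae_goodRound hD hl] with r hr
  rw [Real.norm_eq_abs, abs_of_nonneg (sq_nonneg _), ← sq_abs]
  exact pow_le_pow_left₀ (abs_nonneg _) (hr.abs_inner_estimate_le hlam S a hy) 2

/-- Bound the squared loss by `1` and integrate out the action seed. What remains is the quadratic
form treated in `resampling_second_moment`. -/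
theorem integral_inner_estimate_sq_le (hlam : 0 < lam) (ht : 1 ≤ t) (htT : t ≤ T)
    (hD : ∀ᵐ x ∂D, ‖x‖ ≤ 1) (hl : LinearRound D ν (ℓ t) θ) (S : State d K) (a : Fin K)
    {y : Ctx d} (hy : ‖y‖ ≤ 1) :
    ∫ r, ⟪y, estimate T lam ℓ t S r a⟫ ^ 2 ∂(roundLaw D ν) ≤
      ∫ z, ∫ x, policy T lam t S x a * (y.ofLp ⬝ᵥ (resampling (policy T lam t S) a z
        (iterations T lam t S) *ᵥ x.ofLp)) ^ 2 ∂D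
        ∂(Measure.infinitePi fun _ : ℕ => D.prod (volume : Measure unitInterval)) := by
  have hq := measurable_policy_state (T := T) (lam := lam) (t := t) S
  have hq1 := policy_mem (d := d) (K := K) hlam ht htT S
  have hm0 := measurable_resampling_sq hq a (iterations T lam t S) y
  have hbd := fun z x => resampling_sq_le (T := T) (t := t) hlam S a (z := z) (x := x) (y := y)
  have hest := fun r : Round d W => inner_estimate (T := T) (lam := lam) (ℓ := ℓ) (t := t) S r a y
  simp only [← resampling_eq_geomEst] at hest
  generalize policy T lam t S = q at *
  generalize iterations T lam t S = M at *
  set Pinf := Measure.infinitePi fun _ : ℕ => D.prod (volume : Measure unitInterval) with hPinf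
  set G : Round d W → ℝ := fun r => (if sampleAction (q r.1) r.2.1 = a then (1 : ℝ) else 0) *
    (1 * (y.ofLp ⬝ᵥ (resampling q a r.2.2.2 M *ᵥ r.1.ofLp)) ^ 2) with hG
  have hGint : Integrable G (roundLaw D ν) := by
    have hm1 : Measurable fun r : Round d W => sampleAction (q r.1) r.2.1 := by
      have h1 : Measurable fun r : Round d W => q r.1 := hq.comp measurable_fst
      have h2 : Measurable fun r : Round d W => (r.2.1 : ℝ) :=
        measurable_subtype_coe.comp (measurable_fst.comp measurable_snd)
      exact measurable_sampleAction.comp (h1.prodMk h2)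
    have hm2 : Measurable fun r : Round d W => (r.2.2.2, r.1) :=
      (measurable_snd.comp (measurable_snd.comp measurable_snd)).prodMk measurable_fst
    have hm3 := hm0.comp hm2
    simp only [Function.comp_def] at hm3
    refine Integrable.of_bound ((Measurable.ite (hm1 (measurableSet_singleton a))
      measurable_const measurable_const).mul (hm3.const_mul 1)).aestronglyMeasurable
      (beta T lam S ^ 2) ?_
    filter_upwards [ae_goodRound hD hl] with r hr
    have h3 := hbd _ _ hr.sample_le hr.norm_le hy
    simp only [hG, one_mul]
    split_ifs
    · rw [one_mul, Real.norm_eq_abs, abs_of_nonneg (sq_nonneg _)]; exact h3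
    · simpa using sq_nonneg (beta T lam S)
  have hle : ∫ r, ⟪y, estimate T lam ℓ t S r a⟫ ^ 2 ∂(roundLaw D ν) ≤
      ∫ r, G r ∂(roundLaw D ν) := by
    refine integral_mono_ae (integrable_inner_estimate_sq hlam hD hl S a hy) hGint ?_
    filter_upwards [ae_goodRound hD hl] with r hr
    simp only [hest, hG]
    split_ifs
    · rw [one_mul, one_mul, one_mul, mul_pow]
      refine mul_le_of_le_one_left (sq_nonneg _) ?_
      rw [← sq_abs]
      exact pow_le_one₀ (abs_nonneg _) (hr.loss_le a)
    · simp
  refine hle.trans (le_of_eq ?_)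
  unfold roundLaw at hGint ⊢
  rw [integral_prod _ hGint]
  have hx : ∀ x, ∫ s, G (x, s) ∂((volume : Measure unitInterval).prod (ν.prod Pinf)) =
      ∫ z, q x a * (y.ofLp ⬝ᵥ (resampling q a z M *ᵥ x.ofLp)) ^ 2 ∂Pinf := by
    intro x
    -- The factorization is reused with the constant loss `1`.
    have h1 := integral_round_mul (D := D) (ν := ν) (ℓ := fun _ _ _ (_ : Fin K) => (1 : ℝ))
      (t := t) (x := x) (a := a) (m := 1) (by simp) (fun u : unitInterval =>
        if sampleAction (q x) u = a then (1 : ℝ) else 0)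
      (fun z => (y.ofLp ⬝ᵥ (resampling q a z M *ᵥ x.ofLp)) ^ 2)
    rw [integral_sampleAction (hq1 x), mul_one, one_mul, ← integral_const_mul] at h1
    exact h1
  rw [← hPinf]
  simp only [hx]
  refine integral_integral_swap ?_
  have hm4 := hm0.comp (measurable_swap (α := Ctx d) (β := ℕ → Ctx d × unitInterval))
  simp only [Function.comp_def, Prod.fst_swap, Prod.snd_swap] at hm4
  have hm5 : Measurable fun p : Ctx d × (ℕ → Ctx d × unitInterval) => q p.1 a :=
    ((measurable_pi_apply a).comp hq).comp measurable_fst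
  refine Integrable.of_bound (hm5.mul hm4).aestronglyMeasurable (beta T lam S ^ 2) ?_
  have hz : ∀ᵐ z ∂Pinf, ∀ n, ‖(z n).1‖ ≤ 1 :=
    ae_forall_infinitePi (p := fun z : Ctx d × unitInterval => ‖z.1‖ ≤ 1)
      (Measure.quasiMeasurePreserving_fst.ae hD)
  have h1 : ∀ᵐ p ∂(D.prod Pinf), ‖p.1‖ ≤ 1 := Measure.quasiMeasurePreserving_fst.ae hD
  have h2 : ∀ᵐ p ∂(D.prod Pinf), ∀ n, ‖(p.2 n).1‖ ≤ 1 :=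
    Measure.quasiMeasurePreserving_snd.ae hz
  filter_upwards [h1, h2] with p hp1 hp2
  have h3 := hbd _ _ hp2 hp1 hy
  have h4 : q p.1 a ≤ 1 := (Finset.single_le_sum (fun b _ => (hq1 p.1).1 b)
    (Finset.mem_univ a)).trans (hq1 p.1).2.le
  simp only [Function.uncurry]
  rw [Real.norm_eq_abs, abs_of_nonneg (mul_nonneg ((hq1 _).1 a) (sq_nonneg _))]
  exact (mul_le_of_le_one_left (sq_nonneg _) h4).trans h3

theorem integrable_policy_mul_second_moment {q : Ctx d → Fin K → ℝ} (hq : Measurable q)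
    (hq1 : ∀ x, q x ∈ stdSimplex ℝ (Fin K)) (hD : ∀ᵐ x ∂D, ‖x‖ ≤ 1) (a : Fin K) (M : ℕ) :
    Integrable (fun y : Ctx d => q y a * ∫ z, ∫ x, q x a *
      (y.ofLp ⬝ᵥ (resampling q a z M *ᵥ x.ofLp)) ^ 2 ∂D
      ∂(Measure.infinitePi fun _ : ℕ => D.prod (volume : Measure unitInterval))) D := by
  have h := integrable_vecMul_quadratic_prod hq hq1 hD a M
  refine h.integral_prod_left.congr ?_
  filter_upwards [h.prod_right_ae] with y hy
  rw [integral_const_mul]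
  -- Fubini yields integrability only after multiplication by `q y a`; it can be divided out unless
  -- that weight is zero, when both sides vanish.
  rcases ((hq1 y).1 a).eq_or_lt with h0 | h0
  · simp [← h0]
  · congr 1
    refine integral_prod _ ?_
    exact (integrable_const_mul_iff (IsUnit.mk0 _ h0.ne') _).1 hy

/-- The second moment of the loss estimates. -/
theorem integral_estQuad_le (hlam : 0 < lam) (ht : 1 ≤ t) (htT : t ≤ T)
    (hD : ∀ᵐ x ∂D, ‖x‖ ≤ 1) (hl : LinearRound D ν (ℓ t) θ) (S : State d K) :
    ∫ r, ∫ y, estQuad T lam ℓ t y S r ∂D ∂(roundLaw D ν) ≤ 8 / 3 * (K * d) := by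
  have hq := measurable_policy_state (T := T) (lam := lam) (t := t) S
  have hq1 := policy_mem (d := d) (K := K) hlam ht htT S
  have hint := integrable_estQuad (T := T) hlam hD hl S
  have hpt : ∀ᵐ y ∂D, ∫ r, estQuad T lam ℓ t y S r ∂(roundLaw D ν) ≤
      ∑ a, 2 * (policy T lam t S y a * ∫ z, ∫ x, policy T lam t S x a *
        (y.ofLp ⬝ᵥ (resampling (policy T lam t S) a z (iterations T lam t S) *ᵥ x.ofLp)) ^ 2 ∂D
        ∂(Measure.infinitePi fun _ : ℕ => D.prod (volume : Measure unitInterval))) := by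
    filter_upwards [hD] with y hy
    unfold estQuad
    rw [integral_finsetSum _ fun a _ =>
      (integrable_inner_estimate_sq hlam hD hl S a hy).const_mul _]
    refine Finset.sum_le_sum fun a _ => ?_
    rw [integral_const_mul, ← mul_assoc]
    -- The factor `2` gained here, the `4d/3` per action and the `K` actions make up `8/3 · Kd`.
    exact mul_le_mul (predict_le_policy hlam ht htT S y a)
      (integral_inner_estimate_sq_le hlam ht htT hD hl S a hy)
      (integral_nonneg fun r => sq_nonneg _) (mul_nonneg zero_le_two ((hq1 y).1 a))
  rw [← integral_prod_symm _ hint, integral_prod _ hint]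
  have hquad := fun a => integrable_policy_mul_second_moment hq hq1 hD a (iterations T lam t S)
  have hmom := fun a => resampling_second_moment hq hq1 hD a (iterations T lam t S)
  refine (integral_mono_ae hint.integral_prod_left
    (integrable_finsetSum _ fun a _ => (hquad a).const_mul 2) hpt).trans ?_
  rw [integral_finsetSum _ fun a _ => (hquad a).const_mul 2]
  simp only [integral_const_mul]
  refine (Finset.sum_le_sum fun a _ => mul_le_mul_of_nonneg_left (hmom a) zero_le_two).trans
    (le_of_eq ?_)
  rw [Finset.sum_const, Finset.card_univ, Fintype.card_fin, nsmul_eq_mul]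
  ring

end RoundMoments

/-! ### Along a path -/

section Path

set_option linter.unusedSectionVars false

variable {d K T : ℕ} [NeZero K] {lam : ℝ} {W : Type*} [MeasurableSpace W] {ℓ : Loss d K W}

/-- Only the coordinates up to `n` influence the state, whence its independence of round `n + 1`. -/
theorem stateAfter_congr {ω ω' : ℕ → Round d W} {n : ℕ} (h : ∀ i ∈ Finset.range (n + 1), ω i = ω' i) :
    stateAfter T lam ℓ ω n = stateAfter T lam ℓ ω' n := by
  induction n with
  | zero => rfl
  | succ n ih =>
    rw [stateAfter, stateAfter, ih fun i hi => h i (by rw [Finset.mem_range] at *; omega),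
      h (n + 1) (by simp)]

/-- The entropy of the prediction in the context of round `n + 1`. -/
noncomputable def roundEntropy (T : ℕ) (lam : ℝ) (ℓ : Loss d K W) (ω : ℕ → Round d W) (n : ℕ) : ℝ :=
  entropy (predict T lam (stateAfter T lam ℓ ω n) (ω (n + 1)).1)

theorem roundEntropy_nonneg (ω : ℕ → Round d W) (n : ℕ) : 0 ≤ roundEntropy T lam ℓ ω n :=
  entropy_nonneg (predict_mem _ _)

theorem roundEntropy_le (ω : ℕ → Round d W) (n : ℕ) : roundEntropy T lam ℓ ω n ≤ Real.log K :=
  entropy_le_log (predict_mem _ _)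

theorem cumEntropy_stateAfter (ω : ℕ → Round d W) (n : ℕ) :
    (stateAfter T lam ℓ ω n).cumEntropy = ∑ s ∈ Finset.range n, roundEntropy T lam ℓ ω s := by
  induction n with
  | zero => rfl
  | succ n ih => rw [Finset.sum_range_succ, ← ih]; rfl

theorem cumEntropy_nonneg (ω : ℕ → Round d W) (n : ℕ) :
    0 ≤ (stateAfter T lam ℓ ω n).cumEntropy := by
  rw [cumEntropy_stateAfter]
  exact Finset.sum_nonneg fun s _ => roundEntropy_nonneg ω s

theorem cumEntropy_mono (ω : ℕ → Round d W) {m n : ℕ} (h : m ≤ n) :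
    (stateAfter T lam ℓ ω m).cumEntropy ≤ (stateAfter T lam ℓ ω n).cumEntropy := by
  rw [cumEntropy_stateAfter, cumEntropy_stateAfter]
  exact Finset.sum_le_sum_of_subset_of_nonneg (Finset.range_mono h)
    fun s _ _ => roundEntropy_nonneg ω s

theorem cumEntropy_le (ω : ℕ → Round d W) (n : ℕ) :
    (stateAfter T lam ℓ ω n).cumEntropy ≤ n * Real.log K := by
  rw [cumEntropy_stateAfter]
  refine (Finset.sum_le_sum fun s _ => roundEntropy_le ω s).trans ?_
  simp

/-- The increment of `β'` on reaching the state `S`. -/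
noncomputable def increment (T : ℕ) (lam : ℝ) (S : State d K) : ℝ :=
  c₁ d K T lam / √(1 + (Real.log K)⁻¹ * S.cumEntropy)

theorem beta'_succ (ω : ℕ → Round d W) (n : ℕ) :
    (stateAfter T lam ℓ ω (n + 1)).beta' =
      (stateAfter T lam ℓ ω n).beta' + increment T lam (stateAfter T lam ℓ ω (n + 1)) := rfl

theorem c₁_nonneg : 0 ≤ c₁ d K T lam := Real.sqrt_nonneg _

theorem increment_nonneg (S : State d K) : 0 ≤ increment T lam S :=
  div_nonneg c₁_nonneg (Real.sqrt_nonneg _)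

theorem one_le_sqrt (ω : ℕ → Round d W) (n : ℕ) :
    1 ≤ √(1 + (Real.log K)⁻¹ * (stateAfter T lam ℓ ω n).cumEntropy) := by
  rw [Real.one_le_sqrt]
  have := mul_nonneg (inv_nonneg.2 (Real.log_natCast_nonneg K))
    (cumEntropy_nonneg (T := T) (lam := lam) (ℓ := ℓ) ω n)
  linarith

theorem increment_le (ω : ℕ → Round d W) (n : ℕ) :
    increment T lam (stateAfter T lam ℓ ω n) ≤ c₁ d K T lam :=
  div_le_self c₁_nonneg (one_le_sqrt ω n)

theorem beta'_le (ω : ℕ → Round d W) (n : ℕ) :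
    (stateAfter T lam ℓ ω n).beta' ≤ c₁ d K T lam * (n + 1) := by
  induction n with
  | zero => simp [stateAfter, State.beta']
  | succ n ih =>
    rw [beta'_succ]
    have := increment_le (T := T) (lam := lam) (ℓ := ℓ) ω (n + 1)
    push_cast
    linarith

/-- The initial value and the `n` increments are `n + 1` contributions; as the cumulative entropy
grows, each is at least the value it would have at time `m`. -/
theorem le_beta' (ω : ℕ → Round d W) {n m : ℕ} (h : n ≤ m) :
    c₁ d K T lam * (n + 1) / √(1 + (Real.log K)⁻¹ * (stateAfter T lam ℓ ω m).cumEntropy) ≤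
      (stateAfter T lam ℓ ω n).beta' := by
  induction n with
  | zero =>
    simp only [stateAfter, State.beta', Nat.cast_zero, zero_add, mul_one]
    exact div_le_self c₁_nonneg (one_le_sqrt ω m)
  | succ n ih =>
    rw [beta'_succ]
    have h1 := ih (by omega)
    have h2 : c₁ d K T lam / √(1 + (Real.log K)⁻¹ * (stateAfter T lam ℓ ω m).cumEntropy) ≤
        increment T lam (stateAfter T lam ℓ ω (n + 1)) := by
      refine div_le_div_of_nonneg_left c₁_nonneg (zero_lt_one.trans_le (one_le_sqrt ω _))
        (Real.sqrt_le_sqrt ?_)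
      have := mul_le_mul_of_nonneg_left (cumEntropy_mono (T := T) (lam := lam) (ℓ := ℓ) ω h)
        (inv_nonneg.2 (Real.log_natCast_nonneg K))
      linarith
    have h3 : c₁ d K T lam * (((n + 1 : ℕ) : ℝ) + 1) /
        √(1 + (Real.log K)⁻¹ * (stateAfter T lam ℓ ω m).cumEntropy) =
        c₁ d K T lam * (n + 1) / √(1 + (Real.log K)⁻¹ * (stateAfter T lam ℓ ω m).cumEntropy) +
        c₁ d K T lam / √(1 + (Real.log K)⁻¹ * (stateAfter T lam ℓ ω m).cumEntropy) := by
      push_cast; ring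
    linarith

/-- A deterministic bound for `β` in the first `T` rounds. -/
noncomputable def betaBound (d K T : ℕ) (lam : ℝ) : ℝ :=
  max (max 2 (c₂ K lam * Real.log T)) (c₁ d K T lam * (T + 1))

theorem beta_le_betaBound (ω : ℕ → Round d W) {n : ℕ} (hn : n ≤ T) :
    beta T lam (stateAfter T lam ℓ ω n) ≤ betaBound d K T lam := by
  refine max_le_max le_rfl ((beta'_le ω n).trans ?_)
  have : (n : ℝ) ≤ T := by exact_mod_cast hn
  exact mul_le_mul_of_nonneg_left (by linarith) c₁_nonneg

theorem beta_mono (ω : ℕ → Round d W) (n : ℕ) :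
    beta T lam (stateAfter T lam ℓ ω n) ≤ beta T lam (stateAfter T lam ℓ ω (n + 1)) := by
  refine max_le_max le_rfl ?_
  rw [beta'_succ]
  linarith [increment_nonneg (T := T) (lam := lam) (stateAfter T lam ℓ ω (n + 1))]

/-- Taking the maximum with a constant is 1-Lipschitz. -/
theorem beta_sub_le (ω : ℕ → Round d W) (n : ℕ) :
    beta T lam (stateAfter T lam ℓ ω (n + 1)) - beta T lam (stateAfter T lam ℓ ω n) ≤
      increment T lam (stateAfter T lam ℓ ω (n + 1)) := by
  have h0 := increment_nonneg (T := T) (lam := lam) (stateAfter T lam ℓ ω (n + 1))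
  unfold beta
  rw [beta'_succ]
  generalize increment T lam (stateAfter T lam ℓ ω (n + 1)) = g at *
  have : max (max 2 (c₂ K lam * Real.log T)) ((stateAfter T lam ℓ ω n).beta' + g) ≤
      max (max 2 (c₂ K lam * Real.log T)) (stateAfter T lam ℓ ω n).beta' + g :=
    max_le (by linarith [le_max_left (max 2 (c₂ K lam * Real.log T)) (stateAfter T lam ℓ ω n).beta'])
      (by linarith [le_max_right (max 2 (c₂ K lam * Real.log T)) (stateAfter T lam ℓ ω n).beta'])
  linarith

/-- The penalty of the learning rate schedule along a path. -/
theorem sum_increment_mul_le (hK : 2 ≤ K) (ω : ℕ → Round d W) :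
    ∑ n ∈ Finset.range T, increment T lam (stateAfter T lam ℓ ω (n + 1)) *
        roundEntropy T lam ℓ ω (n + 1) ≤
      2 * c₁ d K T lam * √(Real.log K) *
        √(Real.log K + (stateAfter T lam ℓ ω T).cumEntropy) := by
  have hlog : 0 < Real.log K := Real.log_pos (by exact_mod_cast hK)
  have h1 := sum_div_sqrt_le (roundEntropy T lam ℓ ω) (roundEntropy_nonneg ω)
    (roundEntropy_le ω) T
  -- Clearing `log K` from under the root gives the form of `sum_div_sqrt_le` with `M = log K`, the
  -- uniform bound on the entropies.
  have h2 : ∀ n, increment T lam (stateAfter T lam ℓ ω (n + 1)) * roundEntropy T lam ℓ ω (n + 1) =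
      c₁ d K T lam * √(Real.log K) * (roundEntropy T lam ℓ ω (n + 1) /
        √(Real.log K + ∑ s ∈ Finset.range (n + 1), roundEntropy T lam ℓ ω s)) := by
    intro n
    rw [← cumEntropy_stateAfter]
    have h3 : 1 + (Real.log K)⁻¹ * (stateAfter T lam ℓ ω (n + 1)).cumEntropy =
        (Real.log K + (stateAfter T lam ℓ ω (n + 1)).cumEntropy) / Real.log K := by
      field_simp
    unfold increment
    have h4 := cumEntropy_nonneg (T := T) (lam := lam) (ℓ := ℓ) ω (n + 1)
    have h5 : 0 < √(Real.log K + (stateAfter T lam ℓ ω (n + 1)).cumEntropy) :=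
      Real.sqrt_pos.2 (by linarith)
    have h6 := Real.sqrt_pos.2 hlog
    rw [h3, Real.sqrt_div (by linarith)]
    field_simp
  simp only [h2]
  rw [← Finset.mul_sum]
  -- The sum reaches one round past the horizon; that last entropy is absorbed by `log K`.
  have h7 : √(∑ s ∈ Finset.range (T + 1), roundEntropy T lam ℓ ω s) ≤
      √(Real.log K + (stateAfter T lam ℓ ω T).cumEntropy) := by
    refine Real.sqrt_le_sqrt ?_
    rw [Finset.sum_range_succ, cumEntropy_stateAfter]
    linarith [roundEntropy_le (T := T) (lam := lam) (ℓ := ℓ) ω T]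
  have h8 : 0 ≤ c₁ d K T lam * √(Real.log K) := mul_nonneg c₁_nonneg (Real.sqrt_nonneg _)
  have h9 := mul_le_mul_of_nonneg_left (h1.trans (mul_le_mul_of_nonneg_left h7 zero_le_two)) h8
  refine h9.trans (le_of_eq (by ring))

/-- `le_beta'` with `m = T` makes `η_n` at most a path-dependent multiple of `1/(n + 1)`, and the
harmonic sum supplies `1 + log T`. -/
theorem sum_eta_le (hK : 2 ≤ K) (hc : 0 < c₁ d K T lam) (ω : ℕ → Round d W) :
    ∑ n ∈ Finset.range T, eta T lam (stateAfter T lam ℓ ω n) ≤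
      (1 + Real.log T) / (c₁ d K T lam * √(Real.log K)) *
        √(Real.log K + (stateAfter T lam ℓ ω T).cumEntropy) := by
  have hlog : 0 < Real.log K := Real.log_pos (by exact_mod_cast hK)
  have h4 := cumEntropy_nonneg (T := T) (lam := lam) (ℓ := ℓ) ω T
  have h3 : √(1 + (Real.log K)⁻¹ * (stateAfter T lam ℓ ω T).cumEntropy) =
      √(Real.log K + (stateAfter T lam ℓ ω T).cumEntropy) / √(Real.log K) := by
    rw [← Real.sqrt_div (by linarith)]
    congr 1
    field_simp
  have h5 : 0 < √(Real.log K + (stateAfter T lam ℓ ω T).cumEntropy) :=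
    Real.sqrt_pos.2 (by linarith)
  have h6 := Real.sqrt_pos.2 hlog
  have h1 : ∀ n ∈ Finset.range T, eta T lam (stateAfter T lam ℓ ω n) ≤
      √(Real.log K + (stateAfter T lam ℓ ω T).cumEntropy) / (c₁ d K T lam * √(Real.log K)) *
        (1 / ((n : ℝ) + 1)) := by
    intro n hn
    have h7 := (le_beta' (T := T) (lam := lam) (ℓ := ℓ) ω (Finset.mem_range.1 hn).le).trans
      (le_max_right (max 2 (c₂ K lam * Real.log T)) _)
    rw [h3] at h7
    unfold eta
    refine (one_div_le_one_div_of_le ?_ h7).trans (le_of_eq ?_)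
    · positivity
    · field_simp
  refine (Finset.sum_le_sum h1).trans ?_
  rw [← Finset.mul_sum]
  refine (mul_le_mul_of_nonneg_left (sum_one_div_succ_le T) (by positivity)).trans (le_of_eq ?_)
  ring

/-- The regret bound for the estimated losses along a path, in a fixed context. -/
theorem sum_estRegret_le (hlam : 0 < lam) {ω : ℕ → Round d W}
    (hω : ∀ n ∈ Finset.range T, GoodRound (ℓ (n + 1)) (ω (n + 1))) (π : Ctx d → Fin K)
    {y : Ctx d} (hy : ‖y‖ ≤ 1) :
    ∑ n ∈ Finset.range T, estRegret T lam ℓ π (n + 1) y (stateAfter T lam ℓ ω n) (ω (n + 1)) ≤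
      beta T lam (stateAfter T lam ℓ ω 0) * Real.log K +
      ∑ n ∈ Finset.range T, increment T lam (stateAfter T lam ℓ ω (n + 1)) *
        entropy (predict T lam (stateAfter T lam ℓ ω (n + 1)) y) +
      ∑ n ∈ Finset.range T, eta T lam (stateAfter T lam ℓ ω n) *
        estQuad T lam ℓ (n + 1) y (stateAfter T lam ℓ ω n) (ω (n + 1)) := by
  have h := exponential_weights_regret T (fun n => beta T lam (stateAfter T lam ℓ ω n))
    (fun n => beta_pos _) (beta_mono ω) (fun n a => ⟪y, (stateAfter T lam ℓ ω n).cumEst a⟫)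
    (fun n a => ⟪y, estimate T lam ℓ (n + 1) (stateAfter T lam ℓ ω n) (ω (n + 1)) a⟫)
    (by ext a; simp [stateAfter, State.cumEst])
    (by intro n; ext a; rw [Pi.add_apply, ← inner_add_right]; rfl)
    (fun n hn a => (hω n (Finset.mem_range.2 hn)).abs_inner_estimate_le hlam _ a hy) (π y)
  simp only [← predict_eq] at h
  have h1 : ∀ n, estRegret T lam ℓ π (n + 1) y (stateAfter T lam ℓ ω n) (ω (n + 1)) =
      ∑ a, predict T lam (stateAfter T lam ℓ ω n) y a *
        ⟪y, estimate T lam ℓ (n + 1) (stateAfter T lam ℓ ω n) (ω (n + 1)) a⟫ -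
      ⟪y, estimate T lam ℓ (n + 1) (stateAfter T lam ℓ ω n) (ω (n + 1)) (π y)⟫ := by
    intro n
    simp only [estRegret, sub_mul, Finset.sum_sub_distrib, Pi.single_apply, ite_mul, one_mul,
      zero_mul, Finset.sum_ite_eq', Finset.mem_univ, if_true]
  simp only [h1]
  have h2 : ∑ n ∈ Finset.range T, (beta T lam (stateAfter T lam ℓ ω (n + 1)) -
        beta T lam (stateAfter T lam ℓ ω n)) *
        entropy (predict T lam (stateAfter T lam ℓ ω (n + 1)) y) ≤
      ∑ n ∈ Finset.range T, increment T lam (stateAfter T lam ℓ ω (n + 1)) *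
        entropy (predict T lam (stateAfter T lam ℓ ω (n + 1)) y) :=
    Finset.sum_le_sum fun n _ => mul_le_mul_of_nonneg_right (beta_sub_le ω n)
      (entropy_nonneg (predict_mem _ _))
  refine h.trans ?_
  unfold estQuad eta
  linarith

end Path

/-! ### Taking expectations along a path -/

section Expectation

set_option linter.unusedSectionVars false

variable {d K T : ℕ} [NeZero K] {lam : ℝ} {W : Type*} [MeasurableSpace W]
  {D : Measure (Ctx d)} [IsProbabilityMeasure D] {ν : ℕ → Measure W}
  [∀ t, IsProbabilityMeasure (ν t)] {ℓ : Loss d K W} {θ : ℕ → Fin K → Ctx d} {π : Ctx d → Fin K}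

instance : IsProbabilityMeasure (pathLaw D ν) := by
  unfold pathLaw; infer_instance

/-- The state before a round is independent of the randomness of the round. -/
theorem map_state_round
    (hm : ∀ t ∈ Finset.Icc 1 T, ∀ a, Measurable fun p : W × Ctx d => ℓ t p.1 p.2 a)
    {n : ℕ} (hn : n ≤ T) :
    (pathLaw D ν).map (fun ω => (stateAfter T lam ℓ ω n, ω (n + 1))) =
      ((pathLaw D ν).map fun ω => stateAfter T lam ℓ ω n).prod (roundLaw D (ν (n + 1))) := by
  have hmeas := measurable_stateAfter (lam := lam) hm hn
  have hind : ProbabilityTheory.iIndepFun (fun (i : ℕ) (ω : ℕ → Round d W) => ω i)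
      (pathLaw D ν) :=
    ProbabilityTheory.iIndepFun_infinitePi (X := fun _ r => r) fun _ => measurable_id
  have h2 := hind.indepFun_finset (Finset.range (n + 1)) {n + 1}
    (by simp) fun i => measurable_pi_apply i
  -- Extends a finite initial segment to a path; the filling by coordinate `0` is immaterial, since
  -- the state ignores later coordinates.
  set e : (Finset.range (n + 1) → Round d W) → ℕ → Round d W := fun x i =>
    if h : i ∈ Finset.range (n + 1) then x ⟨i, h⟩ else x ⟨0, by simp⟩ with he
  have hem : Measurable e := by
    refine measurable_pi_lambda _ fun i => ?_
    simp only [he]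
    split_ifs <;> exact measurable_pi_apply _
  have h3 := h2.comp (hmeas.comp hem) (measurable_pi_apply
    (X := fun _ : ({n + 1} : Finset ℕ) => Round d W) ⟨n + 1, by simp⟩)
  have h4 : (fun ω => stateAfter T lam ℓ ω n) = ((fun ω => stateAfter T lam ℓ ω n) ∘ e) ∘
      fun (ω : ℕ → Round d W) (i : Finset.range (n + 1)) => ω i := by
    ext1 ω
    refine stateAfter_congr fun i hi => ?_
    simp only [he, dif_pos hi]
  have h5 : (fun ω : ℕ → Round d W => ω (n + 1)) =
      (fun x : ({n + 1} : Finset ℕ) → Round d W => x ⟨n + 1, by simp⟩) ∘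
        fun ω i => ω i := rfl
  rw [← h4, ← h5] at h3
  rw [h3.map_prod_eq_prod_map_map hmeas.aemeasurable (measurable_pi_apply _).aemeasurable]
  congr 1
  exact Measure.infinitePi_map_eval _ _

/-- Fubini for the independent pair of state and next round. Boundedness is required only almost
surely along the path, because `β` has no uniform bound over arbitrary states. -/
theorem integrable_and_integral_state_round
    (hm : ∀ t ∈ Finset.Icc 1 T, ∀ a, Measurable fun p : W × Ctx d => ℓ t p.1 p.2 a)
    {n : ℕ} (hn : n ≤ T) {F : State d K → Round d W → ℝ}
    (hF : Measurable fun p : State d K × Round d W => F p.1 p.2) {C : ℝ}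
    (hC : ∀ᵐ ω ∂(pathLaw D ν), |F (stateAfter T lam ℓ ω n) (ω (n + 1))| ≤ C) :
    Integrable (fun ω => F (stateAfter T lam ℓ ω n) (ω (n + 1))) (pathLaw D ν) ∧
    Integrable (fun ω => ∫ r, F (stateAfter T lam ℓ ω n) r ∂(roundLaw D (ν (n + 1))))
      (pathLaw D ν) ∧
    ∫ ω, F (stateAfter T lam ℓ ω n) (ω (n + 1)) ∂(pathLaw D ν) =
      ∫ ω, ∫ r, F (stateAfter T lam ℓ ω n) r ∂(roundLaw D (ν (n + 1))) ∂(pathLaw D ν) := by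
  have hmeas := measurable_stateAfter (lam := lam) hm hn
  have hpair : Measurable fun ω : ℕ → Round d W => (stateAfter T lam ℓ ω n, ω (n + 1)) :=
    hmeas.prodMk (measurable_pi_apply _)
  have hint : Integrable (fun ω => F (stateAfter T lam ℓ ω n) (ω (n + 1))) (pathLaw D ν) :=
    Integrable.of_bound (hF.comp hpair).aestronglyMeasurable C hC
  have hmap := map_state_round (D := D) (ν := ν) (lam := lam) hm hn
  have hint2 : Integrable (fun p : State d K × Round d W => F p.1 p.2)
      (((pathLaw D ν).map fun ω => stateAfter T lam ℓ ω n).prod (roundLaw D (ν (n + 1)))) := by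
    rw [← hmap]
    exact (integrable_map_measure hF.aestronglyMeasurable hpair.aemeasurable).2 hint
  have : IsProbabilityMeasure ((pathLaw D ν).map fun ω => stateAfter T lam ℓ ω n) :=
    Measure.isProbabilityMeasure_map hmeas.aemeasurable
  have h1 := hint2.integral_prod_left
  refine ⟨hint, (integrable_map_measure h1.aestronglyMeasurable hmeas.aemeasurable).1 h1, ?_⟩
  have h2 := integral_prod _ hint2
  rw [← hmap, integral_map hpair.aemeasurable hF.aestronglyMeasurable,
    integral_map hmeas.aemeasurable h1.aestronglyMeasurable] at h2
  exact h2

theorem ae_path_good (hD : ∀ᵐ x ∂D, ‖x‖ ≤ 1)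
    (hl : ∀ t ∈ Finset.Icc 1 T, LinearRound D (ν t) (ℓ t) (θ t)) :
    ∀ᵐ ω ∂(pathLaw D ν), ∀ n ∈ Finset.range T, GoodRound (ℓ (n + 1)) (ω (n + 1)) := by
  refine (ae_ball_iff (Finset.range T).countable_toSet).2 fun n hn => ?_
  have h := ae_goodRound (t := n + 1) hD (hl (n + 1) (by
    rw [Finset.mem_coe, Finset.mem_range] at hn; rw [Finset.mem_Icc]; omega))
  exact (measurePreserving_eval_infinitePi (fun t => roundLaw D (ν t))
    (n + 1)).quasiMeasurePreserving.ae h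

theorem pathRegret_eq (ω : ℕ → Round d W) :
    pathRegret T lam ℓ π ω = ∑ n ∈ Finset.range T,
      roundRegret T lam ℓ π (n + 1) (stateAfter T lam ℓ ω n) (ω (n + 1)) := by
  have h := Finset.sum_Ico_add' (fun t => roundRegret T lam ℓ π t
    (stateAfter T lam ℓ ω (t - 1)) (ω t)) 0 T 1
  simp only [Nat.add_sub_cancel] at h
  rw [Finset.range_eq_Ico, h]
  rfl

theorem mem_Icc_of_mem_range {n : ℕ} (hn : n ∈ Finset.range T) : n + 1 ∈ Finset.Icc 1 T := by
  rw [Finset.mem_range] at hn; rw [Finset.mem_Icc]; omega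

theorem integral_roundRegret_path (hD : ∀ᵐ x ∂D, ‖x‖ ≤ 1)
    (hl : ∀ t ∈ Finset.Icc 1 T, LinearRound D (ν t) (ℓ t) (θ t)) (hπ : Measurable π) {n : ℕ}
    (hn : n ∈ Finset.range T) :
    Integrable (fun ω => roundRegret T lam ℓ π (n + 1) (stateAfter T lam ℓ ω n) (ω (n + 1)))
      (pathLaw D ν) ∧
    Integrable (fun ω => ∫ r, roundRegret T lam ℓ π (n + 1) (stateAfter T lam ℓ ω n) r
      ∂(roundLaw D (ν (n + 1)))) (pathLaw D ν) ∧
    ∫ ω, roundRegret T lam ℓ π (n + 1) (stateAfter T lam ℓ ω n) (ω (n + 1)) ∂(pathLaw D ν) =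
      ∫ ω, ∫ r, roundRegret T lam ℓ π (n + 1) (stateAfter T lam ℓ ω n) r
        ∂(roundLaw D (ν (n + 1))) ∂(pathLaw D ν) :=
  integrable_and_integral_state_round (fun t ht => (hl t ht).meas) (Finset.mem_range.1 hn).le
    (measurable_roundRegret (hl _ (mem_Icc_of_mem_range hn)) hπ) (C := 2)
    ((ae_path_good hD hl).mono fun _ hω => (hω n hn).abs_roundRegret_le _)

theorem integrable_pathRegret (hD : ∀ᵐ x ∂D, ‖x‖ ≤ 1)
    (hl : ∀ t ∈ Finset.Icc 1 T, LinearRound D (ν t) (ℓ t) (θ t)) (hπ : Measurable π) :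
    Integrable (pathRegret T lam ℓ π) (pathLaw D ν) := by
  have h : pathRegret T lam ℓ π = fun ω => ∑ n ∈ Finset.range T,
      roundRegret T lam ℓ π (n + 1) (stateAfter T lam ℓ ω n) (ω (n + 1)) :=
    funext pathRegret_eq
  rw [h]
  exact integrable_finsetSum _ fun n hn => (integral_roundRegret_path hD hl hπ hn).1

/-- The trivial bound covers short horizons, where the `c₂` contribution exceeds the square root
rate. -/
theorem integral_pathRegret_le_two_mul (hD : ∀ᵐ x ∂D, ‖x‖ ≤ 1)
    (hl : ∀ t ∈ Finset.Icc 1 T, LinearRound D (ν t) (ℓ t) (θ t)) (hπ : Measurable π) :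
    ∫ ω, pathRegret T lam ℓ π ω ∂(pathLaw D ν) ≤ 2 * T := by
  have h : ∫ ω, pathRegret T lam ℓ π ω ∂(pathLaw D ν) ≤ ∫ _, 2 * (T : ℝ) ∂(pathLaw D ν) := by
    refine integral_mono_ae (integrable_pathRegret hD hl hπ) (integrable_const _) ?_
    filter_upwards [ae_path_good hD hl] with ω hω
    rw [pathRegret_eq]
    refine (Finset.sum_le_sum fun n hn =>
      (abs_le.1 ((hω n hn).abs_roundRegret_le (stateAfter T lam ℓ ω n))).2).trans ?_
    simp [mul_comm]
  simpa using h

theorem measurable_integral_fst {f : Ctx d → State d K → Round d W → ℝ}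
    (hf : Measurable fun p : Ctx d × (State d K × Round d W) => f p.1 p.2.1 p.2.2) :
    Measurable fun p : State d K × Round d W => ∫ y, f y p.1 p.2 ∂D :=
  (hf.stronglyMeasurable.integral_prod_left' (μ := D)).measurable

theorem integral_estRegret_path (hlam : 0 < lam) (hD : ∀ᵐ x ∂D, ‖x‖ ≤ 1)
    (hl : ∀ t ∈ Finset.Icc 1 T, LinearRound D (ν t) (ℓ t) (θ t)) (hπ : Measurable π) {n : ℕ}
    (hn : n ∈ Finset.range T) :
    Integrable (fun ω => ∫ y, estRegret T lam ℓ π (n + 1) y (stateAfter T lam ℓ ω n)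
      (ω (n + 1)) ∂D) (pathLaw D ν) ∧
    Integrable (fun ω => ∫ r, ∫ y, estRegret T lam ℓ π (n + 1) y (stateAfter T lam ℓ ω n) r ∂D
      ∂(roundLaw D (ν (n + 1)))) (pathLaw D ν) ∧
    ∫ ω, ∫ y, estRegret T lam ℓ π (n + 1) y (stateAfter T lam ℓ ω n) (ω (n + 1)) ∂D
        ∂(pathLaw D ν) =
      ∫ ω, ∫ r, ∫ y, estRegret T lam ℓ π (n + 1) y (stateAfter T lam ℓ ω n) r ∂D
        ∂(roundLaw D (ν (n + 1))) ∂(pathLaw D ν) := by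
  refine integrable_and_integral_state_round (fun t ht => (hl t ht).meas)
    (Finset.mem_range.1 hn).le
    (F := fun S r => ∫ y, estRegret T lam ℓ π (n + 1) y S r ∂D)
    (measurable_integral_fst (measurable_estRegret (hl _ (mem_Icc_of_mem_range hn)) hπ))
    (C := 2 * betaBound d K T lam) ?_
  filter_upwards [ae_path_good hD hl] with ω hω
  have hb := beta_le_betaBound (lam := lam) (ℓ := ℓ) ω (Finset.mem_range.1 hn).le
  have h := norm_integral_le_of_norm_le_const (μ := D) (C := 2 * betaBound d K T lam)
    (f := fun y => estRegret T lam ℓ π (n + 1) y (stateAfter T lam ℓ ω n) (ω (n + 1)))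
    (hD.mono fun y hy => ((hω n hn).abs_estRegret_le hlam _ hy).trans (by linarith))
  simpa using h

theorem integral_estQuad_path (hlam : 0 < lam) (hD : ∀ᵐ x ∂D, ‖x‖ ≤ 1)
    (hl : ∀ t ∈ Finset.Icc 1 T, LinearRound D (ν t) (ℓ t) (θ t)) {n : ℕ}
    (hn : n ∈ Finset.range T) :
    Integrable (fun ω => eta T lam (stateAfter T lam ℓ ω n) *
      ∫ y, estQuad T lam ℓ (n + 1) y (stateAfter T lam ℓ ω n) (ω (n + 1)) ∂D) (pathLaw D ν) ∧
    Integrable (fun ω => ∫ r, eta T lam (stateAfter T lam ℓ ω n) *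
      ∫ y, estQuad T lam ℓ (n + 1) y (stateAfter T lam ℓ ω n) r ∂D
      ∂(roundLaw D (ν (n + 1)))) (pathLaw D ν) ∧
    ∫ ω, eta T lam (stateAfter T lam ℓ ω n) *
      ∫ y, estQuad T lam ℓ (n + 1) y (stateAfter T lam ℓ ω n) (ω (n + 1)) ∂D ∂(pathLaw D ν) =
      ∫ ω, ∫ r, eta T lam (stateAfter T lam ℓ ω n) *
        ∫ y, estQuad T lam ℓ (n + 1) y (stateAfter T lam ℓ ω n) r ∂D
        ∂(roundLaw D (ν (n + 1))) ∂(pathLaw D ν) := by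
  refine integrable_and_integral_state_round (fun t ht => (hl t ht).meas)
    (Finset.mem_range.1 hn).le
    (F := fun S r => eta T lam S * ∫ y, estQuad T lam ℓ (n + 1) y S r ∂D)
    ((measurable_eta.comp measurable_fst).mul
      (measurable_integral_fst (measurable_estQuad (hl _ (mem_Icc_of_mem_range hn)))))
    (C := betaBound d K T lam) ?_
  filter_upwards [ae_path_good hD hl] with ω hω
  have hb := beta_le_betaBound (lam := lam) (ℓ := ℓ) ω (Finset.mem_range.1 hn).le
  set S := stateAfter T lam ℓ ω n with hS
  have h := norm_integral_le_of_norm_le_const (μ := D) (C := beta T lam S ^ 2)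
    (f := fun y => estQuad T lam ℓ (n + 1) y S (ω (n + 1)))
    (hD.mono fun y hy => (hω n hn).abs_estQuad_le hlam _ hy)
  rw [probReal_univ, mul_one, Real.norm_eq_abs] at h
  rw [abs_mul, abs_of_pos (eta_pos S)]
  have h2 := mul_le_mul_of_nonneg_left h (eta_pos (T := T) (lam := lam) S).le
  -- One factor `β` cancels against `η`.
  have h3 : eta T lam S * beta T lam S ^ 2 = beta T lam S := by
    have := (beta_pos (T := T) (lam := lam) S).ne'
    unfold eta; field_simp
  linarith

/-- The state after `n + 1` rounds is independent of the next context, so in expectation the ghost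
entropy may be replaced by the observed one, the quantity the schedule adapts to. -/
theorem integrable_increment_mul (hm : ∀ t ∈ Finset.Icc 1 T, ∀ a,
      Measurable fun p : W × Ctx d => ℓ t p.1 p.2 a) {n : ℕ} (hn : n < T) :
    Integrable (fun ω => increment T lam (stateAfter T lam ℓ ω (n + 1)) *
      roundEntropy T lam ℓ ω (n + 1)) (pathLaw D ν) ∧
    Integrable (fun ω => increment T lam (stateAfter T lam ℓ ω (n + 1)) *
      ∫ y, entropy (predict T lam (stateAfter T lam ℓ ω (n + 1)) y) ∂D) (pathLaw D ν) ∧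
    ∫ ω, increment T lam (stateAfter T lam ℓ ω (n + 1)) *
      roundEntropy T lam ℓ ω (n + 1) ∂(pathLaw D ν) =
    ∫ ω, increment T lam (stateAfter T lam ℓ ω (n + 1)) *
      ∫ y, entropy (predict T lam (stateAfter T lam ℓ ω (n + 1)) y) ∂D ∂(pathLaw D ν) := by
  have hme : Measurable fun p : State d K × Round d W => entropy (predict T lam p.1 p.2.1) :=
    measurable_entropy.comp (measurable_predict_comp measurable_fst
      (measurable_fst.comp measurable_snd))
  have hmi : Measurable fun p : State d K × Round d W => increment T lam p.1 := by
    have h1 : Measurable fun p : State d K × Round d W => p.1.cumEntropy :=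
      measurable_fst.comp (measurable_snd.comp measurable_fst)
    exact measurable_const.div (Real.continuous_sqrt.measurable.comp
      (measurable_const.add (measurable_const.mul h1)))
  have h := integrable_and_integral_state_round (D := D) (ν := ν) (lam := lam) hm
    (n := n + 1) hn (F := fun S r => increment T lam S * entropy (predict T lam S r.1))
    (hmi.mul hme) (C := c₁ d K T lam * Real.log K) (Filter.Eventually.of_forall fun ω => by
      rw [abs_of_nonneg (mul_nonneg (increment_nonneg _) (entropy_nonneg (predict_mem _ _)))]
      exact mul_le_mul (increment_le ω _) (entropy_le_log (predict_mem _ _))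
        (entropy_nonneg (predict_mem _ _)) c₁_nonneg)
  have h2 : ∀ S : State d K, ∫ r, increment T lam S * entropy (predict T lam S r.1)
      ∂(roundLaw D (ν (n + 1 + 1))) = increment T lam S * ∫ y, entropy (predict T lam S y) ∂D := by
    intro S
    rw [integral_const_mul]
    congr 1
    unfold roundLaw
    rw [integral_fun_fst (fun y => entropy (predict T lam S y))]
    simp
  simp only [h2] at h
  exact h

end Expectation

/-! ### The regret bound in terms of the expected cumulative entropy -/

section Master

set_option linter.unusedSectionVars false

variable {d K T : ℕ} [NeZero K] {lam : ℝ} {W : Type*} [MeasurableSpace W]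
  {D : Measure (Ctx d)} [IsProbabilityMeasure D] {ν : ℕ → Measure W}
  [∀ t, IsProbabilityMeasure (ν t)] {ℓ : Loss d K W} {θ : ℕ → Fin K → Ctx d} {π : Ctx d → Fin K}

theorem integrable_estRegret_context (hlam : 0 < lam) (hD : ∀ᵐ x ∂D, ‖x‖ ≤ 1) {t : ℕ}
    (hl : LinearRound D (ν t) (ℓ t) (θ t)) (hπ : Measurable π) (S : State d K) {r : Round d W}
    (hr : GoodRound (ℓ t) r) : Integrable (fun y => estRegret T lam ℓ π t y S r) D := by
  have hm : Measurable fun y => estRegret T lam ℓ π t y S r := by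
    have h := (measurable_estRegret (T := T) (lam := lam) hl hπ).comp
      (measurable_id.prodMk (measurable_const (a := (S, r))))
    simpa only [Function.comp_def, id] using h
  exact Integrable.of_bound hm.aestronglyMeasurable (2 * beta T lam S)
    (hD.mono fun y hy => hr.abs_estRegret_le hlam S hy)

theorem integrable_estQuad_context (hlam : 0 < lam) (hD : ∀ᵐ x ∂D, ‖x‖ ≤ 1) {t : ℕ}
    (hl : LinearRound D (ν t) (ℓ t) (θ t)) (S : State d K) {r : Round d W}
    (hr : GoodRound (ℓ t) r) : Integrable (fun y => estQuad T lam ℓ t y S r) D := by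
  have hm : Measurable fun y => estQuad T lam ℓ t y S r := by
    have h := (measurable_estQuad (T := T) (lam := lam) hl).comp
      (measurable_id.prodMk (measurable_const (a := (S, r))))
    simpa only [Function.comp_def, id] using h
  exact Integrable.of_bound hm.aestronglyMeasurable (beta T lam S ^ 2)
    (hD.mono fun y hy => hr.abs_estQuad_le hlam S hy)

theorem integrable_entropy_context (S : State d K) :
    Integrable (fun y => entropy (predict T lam S y)) D :=
  Integrable.of_bound (measurable_entropy.comp (measurable_predict_state S)).aestronglyMeasurable
    (Real.log K) (Filter.Eventually.of_forall fun y => by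
      rw [Real.norm_eq_abs, abs_of_nonneg (entropy_nonneg (predict_mem _ _))]
      exact entropy_le_log (predict_mem _ _))

theorem sum_integral_estRegret_le (hlam : 0 < lam) (hD : ∀ᵐ x ∂D, ‖x‖ ≤ 1)
    (hl : ∀ t ∈ Finset.Icc 1 T, LinearRound D (ν t) (ℓ t) (θ t)) (hπ : Measurable π)
    {ω : ℕ → Round d W} (hω : ∀ n ∈ Finset.range T, GoodRound (ℓ (n + 1)) (ω (n + 1))) :
    ∑ n ∈ Finset.range T, ∫ y, estRegret T lam ℓ π (n + 1) y (stateAfter T lam ℓ ω n)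
        (ω (n + 1)) ∂D ≤
      beta T lam (stateAfter T lam ℓ ω 0) * Real.log K +
      ∑ n ∈ Finset.range T, increment T lam (stateAfter T lam ℓ ω (n + 1)) *
        ∫ y, entropy (predict T lam (stateAfter T lam ℓ ω (n + 1)) y) ∂D +
      ∑ n ∈ Finset.range T, eta T lam (stateAfter T lam ℓ ω n) *
        ∫ y, estQuad T lam ℓ (n + 1) y (stateAfter T lam ℓ ω n) (ω (n + 1)) ∂D := by
  have h1 := fun n hn => integrable_estRegret_context (T := T) hlam hD
    (hl (n + 1) (mem_Icc_of_mem_range hn)) hπ (stateAfter T lam ℓ ω n) (hω n hn)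
  have h2 := fun n (_ : n ∈ Finset.range T) => (integrable_entropy_context (D := D) (T := T)
    (lam := lam) (stateAfter T lam ℓ ω (n + 1))).const_mul
      (increment T lam (stateAfter T lam ℓ ω (n + 1)))
  have h3 := fun n hn => (integrable_estQuad_context (T := T) hlam hD
    (hl (n + 1) (mem_Icc_of_mem_range hn)) (stateAfter T lam ℓ ω n) (hω n hn)).const_mul
      (eta T lam (stateAfter T lam ℓ ω n))
  have i2 := integrable_finsetSum _ h2
  have i3 := integrable_finsetSum _ h3
  have h := integral_mono_ae (integrable_finsetSum _ h1)
    (((integrable_const (beta T lam (stateAfter T lam ℓ ω 0) * Real.log K)).add i2).add i3)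
    (hD.mono fun y hy => sum_estRegret_le hlam hω π hy)
  have e1 := integral_finsetSum _ h1
  have e2 := integral_finsetSum _ h2
  have e3 := integral_finsetSum _ h3
  rw [integral_add' ((integrable_const _).add i2) i3, integral_add' (integrable_const _) i2,
    e1, e2, e3] at h
  simpa only [integral_const_mul, integral_const, probReal_univ, one_smul] using h

theorem measurable_cumEntropy_stateAfter
    (hm : ∀ t ∈ Finset.Icc 1 T, ∀ a, Measurable fun p : W × Ctx d => ℓ t p.1 p.2 a)
    {n : ℕ} (hn : n ≤ T) :
    Measurable fun ω : ℕ → Round d W => (stateAfter T lam ℓ ω n).cumEntropy :=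
  (measurable_fst.comp measurable_snd).comp (measurable_stateAfter (lam := lam) hm hn)

theorem integrable_cumEntropy
    (hm : ∀ t ∈ Finset.Icc 1 T, ∀ a, Measurable fun p : W × Ctx d => ℓ t p.1 p.2 a) :
    Integrable (fun ω => (stateAfter T lam ℓ ω T).cumEntropy) (pathLaw D ν) :=
  Integrable.of_bound (measurable_cumEntropy_stateAfter hm le_rfl).aestronglyMeasurable
    (T * Real.log K) (Filter.Eventually.of_forall fun ω => by
      rw [Real.norm_eq_abs, abs_of_nonneg (cumEntropy_nonneg _ _)]
      exact cumEntropy_le _ _)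

/-- Jensen's inequality, obtained by integrating `(√f - m)² ≥ 0` with `m` the mean of `√f`. -/
theorem integral_sqrt_le {Ω : Type*} [MeasurableSpace Ω] {μ : Measure Ω} [IsProbabilityMeasure μ]
    {f : Ω → ℝ} (hf : Integrable f μ) (h0 : ∀ ω, 0 ≤ f ω) :
    Integrable (fun ω => √(f ω)) μ ∧ ∫ ω, √(f ω) ∂μ ≤ √(∫ ω, f ω ∂μ) := by
  have hi : Integrable (fun ω => √(f ω)) μ := by
    refine ((integrable_const (1 : ℝ)).add hf).mono'
      (Real.continuous_sqrt.comp_aestronglyMeasurable hf.1) (Filter.Eventually.of_forall fun ω => ?_)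
    rw [Real.norm_eq_abs, abs_of_nonneg (Real.sqrt_nonneg _)]
    have := Real.sq_sqrt (h0 ω)
    show √(f ω) ≤ 1 + f ω
    nlinarith [sq_nonneg (√(f ω) - 1), Real.sqrt_nonneg (f ω)]
  refine ⟨hi, Real.le_sqrt_of_sq_le ?_⟩
  set m := ∫ ω, √(f ω) ∂μ with hm
  have h1 : ∫ ω, (2 * m * √(f ω) - m ^ 2) ∂μ ≤ ∫ ω, f ω ∂μ := by
    refine integral_mono ((hi.const_mul _).sub (integrable_const _)) hf fun ω => ?_
    have := Real.sq_sqrt (h0 ω)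
    show 2 * m * √(f ω) - m ^ 2 ≤ f ω
    nlinarith [sq_nonneg (√(f ω) - m)]
  rw [integral_sub (hi.const_mul _) (integrable_const _), integral_const_mul] at h1
  simp only [integral_const, probReal_univ, one_smul] at h1
  rw [← hm] at h1
  linarith

/-- The sum of the estimated regrets is controlled by the penalties and the learning rates. -/
theorem integral_pathRegret_le (hlam : 0 < lam) (hD : ∀ᵐ x ∂D, ‖x‖ ≤ 1)
    (hcov : ∀ u : Fin d → ℝ, lam * (u ⬝ᵥ u) ≤ ∫ x, (u ⬝ᵥ x.ofLp) ^ 2 ∂D)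
    (hl : ∀ t ∈ Finset.Icc 1 T, LinearRound D (ν t) (ℓ t) (θ t)) (hπ : Measurable π) :
    ∫ ω, pathRegret T lam ℓ π ω ∂(pathLaw D ν) ≤
      4 + max (max 2 (c₂ K lam * Real.log T)) (c₁ d K T lam) * Real.log K +
      ∫ ω, ∑ n ∈ Finset.range T, increment T lam (stateAfter T lam ℓ ω (n + 1)) *
        roundEntropy T lam ℓ ω (n + 1) ∂(pathLaw D ν) +
      (8 / 3 * (K * d) + 8 * K * Real.log T / lam) *
        ∫ ω, ∑ n ∈ Finset.range T, eta T lam (stateAfter T lam ℓ ω n) ∂(pathLaw D ν) := by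
  have hm := fun t ht => (hl t ht).meas
  have hη : ∀ n ∈ Finset.range T,
      Integrable (fun ω => eta T lam (stateAfter T lam ℓ ω n)) (pathLaw D ν) := fun n hn =>
    Integrable.of_bound ((measurable_eta.comp (measurable_stateAfter hm
      (Finset.mem_range.1 hn).le)).aestronglyMeasurable) 1 (Filter.Eventually.of_forall fun ω => by
        rw [Real.norm_eq_abs, abs_of_pos (eta_pos _)]
        unfold eta
        rw [div_le_one (beta_pos _)]
        linarith [two_le_beta (T := T) (lam := lam) (stateAfter T lam ℓ ω n)])
  -- The exploration cost `2γ_t` is at most `(8K log T/λ) η_t`, so it joins the stability term in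
  -- the coefficient of `∑ η_t`.
  have hround : ∀ n ∈ Finset.range T,
      ∫ ω, roundRegret T lam ℓ π (n + 1) (stateAfter T lam ℓ ω n) (ω (n + 1)) ∂(pathLaw D ν) ≤
      ∫ ω, ∫ y, estRegret T lam ℓ π (n + 1) y (stateAfter T lam ℓ ω n) (ω (n + 1)) ∂D
        ∂(pathLaw D ν) + 8 * K * Real.log T / lam *
        ∫ ω, eta T lam (stateAfter T lam ℓ ω n) ∂(pathLaw D ν) + 2 / ((n : ℝ) + 1) ^ 2 := by
    intro n hn
    obtain ⟨-, i1, e1⟩ := integral_roundRegret_path (lam := lam) hD hl hπ hn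
    obtain ⟨-, i2, e2⟩ := integral_estRegret_path hlam hD hl hπ hn
    rw [e1, e2]
    have hn1 := mem_Icc_of_mem_range hn
    have hn2 := Finset.mem_Icc.1 hn1
    have h := integral_mono i1 (((i2.add ((hη n hn).const_mul (8 * K * Real.log T / lam))).add
      (integrable_const (2 / ((n : ℝ) + 1) ^ 2)))) fun ω => by
        have h1 := integral_roundRegret_le hlam hn2.1 hn2.2 hD hcov (hl _ hn1) hπ
          (stateAfter T lam ℓ ω n)
        have h2 := gamma_le_eta hlam hn2.1 hn2.2 (stateAfter T lam ℓ ω n)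
        push_cast at h1
        simp only [Pi.add_apply]
        refine h1.trans ?_
        have h3 : 8 * K * Real.log T / lam * eta T lam (stateAfter T lam ℓ ω n) =
          2 * (4 * K * Real.log T / lam * eta T lam (stateAfter T lam ℓ ω n)) := by ring
        linarith
    refine h.trans (le_of_eq ?_)
    rw [integral_add' (i2.add ((hη n hn).const_mul _)) (integrable_const _),
      integral_add' i2 ((hη n hn).const_mul _), integral_const_mul]
    simp
  have hquad : ∀ n ∈ Finset.range T,
      ∫ ω, eta T lam (stateAfter T lam ℓ ω n) *
        ∫ y, estQuad T lam ℓ (n + 1) y (stateAfter T lam ℓ ω n) (ω (n + 1)) ∂D ∂(pathLaw D ν) ≤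
      8 / 3 * (K * d) * ∫ ω, eta T lam (stateAfter T lam ℓ ω n) ∂(pathLaw D ν) := by
    intro n hn
    obtain ⟨-, i1, e1⟩ := integral_estQuad_path hlam hD hl hn
    have hn1 := mem_Icc_of_mem_range hn
    have hn2 := Finset.mem_Icc.1 hn1
    rw [e1, ← integral_const_mul]
    refine integral_mono i1 ((hη n hn).const_mul _) fun ω => ?_
    have h1 := integral_estQuad_le hlam hn2.1 hn2.2 hD (hl _ hn1) (stateAfter T lam ℓ ω n)
    show ∫ r, _ ∂_ ≤ _
    rw [integral_const_mul, mul_comm]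
    exact mul_le_mul_of_nonneg_right h1 (eta_pos _).le
  have e0 : ∫ ω, pathRegret T lam ℓ π ω ∂(pathLaw D ν) = ∑ n ∈ Finset.range T,
      ∫ ω, roundRegret T lam ℓ π (n + 1) (stateAfter T lam ℓ ω n) (ω (n + 1)) ∂(pathLaw D ν) := by
    simp only [pathRegret_eq]
    exact integral_finsetSum _ fun n hn => (integral_roundRegret_path hD hl hπ hn).1
  have j1 := fun n hn => (integral_estRegret_path (lam := lam) (n := n) hlam hD hl hπ hn).1
  have j2 := fun n (hn : n ∈ Finset.range T) => integrable_increment_mul (D := D) (ν := ν)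
    (lam := lam) hm (Finset.mem_range.1 hn)
  have j3 := fun n hn => (integral_estQuad_path (lam := lam) (n := n) hlam hD hl hn).1
  have hest : ∑ n ∈ Finset.range T, ∫ ω, ∫ y, estRegret T lam ℓ π (n + 1) y
        (stateAfter T lam ℓ ω n) (ω (n + 1)) ∂D ∂(pathLaw D ν) ≤
      max (max 2 (c₂ K lam * Real.log T)) (c₁ d K T lam) * Real.log K +
      ∑ n ∈ Finset.range T, ∫ ω, increment T lam (stateAfter T lam ℓ ω (n + 1)) *
        roundEntropy T lam ℓ ω (n + 1) ∂(pathLaw D ν) +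
      ∑ n ∈ Finset.range T, ∫ ω, eta T lam (stateAfter T lam ℓ ω n) *
        ∫ y, estQuad T lam ℓ (n + 1) y (stateAfter T lam ℓ ω n) (ω (n + 1)) ∂D
          ∂(pathLaw D ν) := by
    have k2 := integrable_finsetSum _ fun n hn => (j2 n hn).2.1
    have k3 := integrable_finsetSum _ j3
    rw [← integral_finsetSum _ j1, ← integral_finsetSum _ j3,
      Finset.sum_congr rfl fun n hn => (j2 n hn).2.2,
      ← integral_finsetSum _ fun n hn => (j2 n hn).2.1]
    have h := integral_mono_ae (integrable_finsetSum _ j1)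
      (((integrable_const (max (max 2 (c₂ K lam * Real.log T)) (c₁ d K T lam) * Real.log K)).add k2).add k3)
      ((ae_path_good hD hl).mono fun ω hω => sum_integral_estRegret_le hlam hD hl hπ hω)
    refine h.trans (le_of_eq ?_)
    rw [integral_add' ((integrable_const _).add k2) k3, integral_add' (integrable_const _) k2]
    simp
  -- The total bias, source of the additive constant `4`.
  have hsq : ∑ n ∈ Finset.range T, 2 / ((n : ℝ) + 1) ^ 2 ≤ 4 := by
    have h := sum_one_div_succ_sq_le T
    have h2 : ∑ n ∈ Finset.range T, 2 / ((n : ℝ) + 1) ^ 2 =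
        2 * ∑ n ∈ Finset.range T, 1 / ((n : ℝ) + 1) ^ 2 := by
      rw [Finset.mul_sum]; exact Finset.sum_congr rfl fun n _ => by ring
    linarith
  have s1 := Finset.sum_le_sum hround
  have s2 := Finset.sum_le_sum hquad
  rw [Finset.sum_add_distrib, Finset.sum_add_distrib, ← Finset.mul_sum] at s1
  rw [← Finset.mul_sum] at s2
  rw [e0, integral_finsetSum _ hη, integral_finsetSum _ fun n hn => (j2 n hn).1]
  linarith

/-- The tuning of `c₁`: this product multiplies the penalty and divides the sum of learning rates,
so both terms end up of the same order. -/
theorem c₁_mul_sqrt_log (hlam : 0 < lam) (hK : 2 ≤ K) :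
    c₁ d K T lam * √(Real.log K) =
      √((3 * K * d + 2 * K * Real.log T / lam) * Real.log T) := by
  have hT := Real.log_natCast_nonneg T
  have hK : 0 < Real.log K := Real.log_pos (by exact_mod_cast hK)
  unfold c₁
  rw [← Real.sqrt_mul (by positivity)]
  congr 1
  field_simp

theorem log_natCast_ge {n : ℕ} (hn : 2 ≤ n) : 0.69 ≤ Real.log n := by
  have h := Real.log_le_log (by norm_num : (0 : ℝ) < 2) (by exact_mod_cast hn : (2 : ℝ) ≤ n)
  linarith [Real.log_two_gt_d9]

/-- The constant `13` is `2` from the penalty, `10` from stability and exploration, and `1` from the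
part `c₁` of the initial `β`. -/
theorem integral_pathRegret_le_sqrt (hd : 1 ≤ d) (hK : 2 ≤ K) (hT : 2 ≤ T) (hlam : 0 < lam)
    (hD : ∀ᵐ x ∂D, ‖x‖ ≤ 1)
    (hcov : ∀ u : Fin d → ℝ, lam * (u ⬝ᵥ u) ≤ ∫ x, (u ⬝ᵥ x.ofLp) ^ 2 ∂D)
    (hl : ∀ t ∈ Finset.Icc 1 T, LinearRound D (ν t) (ℓ t) (θ t)) (hπ : Measurable π) :
    ∫ ω, pathRegret T lam ℓ π ω ∂(pathLaw D ν) ≤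
      4 + 2 * Real.log K + 8 * (K * (Real.log T / lam) * Real.log K) +
      13 * (√((3 * K * d + 2 * K * Real.log T / lam) * Real.log T) *
        √(Real.log K + ∫ ω, (stateAfter T lam ℓ ω T).cumEntropy ∂(pathLaw D ν))) := by
  have hm := fun t ht => (hl t ht).meas
  have hk := log_natCast_ge hK
  have hlT := log_natCast_ge hT
  have hd' : (1 : ℝ) ≤ d := by exact_mod_cast hd
  have hK' : (2 : ℝ) ≤ K := by exact_mod_cast hK
  set k := Real.log K with hkdef
  set l := Real.log T with hldef
  set κ : ℝ := 3 * K * d + 2 * K * l / lam with hκ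
  have hκ0 : 0 < κ := by positivity
  set A := √(κ * l) with hA
  have hA0 : 0 < A := Real.sqrt_pos.2 (by positivity)
  have hA2 : A ^ 2 = κ * l := Real.sq_sqrt (by positivity)
  have hcA : c₁ d K T lam * √k = A := c₁_mul_sqrt_log hlam hK
  have hc0 : 0 < c₁ d K T lam := by
    rcases (c₁_nonneg (d := d) (K := K) (T := T) (lam := lam)).eq_or_lt with h | h
    · rw [← h, zero_mul] at hcA; exact absurd hcA hA0.ne
    · exact h
  have hce := integrable_cumEntropy (D := D) (ν := ν) (lam := lam) hm
  obtain ⟨hsi, hsq⟩ := integral_sqrt_le ((integrable_const k).add hce) fun ω =>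
    add_nonneg (by linarith) (cumEntropy_nonneg _ _)
  simp only [Pi.add_apply] at hsi hsq
  rw [integral_add (integrable_const _) hce] at hsq
  simp only [integral_const, probReal_univ, one_smul] at hsq
  set Y := k + ∫ ω, (stateAfter T lam ℓ ω T).cumEntropy ∂(pathLaw D ν) with hY
  have hkY : k ≤ Y := by
    have : 0 ≤ ∫ ω, (stateAfter T lam ℓ ω T).cumEntropy ∂(pathLaw D ν) :=
      integral_nonneg fun ω => cumEntropy_nonneg _ _
    linarith
  have h := integral_pathRegret_le hlam hD hcov hl hπ
  have h1 : ∫ ω, ∑ n ∈ Finset.range T, increment T lam (stateAfter T lam ℓ ω (n + 1)) *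
      roundEntropy T lam ℓ ω (n + 1) ∂(pathLaw D ν) ≤ 2 * A * √Y := by
    have := integral_mono (integrable_finsetSum _ fun n hn => (integrable_increment_mul (D := D)
      (ν := ν) (lam := lam) hm (Finset.mem_range.1 hn)).1)
      (hsi.const_mul (2 * c₁ d K T lam * √k)) fun ω => sum_increment_mul_le hK ω
    refine this.trans ?_
    rw [integral_const_mul, mul_assoc 2, hcA]
    exact mul_le_mul_of_nonneg_left hsq (by positivity)
  have h2 : ∫ ω, ∑ n ∈ Finset.range T, eta T lam (stateAfter T lam ℓ ω n) ∂(pathLaw D ν) ≤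
      (1 + l) / A * √Y := by
    have hm2 : Measurable fun ω : ℕ → Round d W =>
        ∑ n ∈ Finset.range T, eta T lam (stateAfter T lam ℓ ω n) :=
      Finset.measurable_sum _ fun n hn => measurable_eta.comp (measurable_stateAfter hm
        (Finset.mem_range.1 hn).le)
    have := integral_mono ((hsi.const_mul ((1 + l) / A)).mono' hm2.aestronglyMeasurable
      (Filter.Eventually.of_forall fun ω => by
        rw [Real.norm_eq_abs, abs_of_nonneg (Finset.sum_nonneg fun n _ => (eta_pos _).le), ← hcA]
        exact sum_eta_le hK hc0 ω))
      (hsi.const_mul ((1 + l) / A)) fun ω => by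
        rw [← hcA]
        exact sum_eta_le hK hc0 ω
    refine this.trans ?_
    rw [integral_const_mul]
    exact mul_le_mul_of_nonneg_left hsq (by positivity)
  have h3 : (8 / 3 * (K * d) + 8 * K * l / lam) * ((1 + l) / A * √Y) ≤ 10 * A * √Y := by
    have e1 : 8 / 3 * (K * d) + 8 * K * l / lam ≤ 4 * κ := by
      have : 4 * κ = 12 * (K * d) + 8 * K * l / lam := by rw [hκ]; ring
      have h0 : (0 : ℝ) ≤ K * d := by positivity
      linarith
    have e2 : 4 * κ * ((1 + l) / A * √Y) ≤ 10 * A * √Y := by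
      -- With `A² = κl` this reads `4(1 + l) ≤ 10l`, which holds because `l ≥ 0.69 > 2/3`.
      have e3 : 4 * κ * ((1 + l) / A) ≤ 10 * A := by
        rw [← mul_div_assoc, div_le_iff₀ hA0, mul_assoc 10, ← sq, hA2]
        nlinarith
      calc 4 * κ * ((1 + l) / A * √Y) = 4 * κ * ((1 + l) / A) * √Y := by ring
        _ ≤ _ := mul_le_mul_of_nonneg_right e3 (Real.sqrt_nonneg _)
    exact (mul_le_mul_of_nonneg_right e1 (by positivity)).trans e2
  have h4 : c₁ d K T lam * k ≤ A * √Y := by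
    have e1 : √k * √k = k := Real.mul_self_sqrt (by linarith)
    have e2 := mul_le_mul_of_nonneg_left (Real.sqrt_le_sqrt hkY) hA0.le
    rw [← hcA, mul_assoc, e1, hcA] at e2
    exact e2
  have h5 : max (max 2 (c₂ K lam * l)) (c₁ d K T lam) * k ≤
      2 * k + 8 * (K * (l / lam) * k) + A * √Y := by
    have e1 : max (max 2 (c₂ K lam * l)) (c₁ d K T lam) ≤ 2 + c₂ K lam * l + c₁ d K T lam := by
      have : 0 ≤ c₂ K lam * l := by unfold c₂; positivity
      exact max_le (max_le (by linarith) (by linarith)) (by linarith)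
    have e2 := mul_le_mul_of_nonneg_right e1 (by linarith : 0 ≤ k)
    have e3 : c₂ K lam * l * k = 8 * (K * (l / lam) * k) := by unfold c₂; ring
    rw [add_mul, add_mul, e3] at e2
    linarith
  have h6 := mul_le_mul_of_nonneg_left h2
    (by positivity : 0 ≤ 8 / 3 * ((K : ℝ) * d) + 8 * K * l / lam)
  linarith

end Master

/-! ### The regret controls the entropy in the presence of a gap -/

section SelfBounding

set_option linter.unusedSectionVars false

variable {d K T : ℕ} [NeZero K] {lam : ℝ} {W : Type*} [MeasurableSpace W]
  {D : Measure (Ctx d)} [IsProbabilityMeasure D] {ν : ℕ → Measure W}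
  [∀ t, IsProbabilityMeasure (ν t)] {ℓ : Loss d K W} {θ : ℕ → Fin K → Ctx d} {π : Ctx d → Fin K}

theorem sum_sub_single_mul {q : Fin K → ℝ} (hq : q ∈ stdSimplex ℝ (Fin K)) (b : Fin K)
    (f : Fin K → ℝ) : ∑ a, (q a - Pi.single (M := fun _ => ℝ) b 1 a) * f a =
      ∑ a, q a * (f a - f b) := by
  simp only [sub_mul, mul_sub, Finset.sum_sub_distrib, Pi.single_apply, ite_mul, one_mul,
      zero_mul, Finset.sum_ite_eq', Finset.mem_univ, if_true]
  rw [← Finset.sum_mul, hq.2, one_mul]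

/-- Mass off `b` pays at least `Δ` under the uncorrupted losses `g`; passing to `f` changes the
regret by at most `2δ`. -/
theorem gap_mul_le {q : Fin K → ℝ} (hq : q ∈ stdSimplex ℝ (Fin K)) (b : Fin K)
    {f g : Fin K → ℝ} {Δ δ : ℝ} (hΔ : ∀ a ≠ b, Δ ≤ g a - g b) (hδ : ∀ a, |f a - g a| ≤ δ) :
    Δ * (1 - q b) ≤ ∑ a, (q a - Pi.single (M := fun _ => ℝ) b 1 a) * f a + 2 * δ := by
  have h1 : Δ * (1 - q b) ≤ ∑ a, (q a - Pi.single (M := fun _ => ℝ) b 1 a) * g a := by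
    rw [sum_sub_single_mul hq, ← hq.2, ← Finset.add_sum_erase _ _ (Finset.mem_univ b),
      ← Finset.add_sum_erase _ (fun a => q a * (g a - g b)) (Finset.mem_univ b), sub_self, mul_zero,
      zero_add, add_sub_cancel_left, Finset.mul_sum]
    refine Finset.sum_le_sum fun a ha => ?_
    rw [mul_comm]
    exact mul_le_mul_of_nonneg_left (hΔ a (Finset.ne_of_mem_erase ha)) (hq.1 a)
  have h2 := (abs_le.1 (abs_sum_sub_mul_le hq (single_mem_stdSimplex ℝ b) hδ)).1
  have h3 : ∑ a, (q a - Pi.single (M := fun _ => ℝ) b 1 a) * (f a - g a) =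
      ∑ a, (q a - Pi.single (M := fun _ => ℝ) b 1 a) * f a -
      ∑ a, (q a - Pi.single (M := fun _ => ℝ) b 1 a) * g a := by
    rw [← Finset.sum_sub_distrib]; exact Finset.sum_congr rfl fun a _ => by ring
  linarith

/-- Mixing with the uniform distribution at rate at most `1/2` keeps at least half of the mass off
`a`. -/
theorem one_sub_predict_le (hlam : 0 < lam) {t : ℕ} (ht : 1 ≤ t) (htT : t ≤ T) (S : State d K)
    (x : Ctx d) (a : Fin K) :
    1 - predict T lam S x a ≤ 2 * (1 - policy T lam t S x a) := by
  have h1 := gamma_nonneg (T := T) (t := t) hlam S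
  have h2 := gamma_le_half hlam ht htT S
  have hp := predict_mem (T := T) (lam := lam) S x
  have h3 : predict T lam S x a ≤ 1 :=
    hp.2 ▸ Finset.single_le_sum (fun b _ => hp.1 b) (Finset.mem_univ a)
  have hK : (1 : ℝ) ≤ K := by exact_mod_cast Nat.pos_of_ne_zero (NeZero.ne K)
  have h4 : gamma T lam t S / K ≤ gamma T lam t S := div_le_self h1 hK
  unfold policy
  nlinarith

/-- Self-bounding in one round: entropy is controlled by the mass off the optimal action, and that
mass by regret through the gap. -/
theorem integral_entropy_le (hK : 2 ≤ K) (hT : 2 ≤ T) (hlam : 0 < lam) {t : ℕ} (ht : 1 ≤ t)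
    (htT : t ≤ T) (hD : ∀ᵐ x ∂D, ‖x‖ ≤ 1) (hl : LinearRound D (ν t) (ℓ t) (θ t))
    (hπ : Measurable π) {θ₀ : Fin K → Ctx d} {Δ δ : ℝ} (hΔ : 0 < Δ)
    (hgap : ∀ᵐ x ∂D, ∀ a ≠ π x, Δ ≤ ⟪x, θ₀ a - θ₀ (π x)⟫) (hδ : ∀ a, ‖θ t a - θ₀ a‖ ≤ δ)
    (S : State d K) :
    ∫ y, entropy (predict T lam S y) ∂D ≤ 2 * Real.log (K * T) / Δ *
      (∫ r, roundRegret T lam ℓ π t S r ∂(roundLaw D (ν t)) + 2 * δ) + 2 / T := by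
  have hL : 0 ≤ Real.log (K * T) := by exact_mod_cast Real.log_natCast_nonneg (K * T)
  have hint : Integrable (fun x => ∑ a, (policy T lam t S x a -
      Pi.single (M := fun _ => ℝ) (π x) 1 a) * ⟪x, θ t a⟫) D := by
    refine Integrable.of_bound (Finset.measurable_sum _ fun a _ =>
      (((measurable_pi_apply a).comp (measurable_policy_state S)).sub
        (measurable_single hπ a)).mul
        (measurable_id.inner measurable_const)).aestronglyMeasurable (2 * 1) ?_
    filter_upwards [hD] with x hx
    exact abs_sum_sub_mul_le (policy_mem hlam ht htT S x) (single_mem_stdSimplex ℝ (π x))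
      fun a => abs_inner_le_one hx (hl.norm_le a)
  rw [integral_roundRegret hlam ht htT hD hl hπ S]
  have h := integral_mono_ae (integrable_entropy_context (D := D) (T := T) (lam := lam) S)
    (((hint.add (integrable_const (2 * δ))).const_mul (2 * Real.log (K * T) / Δ)).add
      (integrable_const (2 / (T : ℝ)))) (by
    filter_upwards [hD, hgap] with x hx hgx
    have h1 := entropy_le_of_mode hK hT (predict_mem (T := T) (lam := lam) S x) (π x)
    have h2 := one_sub_predict_le hlam ht htT S x (π x)
    have h3 := gap_mul_le (policy_mem hlam ht htT S x) (π x) (f := fun a => ⟪x, θ t a⟫)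
      (g := fun a => ⟪x, θ₀ a⟫) (Δ := Δ) (δ := δ)
      (fun a ha => by rw [← inner_sub_right]; exact hgx a ha)
      (fun a => by
        rw [← inner_sub_right]
        refine (abs_real_inner_le_norm _ _).trans ?_
        exact (mul_le_of_le_one_left (norm_nonneg _) hx).trans (hδ a))
    simp only [Pi.add_apply]
    have h4 := mul_le_mul_of_nonneg_left h3 (by positivity : 0 ≤ 2 * Real.log (K * T) / Δ)
    have h5 : 2 * Real.log (K * T) / Δ * (Δ * (1 - policy T lam t S x (π x))) =
        2 * (1 - policy T lam t S x (π x)) * Real.log (K * T) := by field_simp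
    have h6 := mul_le_mul_of_nonneg_right h2 hL
    linarith)
  refine h.trans (le_of_eq ?_)
  rw [integral_add' ((hint.add (integrable_const _)).const_mul _) (integrable_const _),
    integral_const_mul, integral_add' hint (integrable_const _)]
  simp

theorem integral_cumEntropy_le (hK : 2 ≤ K) (hT : 2 ≤ T) (hlam : 0 < lam)
    (hD : ∀ᵐ x ∂D, ‖x‖ ≤ 1)
    (hl : ∀ t ∈ Finset.Icc 1 T, LinearRound D (ν t) (ℓ t) (θ t))
    (hπ : Measurable π) {θ₀ : Fin K → Ctx d} {Δ C : ℝ} {δ : ℕ → ℝ} (hΔ : 0 < Δ)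
    (hgap : ∀ᵐ x ∂D, ∀ a ≠ π x, Δ ≤ ⟪x, θ₀ a - θ₀ (π x)⟫)
    (hδ : ∀ t, ∀ a, ‖θ t a - θ₀ a‖ ≤ δ t)
    (hC : ∑ n ∈ Finset.range T, δ (n + 1) ≤ C) :
    ∫ ω, (stateAfter T lam ℓ ω T).cumEntropy ∂(pathLaw D ν) ≤ 2 * Real.log (K * T) / Δ *
      (∫ ω, pathRegret T lam ℓ π ω ∂(pathLaw D ν) + 2 * C) + 2 := by
  have hL : 0 ≤ Real.log (K * T) := by exact_mod_cast Real.log_natCast_nonneg (K * T)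
  have hT0 : (T : ℝ) ≠ 0 := by positivity
  have hm := fun t ht => (hl t ht).meas
  have hent : ∀ n ∈ Finset.range T,
      Integrable (fun ω => roundEntropy T lam ℓ ω n) (pathLaw D ν) ∧
      Integrable (fun ω => ∫ r, entropy (predict T lam (stateAfter T lam ℓ ω n) r.1)
        ∂(roundLaw D (ν (n + 1)))) (pathLaw D ν) ∧
      ∫ ω, roundEntropy T lam ℓ ω n ∂(pathLaw D ν) =
        ∫ ω, ∫ r, entropy (predict T lam (stateAfter T lam ℓ ω n) r.1)
          ∂(roundLaw D (ν (n + 1))) ∂(pathLaw D ν) := fun n hn =>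
    integrable_and_integral_state_round (D := D) (ν := ν) (lam := lam) hm
      (Finset.mem_range.1 hn).le (F := fun S r => entropy (predict T lam S r.1))
      (measurable_entropy.comp (measurable_predict_comp measurable_fst
        (measurable_fst.comp measurable_snd))) (C := Real.log K)
      (Filter.Eventually.of_forall fun ω => by
        rw [abs_of_nonneg (entropy_nonneg (predict_mem _ _))]
        exact entropy_le_log (predict_mem _ _))
  have hfst : ∀ (n : ℕ) (S : State d K), ∫ r, entropy (predict T lam S r.1)
      ∂(roundLaw D (ν (n + 1))) = ∫ y, entropy (predict T lam S y) ∂D := by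
    intro n S
    unfold roundLaw
    rw [integral_fun_fst (fun y => entropy (predict T lam S y))]
    simp
  simp only [hfst] at hent
  have hreg := fun n (hn : n ∈ Finset.range T) =>
    integral_roundRegret_path (lam := lam) hD hl hπ hn
  have hstep : ∀ n ∈ Finset.range T, ∫ ω, roundEntropy T lam ℓ ω n ∂(pathLaw D ν) ≤
      2 * Real.log (K * T) / Δ * (∫ ω, roundRegret T lam ℓ π (n + 1) (stateAfter T lam ℓ ω n)
        (ω (n + 1)) ∂(pathLaw D ν) + 2 * δ (n + 1)) + 2 / T := by
    intro n hn
    obtain ⟨-, i1, e1⟩ := hent n hn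
    obtain ⟨-, i2, e2⟩ := hreg n hn
    have hn1 := mem_Icc_of_mem_range hn
    have hn2 := Finset.mem_Icc.1 hn1
    rw [e1, e2]
    have h := integral_mono i1 (((i2.add (integrable_const (2 * δ (n + 1)))).const_mul
      (2 * Real.log (K * T) / Δ)).add (integrable_const (2 / (T : ℝ)))) fun ω =>
        integral_entropy_le hK hT hlam hn2.1 hn2.2 hD (hl _ hn1) hπ hΔ hgap (hδ _)
          (stateAfter T lam ℓ ω n)
    refine h.trans (le_of_eq ?_)
    rw [integral_add' ((i2.add (integrable_const _)).const_mul _) (integrable_const _),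
      integral_const_mul, integral_add' i2 (integrable_const _)]
    simp
  simp only [cumEntropy_stateAfter, pathRegret_eq]
  rw [integral_finsetSum _ fun n hn => (hent n hn).1,
    integral_finsetSum _ fun n hn => (hreg n hn).1]
  refine (Finset.sum_le_sum hstep).trans ?_
  rw [Finset.sum_add_distrib, ← Finset.mul_sum, Finset.sum_add_distrib, ← Finset.mul_sum,
    Finset.sum_const, Finset.card_range, nsmul_eq_mul, mul_div_cancel₀ _ hT0]
  have h := mul_le_mul_of_nonneg_left (mul_le_mul_of_nonneg_left hC zero_le_two)
    (by positivity : 0 ≤ 2 * Real.log (K * T) / Δ)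
  rw [mul_add, mul_add]
  linarith

end SelfBounding

/-! ### From the regret bounds to the rates -/

/-- All terms but `8Kvk` are directly at most multiples of `G`, the square root of the target. For
that term the trivial bound `2T` is needed when `Kvk` exceeds `T`. -/
theorem le_of_le_sqrt_horizon {R K d v k l T : ℝ} (hK : 2 ≤ K) (hd : 1 ≤ d) (hv : 0 ≤ v)
    (hk : 0.69 ≤ k) (hkK : k ≤ K) (hl : 0.69 ≤ l) (hT : 2 ≤ T) (hRT : R ≤ 2 * T)
    (hR : R ≤ 4 + 2 * k + 8 * (K * v * k) +
      13 * (√((3 * K * d + 2 * K * v) * l) * √(k + T * k))) :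
    R ≤ 60 * √(T * K * (d + v) * l * k) := by
  set g := T * K * (d + v) * l * k with hg
  have hg0 : 0 ≤ g := by positivity
  set G := √g with hG
  have hG0 : 0 ≤ G := Real.sqrt_nonneg _
  have hG2 : G ^ 2 = g := Real.sq_sqrt hg0
  have hTK : 4 ≤ T * K := by nlinarith
  have hlk : 0.47 ≤ l * k := by nlinarith
  have hsplit : g = T * K * d * (l * k) + T * (K * v * k) * l := by rw [hg]; ring
  have hvpart : 0 ≤ T * (K * v * k) * l := by positivity
  have hdpart : 2 * K * (l * k) ≤ T * K * d * (l * k) := by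
    refine mul_le_mul_of_nonneg_right ?_ (by linarith)
    have : 2 * K ≤ T * K := by nlinarith
    nlinarith
  have h1 : 1 ≤ G := by nlinarith
  have h2 : k ≤ G := by
    refine abs_le_of_sq_le_sq' ?_ hG0 |>.2
    have : k * k ≤ K * k := mul_le_mul_of_nonneg_right hkK (by linarith)
    nlinarith
  have h3 : √((3 * K * d + 2 * K * v) * l) * √(k + T * k) ≤ 2.5 * G := by
    rw [← Real.sqrt_mul (by positivity), Real.sqrt_le_left (by positivity), mul_pow, hG2]
    have e1 : 3 * K * d + 2 * K * v ≤ 3 * (K * (d + v)) := by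
      have : 0 ≤ K * v := by positivity
      linarith
    have e2 : k + T * k ≤ 1.5 * (T * k) := by nlinarith
    calc (3 * K * d + 2 * K * v) * l * (k + T * k)
        ≤ 3 * (K * (d + v)) * l * (1.5 * (T * k)) := by gcongr
      _ = 4.5 * g := by rw [hg]; ring
      _ ≤ 2.5 ^ 2 * g := by nlinarith
  -- The smaller of `T` and `Kvk` has square at most `T·Kvk`, which is at most `G²/0.69`; this
  -- explains `1.25`.
  rcases le_total (K * v * k) T with hu | hu
  · have h4 : K * v * k ≤ 1.25 * G := by
      refine abs_le_of_sq_le_sq' ?_ (by positivity) |>.2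
      have hu0 : 0 ≤ K * v * k := by positivity
      have e1 : (K * v * k) ^ 2 ≤ T * (K * v * k) := by nlinarith
      have e2 : 0.69 * (T * (K * v * k)) ≤ T * (K * v * k) * l := by
        rw [mul_comm]; exact mul_le_mul_of_nonneg_left hl (by positivity)
      have e3 : 0 ≤ T * K * d * (l * k) := by positivity
      nlinarith
    linarith
  · have h4 : T ≤ 1.25 * G := by
      refine abs_le_of_sq_le_sq' ?_ (by positivity) |>.2
      have e1 : T ^ 2 ≤ T * (K * v * k) := by nlinarith
      have e2 : 0.69 * (T * (K * v * k)) ≤ T * (K * v * k) * l := by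
        rw [mul_comm]; exact mul_le_mul_of_nonneg_left hl (by positivity)
      have e3 : 0 ≤ T * K * d * (l * k) := by positivity
      nlinarith
    linarith

/-- Substituting the entropy bound puts `R` under a square root; AM-GM returns half of `R`, which
moves to the left, and leaves `B` and `√(BC)`. -/
theorem le_of_le_sqrt_gap {R K d v k L l Δ C E : ℝ} (hK : 2 ≤ K) (hd : 1 ≤ d) (hv : 0 ≤ v)
    (hk : 0.69 ≤ k) (hkL : k ≤ L) (hL : 1.38 ≤ L) (hl : 0.69 ≤ l) (hΔ : 0 < Δ) (hΔ4 : Δ ≤ 4)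
    (hC : 0 ≤ C) (hE : E ≤ 2 * L / Δ * (R + 2 * C) + 2)
    (hR : R ≤ 4 + 2 * k + 8 * (K * v * k) +
      13 * (√((3 * K * d + 2 * K * v) * l) * √(k + E))) :
    R ≤ 2500 * (K * (d + v) * L * l / Δ + √(K * (d + v) * L * l / Δ * C)) := by
  set X := K * (d + v) with hX
  set B := X * L * l / Δ with hB
  have hX2 : 2 ≤ X := by nlinarith [mul_nonneg (by linarith : (0 : ℝ) ≤ K) hv]
  have hB0 : 0 ≤ B := by positivity
  have hBΔ : B * Δ = X * L * l := by rw [hB]; field_simp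
  set s := √(B * C) with hs
  have hs0 : 0 ≤ s := Real.sqrt_nonneg _
  have hs2 : s ^ 2 = B * C := Real.sq_sqrt (by positivity)
  rcases le_total R 0 with hR0 | hR0
  · linarith
  have hB4 : X * L * l ≤ 4 * B := by nlinarith
  have hLl : 0.69 * L ≤ L * l := by nlinarith
  have h1 : 2 * (L * l) ≤ X * L * l := by
    rw [mul_assoc]; exact mul_le_mul_of_nonneg_right hX2 (by positivity)
  have h2 : 0.69 * (X * L) ≤ X * L * l := by
    rw [mul_comm]; exact mul_le_mul_of_nonneg_left hl (by positivity)
  have h3 : K * v * k ≤ X * L := by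
    have e : K * v ≤ X := by nlinarith
    exact mul_le_mul e hkL (by linarith) (by linarith)
  -- `R/26` is chosen because `13/26 = 1/2`; in the squared right side `2·(1/26)·90` exceeds the
  -- coefficient `6` of `BR`, and `4²` exceeds the `12` of `BC`.
  have h4 : √((3 * K * d + 2 * K * v) * l) * √(k + E) ≤ R / 26 + 90 * B + 4 * s := by
    rw [← Real.sqrt_mul (by positivity), Real.sqrt_le_left (by positivity)]
    have e1 : 3 * K * d + 2 * K * v ≤ 3 * X := by
      have : 0 ≤ K * v := by positivity
      rw [hX]; linarith
    have e2 : k + E ≤ 3 * L + 2 * L / Δ * (R + 2 * C) := by linarith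
    have e3 : 0 ≤ 3 * L + 2 * L / Δ * (R + 2 * C) := by positivity
    have e4 : (3 * K * d + 2 * K * v) * l * (k + E) ≤
        3 * X * l * (3 * L + 2 * L / Δ * (R + 2 * C)) :=
      (mul_le_mul_of_nonneg_left e2 (by positivity)).trans
        (mul_le_mul_of_nonneg_right (mul_le_mul_of_nonneg_right e1 (by linarith)) e3)
    have e5 : 3 * X * l * (3 * L + 2 * L / Δ * (R + 2 * C)) =
        9 * (X * L * l) + 6 * (B * R) + 12 * (B * C) := by
      rw [hB]; field_simp; ring
    have e6 : X * L * l ≤ (4 * B) ^ 2 := by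
      have : 1 ≤ X * L * l := by nlinarith
      nlinarith
    have p1 : 0 ≤ B * R := by positivity
    have p2 : 0 ≤ R * s := by positivity
    have p3 : 0 ≤ B * s := by positivity
    rw [e5] at e4
    nlinarith [sq_nonneg R, sq_nonneg B]
  linarith

/-- When corruption is at least of order `TΔ`, substituting `T ≤ 4C/Δ` in the adversarial rate
already gives the corruption term. -/
theorem le_of_gap_large {R X k L l Δ C T : ℝ} (hX : 0 ≤ X) (hk : 0 ≤ k) (hkL : k ≤ L)
    (hl : 0 ≤ l) (hT : 0 ≤ T) (hΔ : 0 < Δ) (hTC : T * Δ ≤ 4 * C)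
    (hR : R ≤ 60 * √(T * X * l * k)) : R ≤ 120 * √(X * L * l / Δ * C) := by
  have h : √(T * X * l * k) ≤ 2 * √(X * L * l / Δ * C) := by
    have e : T * X * l * k ≤ 2 ^ 2 * (X * L * l / Δ * C) := by
      have e1 : T ≤ 4 * C / Δ := by rwa [le_div_iff₀ hΔ]
      have : 0 ≤ L := hk.trans hkL
      have := hT.trans e1
      calc T * X * l * k = T * (X * l * k) := by ring
        _ ≤ 4 * C / Δ * (X * l * L) := by gcongr
        _ = _ := by ring
    have := Real.sqrt_le_sqrt e
    rwa [Real.sqrt_mul (by norm_num : (0 : ℝ) ≤ 2 ^ 2), Real.sqrt_sq zero_le_two] at this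
  linarith

/-! ### The two regimes -/

section Regimes

set_option linter.unusedSectionVars false

variable {d K T : ℕ} [NeZero K] {W : Type*} [MeasurableSpace W]
  {D : Measure (Ctx d)} [IsProbabilityMeasure D] {ν : ℕ → Measure W}
  [∀ t, IsProbabilityMeasure (ν t)] {ℓ : Loss d K W} {θ : ℕ → Fin K → Ctx d} {π : Ctx d → Fin K}

theorem integral_dotProduct_sq (hD : ∀ᵐ x ∂D, ‖x‖ ≤ 1) (u : Fin d → ℝ) :
    u ⬝ᵥ (secondMoment D *ᵥ u) = ∫ x, (u ⬝ᵥ x.ofLp) ^ 2 ∂D := by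
  have hi : ∀ i j, Integrable (fun x : Ctx d => u i * (x i * x j * u j)) D := by
    intro i j
    have hm : Measurable fun x : Ctx d => x i * x j := by fun_prop
    refine Integrable.const_mul (Integrable.mul_const
      (Integrable.of_bound hm.aestronglyMeasurable 1 ?_) _) _
    filter_upwards [hD] with x hx
    have h := fun i => (PiLp.norm_apply_le x i).trans hx
    rw [norm_mul]
    exact mul_le_one₀ (h i) (norm_nonneg _) (h j)
  have h1 : ∀ x : Ctx d, (u ⬝ᵥ x.ofLp) ^ 2 = ∑ i, ∑ j, u i * (x i * x j * u j) := by
    intro x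
    rw [sq, dotProduct, Finset.sum_mul_sum]
    exact Finset.sum_congr rfl fun i _ => Finset.sum_congr rfl fun j _ => by ring
  simp only [h1]
  rw [integral_finsetSum _ fun i _ => integrable_finsetSum _ fun j _ => hi i j]
  simp only [dotProduct, Matrix.mulVec, secondMoment, Matrix.of_apply]
  refine Finset.sum_congr rfl fun i _ => ?_
  rw [integral_finsetSum _ fun j _ => hi i j, Finset.mul_sum]
  refine Finset.sum_congr rfl fun j _ => ?_
  rw [integral_const_mul, integral_mul_const]

theorem minEigenvalue_mul_le_integral (hD : ∀ᵐ x ∂D, ‖x‖ ≤ 1) (hS : (secondMoment D).PosDef)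
    (u : Fin d → ℝ) :
    minEigenvalue (secondMoment D) * (u ⬝ᵥ u) ≤ ∫ x, (u ⬝ᵥ x.ofLp) ^ 2 ∂D :=
  integral_dotProduct_sq hD u ▸ minEigenvalue_mul_le hS u

theorem integral_pathRegret_le_horizon (hd : 1 ≤ d) (hK : 2 ≤ K) (hT : 2 ≤ T)
    (hD : ∀ᵐ x ∂D, ‖x‖ ≤ 1) (hS : (secondMoment D).PosDef)
    (hl : ∀ t ∈ Finset.Icc 1 T, LinearRound D (ν t) (ℓ t) (θ t)) (hπ : Measurable π) :
    ∫ ω, pathRegret T (minEigenvalue (secondMoment D)) ℓ π ω ∂(pathLaw D ν) ≤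
      60 * √(T * K * (d + Real.log T / minEigenvalue (secondMoment D)) * Real.log T *
        Real.log K) := by
  have hlam := minEigenvalue_pos hd hS
  have hk := log_natCast_ge hK
  have hlT := log_natCast_ge hT
  have h := integral_pathRegret_le_sqrt hd hK hT hlam hD (minEigenvalue_mul_le_integral hD hS)
    hl hπ
  set lam := minEigenvalue (secondMoment D) with hlamdef
  refine le_of_le_sqrt_horizon (by exact_mod_cast hK) (by exact_mod_cast hd)
    (div_nonneg (by linarith) hlam.le) hk (Real.log_le_self (Nat.cast_nonneg K)) hlT
    (by exact_mod_cast hT) (integral_pathRegret_le_two_mul hD hl hπ) (h.trans ?_)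
  have hE : ∫ ω, (stateAfter T lam ℓ ω T).cumEntropy ∂(pathLaw D ν) ≤ T * Real.log K := by
    have := integral_mono (integrable_cumEntropy (D := D) (ν := ν) (lam := lam)
      fun t ht => (hl t ht).meas) (integrable_const (T * Real.log K)) fun ω => cumEntropy_le ω T
    simpa using this
  rw [mul_div_assoc (2 * (K : ℝ))]
  gcongr

/-- Positivity rules out the default infimum `0` of a set unbounded below, so the infimum is a
genuine lower bound. -/
theorem inner_le_of_minGap_pos {𝒳 : Set (Ctx d)} {θ₀ : Fin K → Ctx d} (h : 0 < minGap 𝒳 θ₀ π)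
    {x : Ctx d} (hx : x ∈ 𝒳) {a : Fin K} (ha : a ≠ π x) :
    minGap 𝒳 θ₀ π ≤ ⟪x, θ₀ a - θ₀ (π x)⟫ := by
  refine csInf_le ?_ ⟨x, hx, a, ha, rfl⟩
  by_contra hb
  exact h.ne' (Real.sInf_of_not_bddBelow hb)

theorem integral_pathRegret_le_gap (hd : 1 ≤ d) (hK : 2 ≤ K) (hT : 2 ≤ T)
    {𝒳 : Set (Ctx d)} (hX : ∀ᵐ x ∂D, x ∈ 𝒳)
    (hD : ∀ᵐ x ∂D, ‖x‖ ≤ 1) (hS : (secondMoment D).PosDef)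
    (hl : ∀ t ∈ Finset.Icc 1 T, LinearRound D (ν t) (ℓ t) (θ t)) (hπ : Measurable π)
    {θ₀ : Fin K → Ctx d} {C : ℝ} (hC : ∑ t ∈ Finset.Icc 1 T, ⨆ a, ‖θ t a - θ₀ a‖ ≤ C)
    (hΔ : 0 < minGap 𝒳 θ₀ π) :
    ∫ ω, pathRegret T (minEigenvalue (secondMoment D)) ℓ π ω ∂(pathLaw D ν) ≤
      2500 * (K * (d + Real.log T / minEigenvalue (secondMoment D)) * Real.log (K * T) *
          Real.log T / minGap 𝒳 θ₀ π +
        √(K * (d + Real.log T / minEigenvalue (secondMoment D)) * Real.log (K * T) *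
          Real.log T / minGap 𝒳 θ₀ π * C)) := by
  have hlam := minEigenvalue_pos hd hS
  have hk := log_natCast_ge hK
  have hlT := log_natCast_ge hT
  have hL : Real.log (K * T) = Real.log K + Real.log T :=
    Real.log_mul (by positivity) (by positivity)
  set δ : ℕ → ℝ := fun t => ⨆ a, ‖θ t a - θ₀ a‖ with hδdef
  have hδ : ∀ t a, ‖θ t a - θ₀ a‖ ≤ δ t := fun t a =>
    le_ciSup (f := fun a => ‖θ t a - θ₀ a‖) (Set.finite_range _).bddAbove a
  have hC0 : 0 ≤ C := (Finset.sum_nonneg fun t _ => (norm_nonneg _).trans (hδ t 0)).trans hC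
  have hgap : ∀ᵐ x ∂D, ∀ a ≠ π x, minGap 𝒳 θ₀ π ≤ ⟪x, θ₀ a - θ₀ (π x)⟫ :=
    hX.mono fun x hx a ha => inner_le_of_minGap_pos hΔ hx ha
  have hv : 0 ≤ Real.log T / minEigenvalue (secondMoment D) :=
    div_nonneg (by linarith) hlam.le
  rcases le_total (minGap 𝒳 θ₀ π) 4 with h4 | h4
  · have h := integral_pathRegret_le_sqrt hd hK hT hlam hD (minEigenvalue_mul_le_integral hD hS)
      hl hπ
    have hsum : ∑ n ∈ Finset.range T, δ (n + 1) ≤ C := by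
      rw [Finset.range_eq_Ico, Finset.sum_Ico_add' δ 0 T 1]
      exact hC
    have hE := integral_cumEntropy_le hK hT hlam hD hl hπ hΔ hgap hδ hsum
    rw [mul_div_assoc (2 * (K : ℝ))] at h
    exact le_of_le_sqrt_gap (by exact_mod_cast hK) (by exact_mod_cast hd) hv hk (by linarith)
      (by linarith) hlT hΔ h4 hC0 hE h
  -- For unit-norm-bounded parameters, `Δ ≤ ‖θ₀ a‖ + ‖θ₀ (π x)‖ ≤ 2 + 2δ_t`; with `Δ ≥ 4` this gives
  -- `δ_t ≥ Δ/4` in every round.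
  · have h := integral_pathRegret_le_horizon hd hK hT hD hS hl hπ
    obtain ⟨x, hx, hgx⟩ := (hD.and hgap).exists
    have : Nontrivial (Fin K) := Fin.nontrivial_iff_two_le.2 hK
    obtain ⟨a, ha⟩ := exists_ne (π x)
    have hδ4 : ∀ t ∈ Finset.Icc 1 T, minGap 𝒳 θ₀ π / 4 ≤ δ t := by
      intro t ht
      have h1 : ∀ b, ‖θ₀ b‖ ≤ 1 + δ t := fun b => by
        have e1 := norm_sub_norm_le (θ₀ b) (θ t b)
        rw [norm_sub_rev] at e1
        linarith [hδ t b, (hl t ht).norm_le b]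
      have h2 : ⟪x, θ₀ a - θ₀ (π x)⟫ ≤ ‖θ₀ a‖ + ‖θ₀ (π x)‖ :=
        (real_inner_le_norm _ _).trans ((mul_le_of_le_one_left (norm_nonneg _) hx).trans
          (norm_sub_le _ _))
      linarith [hgx a ha, h1 a, h1 (π x)]
    have hTC : T * minGap 𝒳 θ₀ π ≤ 4 * C := by
      have e := (Finset.sum_le_sum hδ4).trans hC
      rw [Finset.sum_const, Nat.card_Icc, nsmul_eq_mul, Nat.add_sub_cancel] at e
      linarith
    rw [mul_assoc (T : ℝ) K] at h
    have h5 := le_of_gap_large (L := Real.log (K * T)) (by positivity) (by linarith)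
      (by linarith) (by linarith) (Nat.cast_nonneg T) hΔ hTC h
    have h6 : 0 ≤ K * (d + Real.log T / minEigenvalue (secondMoment D)) * Real.log (K * T) *
        Real.log T / minGap 𝒳 θ₀ π := by
      rw [hL]
      have : 0 ≤ Real.log K + Real.log T := by linarith
      have : 0 ≤ Real.log T := by linarith
      positivity
    linarith [Real.sqrt_nonneg (K * (d + Real.log T / minEigenvalue (secondMoment D)) *
      Real.log (K * T) * Real.log T / minGap 𝒳 θ₀ π * C)]

theorem linearRound_noisyLoss {𝒳 : Set (Ctx d)} (hX : ∀ᵐ x ∂D, x ∈ 𝒳) {ε : Loss d K W} {t : ℕ}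
    (hm : ∀ a, Measurable fun p : W × Ctx d => ε t p.1 p.2 a)
    (h0 : ∀ x ∈ 𝒳, ∀ a, ∫ w, ε t w x a ∂(ν t) = 0) (hθ : ∀ a, ‖θ t a‖ ≤ 1)
    (hb : ∀ x ∈ 𝒳, ∀ a, ∀ᵐ w ∂(ν t), |noisyLoss θ ε t w x a| ≤ 1) :
    LinearRound D (ν t) (noisyLoss θ ε t) (θ t) where
  meas a := (measurable_snd.inner measurable_const).add (hm a)
  mean := by
    filter_upwards [hX] with x hx a
    have hmx : Measurable fun w => ε t w x a := (hm a).comp (measurable_id.prodMk measurable_const)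
    -- The noise is a difference of two bounded quantities, the total loss and its fixed linear
    -- part.
    have hi : Integrable (fun w => ε t w x a) (ν t) := by
      refine Integrable.of_bound hmx.aestronglyMeasurable (1 + |⟪x, θ t a⟫|) ?_
      filter_upwards [hb x hx a] with w hw
      have h := abs_sub (noisyLoss θ ε t w x a) ⟪x, θ t a⟫
      unfold noisyLoss at h hw
      rw [add_sub_cancel_left] at h
      exact h.trans (by linarith)
    unfold noisyLoss
    rw [integral_add (integrable_const _) hi, h0 x hx a]
    simp
  bound := hX.mono hb
  norm_le := hθ

theorem linearRound_linearLoss {𝒳 : Set (Ctx d)} (hX : ∀ᵐ x ∂D, x ∈ 𝒳) {t : ℕ}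
    (hθ : ∀ a, ‖θ t a‖ ≤ 1) (hb : ∀ x ∈ 𝒳, ∀ a, |⟪x, θ t a⟫| ≤ 1) :
    LinearRound D (Measure.dirac ()) (linearLoss θ t) (θ t) where
  meas a := measurable_snd.inner measurable_const
  mean := Filter.Eventually.of_forall fun x a => by simp [linearLoss]
  bound := hX.mono fun x hx a => Filter.Eventually.of_forall fun _ => hb x hx a
  norm_le := hθ

end Regimes

end LinCB

/-! ### The two regret bounds with a common constant -/

theorem mainTheorem3 :
    ∃ c : ℝ, 0 < c ∧
      ∀ (d K T : ℕ) [NeZero K], 1 ≤ d → 2 ≤ K → 2 ≤ T →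
      ∀ (𝒳 : Set (LinCB.Ctx d)) (D : Measure (LinCB.Ctx d)) [IsProbabilityMeasure D],
        IsCompact 𝒳 → (∀ᵐ x ∂D, x ∈ 𝒳) → (∀ᵐ x ∂D, ‖x‖ ≤ 1) →
        (LinCB.secondMoment D).PosDef →
        -- adversarial regime
        (∀ θ : ℕ → Fin K → LinCB.Ctx d,
          (∀ t ∈ Finset.Icc 1 T, ∀ a, ‖θ t a‖ ≤ 1) →
          (∀ t ∈ Finset.Icc 1 T, ∀ x ∈ 𝒳, ∀ a, |⟪x, θ t a⟫| ≤ 1) →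
          ∀ π : LinCB.Ctx d → Fin K, Measurable π →
            LinCB.IsOptimalPolicy 𝒳 T (fun _ => Measure.dirac ()) (LinCB.linearLoss θ) π →
            LinCB.RegretLE D T (fun _ => Measure.dirac ()) (LinCB.linearLoss θ) π
              (c * √(T * K * (d + Real.log T / LinCB.minEigenvalue (LinCB.secondMoment D))
                * Real.log T * Real.log K))) ∧
        -- corrupted stochastic regime
        (∀ (W : Type*) [MeasurableSpace W] (ν : ℕ → Measure W) [∀ t, IsProbabilityMeasure (ν t)]
          (ε : LinCB.Loss d K W) (θ : ℕ → Fin K → LinCB.Ctx d) (θ₀ : Fin K → LinCB.Ctx d) (C : ℝ),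
          (∀ t ∈ Finset.Icc 1 T, ∀ a, Measurable fun p : W × LinCB.Ctx d => ε t p.1 p.2 a) →
          (∀ t ∈ Finset.Icc 1 T, ∀ x ∈ 𝒳, ∀ a, ∫ w, ε t w x a ∂(ν t) = 0) →
          (∀ t ∈ Finset.Icc 1 T, ∀ a, ‖θ t a‖ ≤ 1) →
          (∀ t ∈ Finset.Icc 1 T, ∀ x ∈ 𝒳, ∀ a, ∀ᵐ w ∂(ν t), |LinCB.noisyLoss θ ε t w x a| ≤ 1) →
          ∑ t ∈ Finset.Icc 1 T, ⨆ a, ‖θ t a - θ₀ a‖ ≤ C →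
          ∀ π : LinCB.Ctx d → Fin K, Measurable π →
            LinCB.IsOptimalPolicy 𝒳 T ν (LinCB.noisyLoss θ ε) π →
            0 < LinCB.minGap 𝒳 θ₀ π →
            LinCB.RegretLE D T ν (LinCB.noisyLoss θ ε) π
              (c * (K * (d + Real.log T / LinCB.minEigenvalue (LinCB.secondMoment D))
                    * Real.log (K * T) * Real.log T / LinCB.minGap 𝒳 θ₀ π
                + √(K * (d + Real.log T / LinCB.minEigenvalue (LinCB.secondMoment D))
                    * Real.log (K * T) * Real.log T / LinCB.minGap 𝒳 θ₀ π * C)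
                + K * Real.log T *
                  √(1 / LinCB.minEigenvalue (LinCB.secondMoment D)
                    * (d + Real.log T / LinCB.minEigenvalue (LinCB.secondMoment D))
                    * Real.log K * Real.log (K * T) / LinCB.minGap 𝒳 θ₀ π)))) := by
  refine ⟨2500, by norm_num, fun d K T _ hd hK hT 𝒳 D _ _ hX hD hS => ⟨?_, ?_⟩⟩
  · intro θ hθ hb π hπ _
    have hl := fun t ht => LinCB.linearRound_linearLoss hX (hθ t ht) (hb t ht)
    refine ⟨LinCB.integrable_pathRegret (ν := fun _ => Measure.dirac ()) hD hl hπ,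
      (LinCB.integral_pathRegret_le_horizon (ν := fun _ => Measure.dirac ()) hd hK hT hD hS
        hl hπ).trans ?_⟩
    exact mul_le_mul_of_nonneg_right (by norm_num) (Real.sqrt_nonneg _)
  · intro W _ ν _ ε θ θ₀ C hm h0 hθ hb hC π hπ _ hΔ
    have hl := fun t ht => LinCB.linearRound_noisyLoss (ν := ν) hX (hm t ht) (h0 t ht) (hθ t ht)
      (hb t ht)
    refine ⟨LinCB.integrable_pathRegret hD hl hπ,
      (LinCB.integral_pathRegret_le_gap hd hK hT hX hD hS hl hπ hC hΔ).trans ?_⟩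
    -- The first two terms already bound the regret; the third is nonnegative and only enlarges the
    -- right side.
    refine mul_le_mul_of_nonneg_left (le_add_of_nonneg_right ?_) (by norm_num)
    exact mul_nonneg (mul_nonneg (Nat.cast_nonneg K) (Real.log_natCast_nonneg T))
      (Real.sqrt_nonneg _)
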